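/- **Setting.** Let $dx$ be the surface measure on $\mathbb S^2$, $P_\ell$ the Legendre polynomials, and $\{Y_{\ell,m}:\ell\ge 0,\ -\ell\le m\le \ell\}$ the standard real orthonormal spherical harmonics. Let $Z=\{Z(x,t):x\in\mathbb S^2,\ t\in\mathbb Z\}$ be a Gaussian spherical white noise: the fields $Z(\cdot,t)$, $t\in\mathbb Z$, are i.i.d. centered isotropic Gaussian fields with covariance function $\Gamma_Z(x,y)=\sum_{\ell\ge0}\frac{2\ell+1}{4\pi}C_{\ell;Z}P_\ell(\langle x,y\rangle)$, where $C_{\ell;Z}>0$ for all $\ell$ and $\sum_\ell \frac{2\ell+1}{4\pi}C_{\ell;Z}<\infty$. Let $k_1,\dots,k_p:[-1,1]\to\mathbb R$ be continuous, with Legendre expansion $k_j=\sum_{\ell\ge 0}\phi_{\ell;j}\frac{2\ell+1}{4\pi}P_\ell$, i.e. $\phi_{\ell;j}=2\pi\int_{-1}^1k_j(z)P_\ell(z)\,dz$. Let $T=\{T(x,t):x\in\mathbb S^2,\ t\in\mathbb Z\}$ be a real, centered, mean-square continuous Gaussian field, isotropic in space and stationary in time ($T(R\,\cdot,\cdot+\tau)\overset{d}{=}T(\cdot,\cdot)$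 for $R\in SO(3)$, $\tau\in\mathbb Z$), with $$T(x,t)=\sum_{j=1}^p\int_{\mathbb S^2}k_j(\langle x,y\rangle)\,T(y,t-j)\,dy+Z(x,t).$$ (Both fields are jointly measurable in the point of the sphere and the random outcome.) Put $\phi_\ell(z)=1-\sum_{j=1}^p\phi_{\ell;j}z^j$ and assume $\phi_\ell(z)\neq0$ for all $\ell\ge0$ and all $z\in\mathbb C$ with $|z|\le1$. Let $\mu_{\min;\ell}$ and $\mu_{\max;\ell}$ be the minimum and the maximum of $|\phi_\ell(z)|^2$ over $|z|=1$. Let $a_{\ell,m}(t)=\int_{\mathbb S^2}T(x,t)Y_{\ell,m}(x)\,dx$ and $a_{\ell,m;Z}(t)=\int_{\mathbb S^2}Z(x,t)Y_{\ell,m}(x)\,dx$. Let $\tilde a_{\ell,m}(t)=(a_{\ell,m}(t),\dots,a_{\ell,m}(t-p+1))'$, $\Gamma_\ell(\tau)=\mathbb E[\tilde a_{\ell,m}(t+\tau)\tilde a_{\ell,m}(t)']$ (which does not depend on $m$ and $t$), $\Gamma_\ell=\Gamma_\ell(0)$, and $\tilde f_\ell(\nu)=\frac1{2\pi}\sum_{\tau\in\mathbb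 Z}\Gamma_\ell(\tau)e^{-i\tau\nu}$. For an integer $r\ge1$ put $$\mathcal M(\tilde f_\ell,r)=\max_{\emptyset\ne J\subseteq\{1,\dots,p\},\,|J|\le r}\ \max_{\nu\in[-\pi,\pi]}\Lambda_{\max}\big(\tilde f^J_\ell(\nu)\big),$$ where $\tilde f_\ell^J(\nu)$ is the submatrix of $\tilde f_\ell(\nu)$ with rows and columns in $J$ and $\Lambda_{\max}$ is the largest eigenvalue. The observations are $a_{\ell,m}(t)$ for $-\ell\le m\le\ell$ and $t=1,\dots,n$, where $n=N+p$ and $N\ge1$. For $1\le h\le p$ let $\mathbf Y_{\ell,N}(h)$ be the $N(2\ell+1)$-dimensional vector of the $a_{\ell,m}(t-h)$, and $\mathbf E_{\ell,N}$ that of the $a_{\ell,m;Z}(t)$, with $-\ell\le m\le\ell$ and $p+1\le t\le n$ in the same order. Let $X_{\ell,N}$ be the matrix with columns $\mathbf Y_{\ell,N}(1),\dots,\mathbf Y_{\ell,N}(p)$, and $\widehat\Gamma_{\ell,N}=X_{\ell,N}'X_{\ell,N}/(N(2\ell+1))$. **Proposition (Deviation bounds).** There is an absolute constant $c>0$ such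 that, in every such setting and for all $\ell\ge0$, $N\ge1$, $\eta\ge0$, the following hold. 1. For every integer $r\ge1$ and all $u,v\in\mathbb R^p$ with at most $r$ nonzero coordinates and Euclidean norms $\|u\|,\|v\|\le1$, $$\mathbb P\big(|v'(\widehat\Gamma_{\ell,N}-\Gamma_\ell)v|>2\pi\mathcal M(\tilde f_\ell,r)\,\eta\big)\le 2e^{-cN(2\ell+1)\min\{\eta^2,\eta\}},$$ $$\mathbb P\big(|u'(\widehat\Gamma_{\ell,N}-\Gamma_\ell)v|>6\pi\mathcal M(\tilde f_\ell,2r)\,\eta\big)\le 6e^{-cN(2\ell+1)\min\{\eta^2,\eta\}}.$$ 2. For all $i,j\in\{1,\dots,p\}$, $$\mathbb P\big(|(\widehat\Gamma_{\ell,N}-\Gamma_\ell)_{ij}|>6\pi\mathcal M(\tilde f_\ell,2)\,\eta\big)\le 6e^{-cN(2\ell+1)\min\{\eta^2,\eta\}}.$$ 3. For all $1\le h\le p$, $$\mathbb P\left(\left|\frac{\mathbf Y_{\ell,N}(h)'\mathbf E_{\ell,N}}{N(2\ell+1)}\right|>2\pi\,C_{\ell;Z}\left(1+\frac{1+\mu_{\max;\ell}}{\mu_{\min;\ell}}\right)\eta\right)\le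 6e^{-cN(2\ell+1)\min\{\eta^2,\eta\}}.$$ -/

import Mathlib

open MeasureTheory ProbabilityTheory Filter
open scoped Topology Matrix

noncomputable section

namespace SphericalAR

/-! ### The sphere and its harmonics -/

/-- The ambient Euclidean space `ℝ³`. -/
abbrev R3 : Type := EuclideanSpace ℝ (Fin 3)

/-- The unit sphere `𝕊²`. -/
abbrev Sphere2 : Type := Metric.sphere (0 : R3) 1

/-- The surface (spherical Lebesgue) measure `dx = sin θ dθ dφ`, of total mass `4π`. -/
def surface : Measure Sphere2 := (volume : Measure R3).toSphere

/-- Cosine `⟨x, y⟩` of the angle between two points of the sphere. -/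
def cosAngle (x y : Sphere2) : ℝ := inner ℝ (x : R3) (y : R3)

/-- The image of a point of the sphere under a linear isometry of `ℝ³`. -/
def rotate (R : R3 ≃ₗᵢ[ℝ] R3) (x : Sphere2) : Sphere2 :=
  ⟨R (x : R3), by
    have hx : ‖(x : R3)‖ = 1 := mem_sphere_zero_iff_norm.1 x.2
    rw [mem_sphere_zero_iff_norm, R.norm_map, hx]⟩

/-- `R` belongs to the rotation group `SO(3)`. -/
def IsRotation (R : R3 ≃ₗᵢ[ℝ] R3) : Prop :=
  LinearMap.det (R.toLinearEquiv : R3 →ₗ[ℝ] R3) = 1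

/-- The polynomial `(1 / (2^ℓ ℓ!)) (d/du)^(ℓ+m) (u² - 1)^ℓ`. -/
def rodrigues (ℓ m : ℕ) : Polynomial ℝ :=
  Polynomial.C (1 / ((2 : ℝ) ^ ℓ * (ℓ.factorial : ℝ))) *
    Polynomial.derivative^[ℓ + m] ((Polynomial.X ^ 2 - 1) ^ ℓ)

/-- The Legendre polynomial `P_ℓ`. -/
def legendreP (ℓ : ℕ) (u : ℝ) : ℝ := (rodrigues ℓ 0).eval u

/-- The associated Legendre function `P_{ℓ,m}(u) = (1 - u²)^(m/2) · (1/(2^ℓ ℓ!)) (d/du)^(ℓ+m) (u² - 1)^ℓ`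
for `u ∈ [-1,1]` and `m ≥ 0`. -/
def assocLegendre (ℓ m : ℕ) (u : ℝ) : ℝ := √(1 - u ^ 2) ^ m * (rodrigues ℓ m).eval u

/-- `cos θ` for the point `x = (sin θ cos φ, sin θ sin φ, cos θ)`. -/
def cosColat (x : Sphere2) : ℝ := (x : R3) 2

/-- The longitude `φ` of the point `x = (sin θ cos φ, sin θ sin φ, cos θ)`, normalised to `(-π, π]`. -/
def longitude (x : Sphere2) : ℝ := Complex.arg ⟨(x : R3) 0, (x : R3) 1⟩

/-- The real spherical harmonic `Y_{ℓ,m}`, for `-ℓ ≤ m ≤ ℓ`. -/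
def sphHarm (ℓ : ℕ) (m : ℤ) (x : Sphere2) : ℝ :=
  let q : ℕ := m.natAbs
  let norm : ℝ := (((ℓ - q).factorial : ℕ) : ℝ) / (((ℓ + q).factorial : ℕ) : ℝ)
  if 0 < m then
    √((2 * ℓ + 1) / (2 * Real.pi) * norm) * assocLegendre ℓ q (cosColat x) *
      Real.cos (q * longitude x)
  else if m = 0 then
    √((2 * ℓ + 1) / (4 * Real.pi)) * legendreP ℓ (cosColat x)
  else
    √((2 * ℓ + 1) / (2 * Real.pi) * norm) * assocLegendre ℓ q (cosColat x) *
      Real.sin (q * longitude x)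

/-! ### Random fields on sphere cross time -/

variable {Ω : Type*} [MeasurableSpace Ω]

/-- The harmonic coefficient `a_{ℓ,m}(t) = ∫_{𝕊²} F(x,t) Y_{ℓ,m}(x) dx` of a random field `F`. -/
def harmCoeff (F : Sphere2 → ℤ → Ω → ℝ) (ℓ : ℕ) (m : ℤ) (t : ℤ) (ω : Ω) : ℝ :=
  ∫ x, F x t ω * sphHarm ℓ m x ∂surface

/-- `Z` is a Gaussian spherical white noise with angular power spectrum `C_{ℓ;Z} = CZ ℓ`: the fields
`Z(·,t)`, `t ∈ ℤ`, are independent and identically distributed, isotropic, centered Gaussian, with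
covariance function `Γ_Z(x,y) = ∑_ℓ (2ℓ+1)/(4π) C_{ℓ;Z} P_ℓ(⟨x,y⟩)`. -/
structure IsSphericalWhiteNoise (P : Measure Ω) (CZ : ℕ → ℝ) (Z : Sphere2 → ℤ → Ω → ℝ) : Prop where
  measurable : ∀ t, Measurable (fun q : Sphere2 × Ω => Z q.1 t q.2)
  gaussian : ∀ t, IsGaussianProcess (fun x ω => Z x t ω) P
  centered : ∀ x t, ∫ ω, Z x t ω ∂P = 0
  isotropic : ∀ R, IsRotation R → ∀ t,
    IdentDistrib (fun ω (x : Sphere2) => Z (rotate R x) t ω) (fun ω (x : Sphere2) => Z x t ω) P P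
  indep : iIndepFun (fun (t : ℤ) ω (x : Sphere2) => Z x t ω) P
  identDistrib : ∀ t s,
    IdentDistrib (fun ω (x : Sphere2) => Z x t ω) (fun ω (x : Sphere2) => Z x s ω) P P
  power_pos : ∀ ℓ, 0 < CZ ℓ
  power_summable : Summable (fun ℓ : ℕ => (2 * (ℓ : ℝ) + 1) / (4 * Real.pi) * CZ ℓ)
  covariance : ∀ x y t,
    HasSum (fun ℓ : ℕ => (2 * (ℓ : ℝ) + 1) / (4 * Real.pi) * CZ ℓ * legendreP ℓ (cosAngle x y))
      (∫ ω, Z x t ω * Z y t ω ∂P)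

/-- The eigenvalue `φ_{ℓ;j}` of the operator with kernel `k_j(⟨x,y⟩)`: the coefficient of `k_j` in
the expansion `k_j = ∑_ℓ φ_{ℓ;j} (2ℓ+1)/(4π) P_ℓ`, where `∫_{-1}^1 P_ℓ P_{ℓ'} = 2/(2ℓ+1) δ_{ℓℓ'}`. -/
def kernelCoeff (kj : ℝ → ℝ) (ℓ : ℕ) : ℝ :=
  2 * Real.pi * ∫ z in (-1 : ℝ)..1, kj z * legendreP ℓ z

/-- The associated polynomial `φ_ℓ(z) = 1 - φ_{ℓ;1} z - ⋯ - φ_{ℓ;p} z^p`. The index `j : Fin p`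
stands for the lag `j + 1`. -/
def arPoly {p : ℕ} (k : Fin p → ℝ → ℝ) (ℓ : ℕ) (z : ℂ) : ℂ :=
  1 - ∑ j : Fin p, (kernelCoeff (k j) ℓ : ℂ) * z ^ ((j : ℕ) + 1)

/-- The autoregressive operator `(Φ f)(x) = ∫_{𝕊²} κ(⟨x,y⟩) f(y) dy`. -/
def kernelOp (κ : ℝ → ℝ) (f : Sphere2 → ℝ) (x : Sphere2) : ℝ :=
  ∫ y, κ (cosAngle x y) * f y ∂surface

/-- `T` is a spherical autoregressive process of order `p`, with continuous isotropic kernels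
`k_1, …, k_p` and driven by the Gaussian spherical white noise `Z`: it is a real, centered,
mean-square continuous Gaussian field, isotropic in space and stationary in time, which solves
`T(x,t) = ∑_j (Φ_j T(·,t-j))(x) + Z(x,t)`, and none of the polynomials `φ_ℓ` has a root in the
closed unit disk. The equation is required only for almost every `x`, almost surely. -/
structure IsSPHAR {p : ℕ} (P : Measure Ω) (k : Fin p → ℝ → ℝ) (CZ : ℕ → ℝ)
    (T Z : Sphere2 → ℤ → Ω → ℝ) : Prop where
  noise : IsSphericalWhiteNoise P CZ Z
  kernel_continuous : ∀ j, ContinuousOn (k j) (Set.Icc (-1) 1)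
  measurable : ∀ t, Measurable (fun q : Sphere2 × Ω => T q.1 t q.2)
  gaussian : IsGaussianProcess (fun (q : Sphere2 × ℤ) ω => T q.1 q.2 ω) P
  centered : ∀ x t, ∫ ω, T x t ω ∂P = 0
  meanSquare_continuous : ∀ x t,
    Tendsto (fun y => ∫ ω, (T y t ω - T x t ω) ^ 2 ∂P) (𝓝 x) (𝓝 0)
  isotropic_stationary : ∀ R, IsRotation R → ∀ τ : ℤ,
    IdentDistrib (fun ω (q : Sphere2 × ℤ) => T (rotate R q.1) (q.2 + τ) ω)
      (fun ω (q : Sphere2 × ℤ) => T q.1 q.2 ω) P P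
  equation : ∀ t, ∀ᵐ ω ∂P, ∀ᵐ x ∂surface,
    T x t ω = ∑ j : Fin p, kernelOp (k j) (fun y => T y (t - ((j : ℕ) + 1)) ω) x + Z x t ω
  no_roots : ∀ (ℓ : ℕ) (z : ℂ), ‖z‖ ≤ 1 → arPoly k ℓ z ≠ 0

/-- `μ_{min;ℓ} = min_{|z|=1} |φ_ℓ(z)|²`. -/
def muMin {p : ℕ} (k : Fin p → ℝ → ℝ) (ℓ : ℕ) : ℝ := ⨅ z : Circle, ‖arPoly k ℓ z‖ ^ 2

/-- `μ_{max;ℓ} = max_{|z|=1} |φ_ℓ(z)|²`. -/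
def muMax {p : ℕ} (k : Fin p → ℝ → ℝ) (ℓ : ℕ) : ℝ := ⨆ z : Circle, ‖arPoly k ℓ z‖ ^ 2

/-! ### Autocovariances, spectral density and stability measure -/

/-- The `p`-dimensional process `ã_{ℓ,m}(t) = (a_{ℓ,m}(t), …, a_{ℓ,m}(t-p+1))'`. -/
def stacked (p : ℕ) (T : Sphere2 → ℤ → Ω → ℝ) (ℓ : ℕ) (m : ℤ) (t : ℤ) (ω : Ω) : Fin p → ℝ :=
  fun i => harmCoeff T ℓ m (t - (i : ℕ)) ω

/-- `Γ_ℓ(τ) = 𝔼[ã_{ℓ,m}(t+τ) ã_{ℓ,m}(t)']`. By isotropy and stationarity this does not depend on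
`m` and `t`; it is computed here at `m = 0` and `t = 0`. -/
def autocov (P : Measure Ω) (p : ℕ) (T : Sphere2 → ℤ → Ω → ℝ) (ℓ : ℕ) (τ : ℤ) :
    Matrix (Fin p) (Fin p) ℝ :=
  Matrix.of fun i j => ∫ ω, stacked p T ℓ 0 τ ω i * stacked p T ℓ 0 0 ω j ∂P

/-- The covariance matrix `Γ_ℓ = Γ_ℓ(0)`. -/
def covMatrix (P : Measure Ω) (p : ℕ) (T : Sphere2 → ℤ → Ω → ℝ) (ℓ : ℕ) :
    Matrix (Fin p) (Fin p) ℝ :=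
  autocov P p T ℓ 0

/-- The matrix spectral density `f̃_ℓ(ν) = (1/2π) ∑_{τ ∈ ℤ} Γ_ℓ(τ) e^{-iτν}`. -/
def specDensity (P : Measure Ω) (p : ℕ) (T : Sphere2 → ℤ → Ω → ℝ) (ℓ : ℕ) (ν : ℝ) :
    Matrix (Fin p) (Fin p) ℂ :=
  Matrix.of fun i j => (1 / (2 * Real.pi) : ℂ) *
    ∑' τ : ℤ, (autocov P p T ℓ τ i j : ℂ) * Complex.exp (-(Complex.I * (τ : ℂ) * (ν : ℂ)))

/-- The largest (real) eigenvalue of a Hermitian matrix. -/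
def lambdaMax {ι : Type*} [Fintype ι] [DecidableEq ι] (A : Matrix ι ι ℂ) : ℝ :=
  sSup (spectrum ℝ A)

/-- The stability measure `ℳ(f̃^J_ℓ) = max_{ν ∈ [-π,π]} Λ_max(f̃^J_ℓ(ν))` of the subprocess of `ã_ℓ`
with components in `J`. -/
def stabilitySub (P : Measure Ω) (p : ℕ) (T : Sphere2 → ℤ → Ω → ℝ) (ℓ : ℕ) (J : Finset (Fin p)) :
    ℝ :=
  ⨆ ν : Set.Icc (-Real.pi) Real.pi,
    lambdaMax ((specDensity P p T ℓ (ν : ℝ)).submatrix (Subtype.val : J → Fin p) Subtype.val)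

/-- The stability measure `ℳ(f̃_ℓ, r) = max_{∅ ≠ J ⊆ {1,…,p}, |J| ≤ r} ℳ(f̃^J_ℓ)`. For `r ≥ p` all
nonempty `J` are allowed. -/
def stability (P : Measure Ω) (p : ℕ) (T : Sphere2 → ℤ → Ω → ℝ) (ℓ r : ℕ) : ℝ :=
  ⨆ J : {J : Finset (Fin p) // J.Nonempty ∧ J.card ≤ r}, stabilitySub P p T ℓ J.1

/-! ### Observations, sample covariance and empirical process -/

/-- Index set of the observation vectors: a degree `m ∈ {-ℓ,…,ℓ}` and a position `i ∈ {0,…,N-1}`,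
which stands for the time `n - i ∈ {p+1,…,n}`, where `n = N + p`. -/
abbrev ObsIndex (ℓ N : ℕ) : Type := (Finset.Icc (-(ℓ : ℤ)) (ℓ : ℤ)) × Fin N

/-- The time `n - i`, where `n = N + p`. -/
def obsTime (p N : ℕ) (i : Fin N) : ℤ := (N : ℤ) + p - ((i : ℕ) : ℤ)

/-- The vector `Y_{ℓ,N}(h)` of the lagged observations `a_{ℓ,m}(t-h)`, `t = p+1,…,n`. -/
def laggedObs (p : ℕ) (T : Sphere2 → ℤ → Ω → ℝ) (ℓ N h : ℕ) (ω : Ω) : ObsIndex ℓ N → ℝ :=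
  fun q => harmCoeff T ℓ q.1 (obsTime p N q.2 - (h : ℤ)) ω

/-- The noise vector `E_{ℓ,N}` of the `a_{ℓ,m;Z}(t)`, `t = p+1,…,n`. -/
def noiseObs (p : ℕ) (Z : Sphere2 → ℤ → Ω → ℝ) (ℓ N : ℕ) (ω : Ω) : ObsIndex ℓ N → ℝ :=
  fun q => harmCoeff Z ℓ q.1 (obsTime p N q.2) ω

/-- The design matrix `X_{ℓ,N}` with columns `Y_{ℓ,N}(1), …, Y_{ℓ,N}(p)`. -/
def designMatrix (p : ℕ) (T : Sphere2 → ℤ → Ω → ℝ) (ℓ N : ℕ) (ω : Ω) :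
    Matrix (ObsIndex ℓ N) (Fin p) ℝ :=
  Matrix.of fun q j => laggedObs p T ℓ N ((j : ℕ) + 1) ω q

/-- The sample covariance `Γ̂_{ℓ,N} = X_{ℓ,N}' X_{ℓ,N} / (N(2ℓ+1))`. -/
def sampleCov (p : ℕ) (T : Sphere2 → ℤ → Ω → ℝ) (ℓ N : ℕ) (ω : Ω) : Matrix (Fin p) (Fin p) ℝ :=
  ((N : ℝ) * (2 * ℓ + 1))⁻¹ • ((designMatrix p T ℓ N ω)ᵀ * designMatrix p T ℓ N ω)

/-- The `h`-th component `Y_{ℓ,N}(h)' E_{ℓ,N} / (N(2ℓ+1))` of the empirical process. -/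
def empComponent (p : ℕ) (T Z : Sphere2 → ℤ → Ω → ℝ) (ℓ N h : ℕ) (ω : Ω) : ℝ :=
  (laggedObs p T ℓ N h ω ⬝ᵥ noiseObs p Z ℓ N ω) / ((N : ℝ) * (2 * ℓ + 1))

/-- `v` has at most `r` nonzero coordinates. -/
def IsSparse {p : ℕ} (r : ℕ) (v : EuclideanSpace ℝ (Fin p)) : Prop :=
  Set.ncard {i : Fin p | v i ≠ 0} ≤ r

/-- The bilinear form `u' A v`. -/
def bilin {p : ℕ} (u : EuclideanSpace ℝ (Fin p)) (A : Matrix (Fin p) (Fin p) ℝ)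
    (v : EuclideanSpace ℝ (Fin p)) : ℝ :=
  u.ofLp ⬝ᵥ (A *ᵥ v.ofLp)

end SphericalAR

end

noncomputable section

namespace SphericalAR

/-! Projecting the field on a fixed degree reduces everything to scalar autoregressions. By the
Funk–Hecke formula (`integral_cosAngle_sphHarm`) each `Y_{ℓ,m}` is an eigenfunction of every
isotropic kernel operator, so for each `m` the coefficients `a_{ℓ,m}(t)` solve an AR(p) equation
with coefficients `φ_{ℓ;j}` and uncorrelated innovations of variance `C_ℓ`. Isotropy and
orthonormality make different `m` uncorrelated, with a common autocovariance `coeffCov`.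

Since `φ_ℓ` has no root in the closed disk, `1/φ_ℓ` has an absolutely summable causal expansion.
Applied to covariances rather than to random variables, it shows that `coeffCov` is summable, that
past coefficients are uncorrelated with present noise, and that `|φ_ℓ(z)|² ∑ γ(n) zⁿ = C_ℓ` on the
unit circle (`IsSPHAR.coefficient_autoregression`).

For a fixed `v` the vector `X v` is centered Gaussian, and its covariance is block diagonal with one
Toeplitz block per `m`. A Toeplitz form is bounded by the supremum of its symbol
(`sum_mul_mul_le_of_spectral_bound`); here the symbol is `2π v' f̃_ℓ v`, at most `2π ℳ(f̃_ℓ, r)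
‖v‖²` when `v` is `r`-sparse. A Hanson–Wright inequality for squared norms of Gaussian vectors
(`measure_abs_sum_sq_sub_gt_le`) then controls `v'(Γ̂ - Γ)v`. It is proved by diagonalising the
covariance into independent Gaussians and applying Chernoff's bound to both tails.

The other bounds follow by polarization. For `u'(Γ̂ - Γ)v` the vectors `u+v`, `u`, `v` enter with
squared norms at most `4, 1, 1`; entries are the case of basis vectors. For the noise term, `2 Y'E =
|Y+E|² - |Y|² - |E|²`, and the means cancel because `Y` is uncorrelated with `E` at each index.

Joint Gaussianity of `T` and `Z` is not a hypothesis. Harmonic coefficients of `T` lie in the closed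
`L²` span of `T`, those of `Z` lie there too through the equation, and finite families in that span
are jointly Gaussian (`hasGaussianLaw_of_memGaussSpan`). -/

instance : IsFiniteMeasure surface := by unfold surface; infer_instance

/-! ### Surface measure: rotation invariance and the law of the height. -/

theorem measurable_rotate (R : R3 ≃ₗᵢ[ℝ] R3) : Measurable (rotate R) := by
  unfold rotate
  exact (R.continuous.measurable.comp measurable_subtype_coe).subtype_mk

-- The surface measure of a set is a multiple of the volume of the cone over it; a linear isometry
-- commutes with taking cones and preserves volume.
open scoped Pointwise in
theorem measurePreserving_rotate (R : R3 ≃ₗᵢ[ℝ] R3) :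
    MeasurePreserving (rotate R) surface surface := by
  refine ⟨measurable_rotate R, ?_⟩
  ext s hs
  rw [Measure.map_apply (measurable_rotate R) hs]
  unfold surface
  rw [Measure.toSphere_apply' _ (measurable_rotate R hs), Measure.toSphere_apply' _ hs,
    ← (show MeasurePreserving R.toHomeomorph.toMeasurableEquiv volume volume from
      R.measurePreserving).measure_preimage_equiv
        (Set.Ioo (0 : ℝ) 1 • (Subtype.val '' s : Set R3))]
  congr 2
  ext x
  change _ ↔ R x ∈ (Set.Ioo (0 : ℝ) 1 • (Subtype.val '' s : Set R3))
  simp only [Set.mem_smul, Set.mem_image, Set.mem_preimage]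
  constructor
  · rintro ⟨r, hr, _, ⟨y, hy, rfl⟩, rfl⟩
    exact ⟨r, hr, _, ⟨rotate R y, hy, rfl⟩, by simp [rotate]⟩
  · rintro ⟨r, hr, _, ⟨y, hy, rfl⟩, h⟩
    refine ⟨r, hr, _, ⟨rotate R.symm y, ?_, rfl⟩, ?_⟩
    · have : rotate R (rotate R.symm y) = y := Subtype.ext (by simp [rotate])
      rwa [this]
    · apply R.injective
      simpa [rotate] using h

theorem integral_rotate {E : Type*} [NormedAddCommGroup E] [NormedSpace ℝ E]
    (R : R3 ≃ₗᵢ[ℝ] R3) (f : Sphere2 → E) :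
    ∫ x, f (rotate R x) ∂surface = ∫ x, f x ∂surface := by
  have hinv : ∀ x, rotate R.symm (rotate R x) = x := fun x => Subtype.ext (by simp [rotate])
  have hinv' : ∀ x, rotate R (rotate R.symm x) = x := fun x => Subtype.ext (by simp [rotate])
  exact (measurePreserving_rotate R).integral_comp
    (MeasurableEquiv.measurableEmbedding ⟨⟨rotate R, rotate R.symm, hinv, hinv'⟩,
      measurable_rotate R, measurable_rotate R.symm⟩) f

/-- Polar coordinates for the product of a function homogeneous of degree zero and a radial one; it
transfers Gaussian integrals on `ℝ³` to the sphere. -/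
theorem integral_polar (f : R3 → ℝ) (g : ℝ → ℝ) (hf : ∀ (r : ℝ), 0 < r → ∀ x, f (r • x) = f x) :
    ∫ x, f x * g ‖x‖ = (∫ s : Sphere2, f s ∂surface) * ∫ r in Set.Ioi (0 : ℝ), r ^ 2 * g r := by
  calc
    ∫ x, f x * g ‖x‖ = ∫ x : ({(0)}ᶜ : Set R3), f x.1 * g (‖x.1‖) ∂((volume : Measure R3).comap Subtype.val) := by
      rw [integral_subtype_comap (measurableSet_singleton _).compl fun x ↦ f x * g (‖x‖),
        restrict_compl_singleton]
    _ = ∫ x, f (x.1 : Sphere2) * g (x.2 : Set.Ioi (0 : ℝ)) ∂(surface.prod (.volumeIoiPow 2)) := by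
      have := (Measure.measurePreserving_homeomorphUnitSphereProd (volume : Measure R3)).integral_comp
        (Homeomorph.measurableEmbedding _)
        (fun q : Sphere2 × Set.Ioi (0 : ℝ) => f q.1 * g q.2)
      rw [show Module.finrank ℝ R3 - 1 = 2 by simp] at this
      unfold surface
      rw [← this]
      refine integral_congr_ae (Eventually.of_forall fun x => ?_)
      have hx : (0 : ℝ) < ‖x.1‖⁻¹ := by
        have := x.2
        simp only [Set.mem_compl_iff, Set.mem_singleton_iff] at this
        positivity
      simp [hf _ hx]
    _ = (∫ s : Sphere2, f s ∂surface) * ∫ x : Set.Ioi (0 : ℝ), g x ∂.volumeIoiPow 2 :=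
      integral_prod_mul (fun s : Sphere2 => f s) (fun x : Set.Ioi (0 : ℝ) => g x)
    _ = _ := by
      congr 1
      simp only [Measure.volumeIoiPow, ENNReal.ofReal]
      rw [integral_withDensity_eq_integral_smul,
        integral_subtype_comap measurableSet_Ioi fun a ↦ Real.toNNReal (a ^ 2) • g a,
        setIntegral_congr_fun measurableSet_Ioi fun x hx ↦ ?_]
      · simp [NNReal.smul_def, Real.coe_toNNReal _ (pow_nonneg (Set.mem_Ioi.1 hx).le 2)]
      · exact (measurable_subtype_coe.pow_const _).real_toNNReal

theorem integral_Ioi_pow_mul_exp (n : ℕ) :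
    ∫ r in Set.Ioi (0 : ℝ), r ^ n * Real.exp (-r ^ 2) = Real.Gamma ((n + 1) / 2) / 2 := by
  have := integral_rpow_mul_exp_neg_rpow (p := 2) (q := n) (by norm_num) (lt_of_lt_of_le (by norm_num) (Nat.cast_nonneg n))
  simp only [Real.rpow_natCast, Real.rpow_two] at this
  rw [this]
  ring

theorem integral_pow_mul_exp (n : ℕ) :
    ∫ r : ℝ, r ^ (2 * n) * Real.exp (-r ^ 2) = Real.Gamma (n + 1 / 2) := by
  have := integral_comp_abs (f := fun r : ℝ => r ^ (2 * n) * Real.exp (-r ^ 2))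
  simp only [pow_mul, sq_abs] at this
  simp only [pow_mul]
  rw [this]
  simp only [← pow_mul]
  rw [integral_Ioi_pow_mul_exp]
  rw [show (((2 * n : ℕ) : ℝ) + 1) / 2 = n + 1 / 2 by push_cast; ring]
  ring

theorem integral_R3_pow (n : ℕ) :
    ∫ x : R3, (x 2) ^ (2 * n) * Real.exp (-‖x‖ ^ 2) = Real.Gamma (n + 1 / 2) * Real.pi := by
  have h1 : ∀ x : R3, (x 2) ^ (2 * n) * Real.exp (-‖x‖ ^ 2)
      = ∏ i, (![fun r : ℝ => Real.exp (-r ^ 2), fun r => Real.exp (-r ^ 2),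
          fun r => r ^ (2 * n) * Real.exp (-r ^ 2)] i) (x i) := by
    intro x
    rw [EuclideanSpace.norm_sq_eq, Fin.sum_univ_three, Fin.prod_univ_three]
    simp only [Real.norm_eq_abs, sq_abs, neg_add, Real.exp_add]
    simp
    ring
  simp_rw [h1]
  rw [(PiLp.volume_preserving_ofLp (Fin 3)).integral_comp
    (MeasurableEquiv.toLp 2 (Fin 3 → ℝ)).symm.measurableEmbedding
    (fun x : Fin 3 → ℝ => ∏ i, (![fun r : ℝ => Real.exp (-r ^ 2), fun r => Real.exp (-r ^ 2),
          fun r => r ^ (2 * n) * Real.exp (-r ^ 2)] i) (x i)),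
    integral_fintype_prod_volume_eq_prod, Fin.prod_univ_three]
  have h2 : ∫ r : ℝ, Real.exp (-r ^ 2) = √Real.pi := by
    simpa using integral_gaussian 1
  simp [h2, integral_pow_mul_exp]
  field_simp
  rw [Real.sq_sqrt Real.pi_pos.le]

/-- The integral of `x₃^(2n) exp(-|x|²)` over `ℝ³` is computed in Cartesian and in polar
coordinates. The Gamma factors differ by one application of the functional equation, and their ratio
gives the moment. -/
theorem integral_surface_even (n : ℕ) :
    ∫ x : Sphere2, (x : R3) 2 ^ (2 * n) ∂surface = 4 * Real.pi / (2 * n + 1) := by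
  have h := integral_polar (fun x => (x 2 / ‖x‖) ^ (2 * n))
    (fun r => r ^ (2 * n) * Real.exp (-r ^ 2)) (by
      intro r hr x
      rw [norm_smul, Real.norm_of_nonneg hr.le]
      simp only [PiLp.smul_apply, smul_eq_mul]
      rw [mul_div_mul_left _ _ hr.ne'])
  have h1 : ∀ x : R3, (x 2 / ‖x‖) ^ (2 * n) * (‖x‖ ^ (2 * n) * Real.exp (-‖x‖ ^ 2)) =
      (x 2) ^ (2 * n) * Real.exp (-‖x‖ ^ 2) := by
    intro x
    rw [← mul_assoc, ← mul_pow]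
    congr 2
    by_cases hx : ‖x‖ = 0
    · rw [norm_eq_zero] at hx
      simp [hx]
    · field_simp
  simp_rw [h1, integral_R3_pow] at h
  have h2 : ∀ s : Sphere2, ‖(s : R3)‖ = 1 := fun s => mem_sphere_zero_iff_norm.1 s.2
  simp only [h2, div_one] at h
  have h3 := integral_Ioi_pow_mul_exp (2 * n + 2)
  have h4 : Real.Gamma ((((2 * n + 2 : ℕ) : ℝ) + 1) / 2) = (n + 1 / 2) * Real.Gamma (n + 1 / 2) := by
    rw [← Real.Gamma_add_one (by positivity)]
    congr 1
    push_cast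
    ring
  rw [h4] at h3
  simp_rw [← mul_assoc, ← pow_add, add_comm 2 (2 * n)] at h
  rw [h3] at h
  have h5 : Real.Gamma (n + 1 / 2) ≠ 0 := (Real.Gamma_pos_of_pos (by positivity)).ne'
  field_simp at h ⊢
  linarith

/-- The antipodal map preserves the measure and changes the sign of the integrand. -/
theorem integral_surface_odd (n : ℕ) :
    ∫ x : Sphere2, (x : R3) 2 ^ (2 * n + 1) ∂surface = 0 := by
  have h := integral_rotate (LinearIsometryEquiv.neg ℝ) (fun x : Sphere2 => (x : R3) 2 ^ (2 * n + 1))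
  simp only [rotate, LinearIsometryEquiv.coe_neg, PiLp.neg_apply, Odd.neg_pow ⟨n, rfl⟩] at h
  rw [integral_neg] at h
  linarith

theorem continuous_cosColat : Continuous cosColat := by
  unfold cosColat
  fun_prop

theorem cosColat_mem (x : Sphere2) : cosColat x ∈ Set.Icc (-1 : ℝ) 1 := by
  rw [Set.mem_Icc, ← abs_le]
  have h2 : ‖(x : R3)‖ = 1 := mem_sphere_zero_iff_norm.1 x.2
  rw [← h2]
  exact PiLp.norm_apply_le (x : R3) 2

theorem integral_surface_pow (n : ℕ) :
    ∫ x, cosColat x ^ n ∂surface = 2 * Real.pi * ∫ u in (-1 : ℝ)..1, u ^ n := by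
  rw [integral_pow]
  obtain ⟨k, rfl | rfl⟩ := n.even_or_odd'
  · refine (integral_surface_even k).trans ?_
    rw [Odd.neg_one_pow ⟨k, rfl⟩]
    push_cast
    field_simp
    ring
  · refine (integral_surface_odd k).trans ?_
    rw [Even.neg_one_pow ⟨k + 1, by ring⟩]
    simp

theorem integrable_surface {E : Type*} [NormedAddCommGroup E] {f : Sphere2 → E}
    (hf : Continuous f) : Integrable f surface := by
  have : Integrable f (surface.restrict Set.univ) :=
    (hf.continuousOn.integrableOn_compact (μ := surface) isCompact_univ)
  simpa using this

theorem integral_surface_polynomial (q : Polynomial ℝ) :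
    ∫ x, q.eval (cosColat x) ∂surface = 2 * Real.pi * ∫ u in (-1 : ℝ)..1, q.eval u := by
  simp_rw [Polynomial.eval_eq_sum_range]
  rw [integral_finsetSum, intervalIntegral.integral_finsetSum, Finset.mul_sum]
  · refine Finset.sum_congr rfl fun i _ => ?_
    rw [integral_const_mul, intervalIntegral.integral_const_mul, integral_surface_pow]
    ring
  · intro i _
    exact Continuous.intervalIntegrable (by fun_prop) _ _
  · intro i _
    exact integrable_surface (continuous_const.mul (continuous_cosColat.pow i))

/-- Archimedes' theorem: the height is uniformly distributed. The moments settle polynomials, and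
Weierstrass approximation extends this to continuous functions. -/
theorem integral_surface_cosColat {κ : ℝ → ℝ} (hκ : ContinuousOn κ (Set.Icc (-1) 1)) :
    ∫ x, κ (cosColat x) ∂surface = 2 * Real.pi * ∫ u in (-1 : ℝ)..1, κ u := by
  have hint : Integrable (fun x => κ (cosColat x)) surface :=
    integrable_surface (hκ.comp_continuous continuous_cosColat cosColat_mem)
  have hint' : IntervalIntegrable κ volume (-1) 1 :=
    ContinuousOn.intervalIntegrable (by rwa [Set.uIcc_of_le (by norm_num)])
  rw [← sub_eq_zero, ← abs_nonpos_iff]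
  refine le_of_forall_pos_le_add fun ε hε => ?_
  -- An approximation error `ε / M` costs its product with the total mass on the sphere and with `2π
  -- · 2` on the interval; this `M` makes the two costs add up to `ε`.
  set M : ℝ := surface.real Set.univ + 4 * Real.pi with hM
  have hMpos : 0 < M := by positivity
  obtain ⟨q, hq⟩ := exists_polynomial_near_of_continuousOn (-1) 1 κ hκ (ε / M) (by positivity)
  have h1 : |∫ x, (q.eval (cosColat x) - κ (cosColat x)) ∂surface| ≤ ε / M * surface.real Set.univ := by
    rw [← Real.norm_eq_abs]
    refine norm_integral_le_of_norm_le_const (μ := surface) (Eventually.of_forall fun x => ?_)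
    exact (hq _ (cosColat_mem x)).le
  have h2 : |∫ u in (-1 : ℝ)..1, (q.eval u - κ u)| ≤ ε / M * |1 - (-1)| := by
    rw [← Real.norm_eq_abs]
    refine intervalIntegral.norm_integral_le_of_norm_le_const fun x hx => ?_
    rw [Set.uIoc_of_le (by norm_num)] at hx
    exact (hq _ ⟨hx.1.le, hx.2⟩).le
  rw [integral_sub (show Integrable (fun x => q.eval (cosColat x)) surface from
    integrable_surface (q.continuous.comp continuous_cosColat)) hint,
    integral_surface_polynomial] at h1
  rw [intervalIntegral.integral_sub (q.continuous.intervalIntegrable _ _) hint'] at h2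
  have h3 : ε / M * surface.real Set.univ + 2 * Real.pi * (ε / M * |1 - (-1)|) = ε := by
    rw [show |(1 : ℝ) - (-1)| = 2 by norm_num]
    field_simp
    rw [hM]; ring
  rw [abs_le] at *
  have := Real.pi_pos
  constructor <;> nlinarith

/-! ### Coefficients of powers of a quadratic polynomial. -/

section Quadratic

open Polynomial

variable {K : Type*} [Field K]

/-- The quadratic polynomial `c + a X + b X²`. -/
def quad (c a b : K) : K[X] := C c + C a * X + C b * X ^ 2

theorem quad_smul (s c a b : K) : quad (s * c) (s * a) (s * b) = C s * quad c a b := by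
  simp only [quad, map_mul]; ring

theorem quad_comp (s c a b : K) : (quad c a b).comp (C s * X) = quad c (a * s) (b * s ^ 2) := by
  simp only [quad, map_mul, add_comp, mul_comp, C_comp, X_comp, pow_comp, map_pow]; ring

theorem eval_quad (v c a b : K) : (quad c a b).eval v = c + a * v + b * v ^ 2 := by
  simp [quad]

theorem map_quad {L : Type*} [Field L] (f : K →+* L) (c a b : K) :
    (quad c a b).map f = quad (f c) (f a) (f b) := by
  simp [quad]

theorem natDegree_quad_le (c a b : K) : (quad c a b).natDegree ≤ 2 := by
  unfold quad; compute_degree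

/-- The coefficient of `X^k` in `(c + a X + b X²)^ℓ`. -/
def quadCoeff (ℓ k : ℕ) (c a b : K) : K := (quad c a b ^ ℓ).coeff k

/-- Scaling the polynomial, dilating the variable and reversing the coefficients are the symmetries
from which the later coefficient identities are derived. -/
theorem quadCoeff_smul (ℓ k : ℕ) (s c a b : K) :
    quadCoeff ℓ k (s * c) (s * a) (s * b) = s ^ ℓ * quadCoeff ℓ k c a b := by
  rw [quadCoeff, quad_smul, mul_pow, ← C_pow, coeff_C_mul, quadCoeff]

theorem quadCoeff_dilate (ℓ k : ℕ) (s c a b : K) :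
    quadCoeff ℓ k c (a * s) (b * s ^ 2) = s ^ k * quadCoeff ℓ k c a b := by
  rw [quadCoeff, ← quad_comp, ← pow_comp, comp_C_mul_X_coeff, quadCoeff, mul_comm]

theorem quadCoeff_zero_left (ℓ k : ℕ) (a b : K) :
    quadCoeff ℓ k 0 a b = if ℓ ≤ k then ((C a + C b * X) ^ ℓ).coeff (k - ℓ) else 0 := by
  rw [quadCoeff, show quad 0 a b = X * (C a + C b * X) by simp [quad]; ring, mul_pow,
    coeff_X_pow_mul']

theorem quadCoeff_reverse (ℓ m : ℕ) (hm : m ≤ ℓ) (c a b : K) :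
    quadCoeff ℓ (ℓ - m) c a b = quadCoeff ℓ (ℓ + m) b a c := by
  have h2 : reflect 2 (quad c a b) = quad b a c := by
    simp only [quad, reflect_add]
    rw [show (C c : K[X]) = C c * X ^ 0 by simp, show C a * X = C a * X ^ 1 by simp,
      reflect_C_mul_X_pow, reflect_C_mul_X_pow, reflect_C_mul_X_pow]
    rw [revAt_le (by norm_num), revAt_le (by norm_num), revAt_le (by norm_num)]
    simp
    ring
  have h : ∀ n : ℕ, reflect (2 * n) (quad c a b ^ n) = quad b a c ^ n := by
    intro n
    induction n with
    | zero => simp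
    | succ n ih =>
      rw [pow_succ, pow_succ, mul_add, mul_one, reflect_mul _ _ _ (natDegree_quad_le c a b), ih, h2]
      exact natDegree_pow_le_of_le n (natDegree_quad_le c a b) |>.trans (by omega)
  rw [quadCoeff, quadCoeff, ← h, coeff_reflect, revAt_le (by omega)]
  congr 1
  omega

/-- On the middle coefficient, dilation by `b` and scaling by `b` both act by `b ^ ℓ`, so only the
product of the outer coefficients matters. For `b = 0` both sides reduce to `a ^ ℓ`. -/
theorem quadCoeff_central (ℓ : ℕ) (c a b : K) :
    quadCoeff ℓ ℓ c a b = quadCoeff ℓ ℓ (c * b) a 1 := by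
  by_cases hb : b = 0
  · subst hb
    have h := quadCoeff_reverse ℓ 0 (Nat.zero_le _) c a 0
    simp only [Nat.sub_zero, add_zero] at h
    rw [h, mul_zero, quadCoeff_zero_left, quadCoeff_zero_left]
    simp [coeff_zero_eq_eval_zero]
  · have h1 := quadCoeff_dilate ℓ ℓ b (c * b) a 1
    have h2 := quadCoeff_smul ℓ ℓ b c a b
    rw [show b * c = c * b by ring, show b * a = a * b by ring, show b * b = 1 * b ^ 2 by ring,
      h1] at h2
    exact (mul_left_cancel₀ (pow_ne_zero _ hb) h2).symm

theorem quadCoeff_map {L : Type*} [Field L] (f : K →+* L) (ℓ k : ℕ) (c a b : K) :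
    f (quadCoeff ℓ k c a b) = quadCoeff ℓ k (f c) (f a) (f b) := by
  rw [quadCoeff, quadCoeff, ← map_quad, ← Polynomial.map_pow, coeff_map]

/-- Dilation by `s`, scaling by `s` and reversal combined. With `s = u² - 1` this relates the
derivatives of orders `ℓ - m` and `ℓ + m` in Rodrigues' formula. -/
theorem quadCoeff_shift (ℓ m : ℕ) (hm : m ≤ ℓ) (s a : K) :
    quadCoeff ℓ (ℓ - m) s a 1 = s ^ m * quadCoeff ℓ (ℓ + m) s a 1 := by
  by_cases hs : s = 0
  · subst hs
    rcases Nat.eq_zero_or_pos m with rfl | h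
    · simp
    · rw [quadCoeff_zero_left, if_neg (by omega), zero_pow h.ne', zero_mul]
  · have h1 := quadCoeff_dilate ℓ (ℓ + m) s s a 1
    have h2 := quadCoeff_smul ℓ (ℓ + m) s 1 a s
    rw [show s * 1 = s by ring, show s * a = a * s by ring, show s * s = 1 * s ^ 2 by ring, h1,
      ← quadCoeff_reverse ℓ m hm s a 1, pow_add, mul_assoc] at h2
    exact (mul_left_cancel₀ (pow_ne_zero _ hs) h2).symm

/-- The coefficients attached to a null vector, in terms of the zonal ones. -/
theorem quadCoeff_null (ℓ m : ℕ) [NeZero (2 : K)] (x y z : K) :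
    quadCoeff ℓ (ℓ + m) (-y / 2) z (x / 2) = x ^ m * quadCoeff ℓ (ℓ + m) (-(x * y) / 2) z (1 / 2) := by
  have h2 : (2 : K) ≠ 0 := NeZero.ne 2
  by_cases hx : x = 0
  · subst hx
    rcases Nat.eq_zero_or_pos m with rfl | h
    · simp only [add_zero, pow_zero, one_mul]
      rw [quadCoeff_central, quadCoeff_central ℓ _ _ (1 / 2)]
      simp
    · rw [zero_pow h.ne', zero_mul]
      have : quad (-y / 2) z ((0 : K) / 2) = C (-y / 2) + C z * X := by simp [quad]
      rw [quadCoeff, this]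
      refine coeff_eq_zero_of_natDegree_lt ?_
      have h3 : (C (-y / 2) + C z * X).natDegree ≤ 1 := by compute_degree
      exact (natDegree_pow_le_of_le ℓ h3).trans_lt (by omega)
  · have h1 := quadCoeff_dilate ℓ (ℓ + m) x (-(x * y) / 2) z (1 / 2)
    have h2 := quadCoeff_smul ℓ (ℓ + m) x (-y / 2) z (x / 2)
    rw [show x * (-y / 2) = -(x * y) / 2 by ring, show x * z = z * x by ring,
      show x * (x / 2) = 1 / 2 * x ^ 2 by ring, h1, pow_add, mul_assoc] at h2
    exact (mul_left_cancel₀ (pow_ne_zero _ hx) h2).symm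

theorem continuous_coeff_pow {α : Type*} [TopologicalSpace α] {p : α → ℂ[X]}
    (hp : ∀ k, Continuous fun x => (p x).coeff k) (ℓ k : ℕ) :
    Continuous fun x => (p x ^ ℓ).coeff k := by
  induction ℓ generalizing k with
  | zero => simpa using continuous_const
  | succ n ih =>
    simp only [pow_succ, coeff_mul]
    exact continuous_finsetSum _ fun i _ => (ih _).mul (hp _)

theorem continuous_quadCoeff {α : Type*} [TopologicalSpace α] {c a b : α → ℂ} (hc : Continuous c)
    (ha : Continuous a) (hb : Continuous b) (ℓ k : ℕ) :
    Continuous fun x => quadCoeff ℓ k (c x) (a x) (b x) := by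
  refine continuous_coeff_pow (fun k => ?_) ℓ k
  simp only [quad, coeff_add, coeff_C, coeff_C_mul, coeff_X, coeff_X_pow]
  split_ifs <;> fun_prop

end Quadratic

/-! ### Legendre functions: Rodrigues' formula, norms and orthogonality. -/

section Legendre

open Polynomial

/-- Taylor's formula: `(X² - 1)^ℓ` expanded at `u` is the power of the quadratic `(u² - 1) + 2uX +
X²`. -/
theorem eval_iterate_derivative (ℓ k : ℕ) (u : ℝ) :
    (derivative^[k] ((X ^ 2 - 1 : ℝ[X]) ^ ℓ)).eval u =
      k.factorial * quadCoeff ℓ k (u ^ 2 - 1) (2 * u) 1 := by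
  have h := taylor_coeff (R := ℝ) u ((X ^ 2 - 1 : ℝ[X]) ^ ℓ) k
  have h3 : taylor u ((X ^ 2 - 1 : ℝ[X]) ^ ℓ) = quad (u ^ 2 - 1) (2 * u) 1 ^ ℓ := by
    rw [taylor_apply, pow_comp]
    congr 1
    simp only [sub_comp, pow_comp, X_comp, one_comp, quad]
    simp only [map_sub, map_mul, map_pow, map_one, map_ofNat]
    ring
  rw [← factorial_smul_hasseDeriv]
  rw [quadCoeff, ← h3, h]
  simp

theorem rodrigues_eval (ℓ m : ℕ) (u : ℝ) :
    (rodrigues ℓ m).eval u =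
      (ℓ + m).factorial / ℓ.factorial * quadCoeff ℓ (ℓ + m) ((u ^ 2 - 1) / 2) u (1 / 2) := by
  have h := quadCoeff_smul ℓ (ℓ + m) 2 ((u ^ 2 - 1) / 2) u (1 / 2)
  rw [show (2 : ℝ) * ((u ^ 2 - 1) / 2) = u ^ 2 - 1 by ring, show (2 : ℝ) * (1 / 2) = 1 by norm_num] at h
  rw [rodrigues, eval_mul, eval_C, eval_iterate_derivative, h]
  have := Nat.factorial_pos ℓ
  field_simp

theorem rodrigues_relation (ℓ m : ℕ) (hm : m ≤ ℓ) (u : ℝ) :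
    (1 - u ^ 2) ^ m * (derivative^[ℓ + m] ((X ^ 2 - 1 : ℝ[X]) ^ ℓ)).eval u =
      (-1) ^ m * ((ℓ + m).factorial / (ℓ - m).factorial) *
        (derivative^[ℓ - m] ((X ^ 2 - 1 : ℝ[X]) ^ ℓ)).eval u := by
  rw [eval_iterate_derivative, eval_iterate_derivative, quadCoeff_shift ℓ m hm,
    show (1 - u ^ 2) = (-1) * (u ^ 2 - 1) by ring, mul_pow]
  have := Nat.factorial_pos (ℓ - m)
  field_simp

theorem integral_derivative_mul (p q : ℝ[X]) (h1 : p.eval 1 = 0) (h2 : p.eval (-1) = 0) :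
    ∫ u in (-1 : ℝ)..1, (derivative p).eval u * q.eval u =
      -∫ u in (-1 : ℝ)..1, p.eval u * (derivative q).eval u := by
  rw [intervalIntegral.integral_mul_deriv_eq_deriv_mul (u := fun u => p.eval u)
    (v := fun u => q.eval u) (u' := fun u => (derivative p).eval u)
    (v' := fun u => (derivative q).eval u) (fun x _ => p.hasDerivAt x) (fun x _ => q.hasDerivAt x)
    ((derivative p).continuous.intervalIntegrable _ _)
    ((derivative q).continuous.intervalIntegrable _ _)]
  simp [h1, h2]

/-- Repeated integration by parts; no boundary terms arise because `X² - 1` still divides every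
derivative of order below `ℓ`. -/
theorem integral_iterate_derivative_mul (ℓ k : ℕ) (hk : k ≤ ℓ) (q : ℝ[X]) :
    ∫ u in (-1 : ℝ)..1, (derivative^[k] ((X ^ 2 - 1 : ℝ[X]) ^ ℓ)).eval u * q.eval u =
      (-1) ^ k * ∫ u in (-1 : ℝ)..1, ((X ^ 2 - 1 : ℝ[X]) ^ ℓ).eval u * (derivative^[k] q).eval u := by
  induction k generalizing q with
  | zero => simp
  | succ k ih =>
    have hd : (X ^ 2 - 1 : ℝ[X]) ∣ derivative^[k] ((X ^ 2 - 1 : ℝ[X]) ^ ℓ) :=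
      (dvd_pow_self _ (by omega)).trans (pow_sub_dvd_iterate_derivative_pow _ ℓ k)
    have h0 : ∀ x : ℝ, x ^ 2 = 1 → (derivative^[k] ((X ^ 2 - 1 : ℝ[X]) ^ ℓ)).eval x = 0 := by
      intro x hx
      obtain ⟨r, hr⟩ := hd
      rw [hr]
      simp [hx]
    simp only [Function.iterate_succ_apply']
    rw [integral_derivative_mul _ _ (h0 1 (by norm_num)) (h0 (-1) (by norm_num)), ih (by omega),
      pow_succ, ← Function.iterate_succ_apply, Function.iterate_succ_apply']
    ring

theorem integral_one_sub_sq_pow (ℓ : ℕ) :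
    ∫ u in (-1 : ℝ)..1, (1 - u ^ 2) ^ ℓ =
      2 ^ (2 * ℓ + 1) * (ℓ.factorial : ℝ) ^ 2 / (2 * ℓ + 1).factorial := by
  induction ℓ with
  | zero => norm_num
  | succ n ih =>
    -- Integrating the derivative of `u (1 - u²)^(n+1)`, which vanishes at both ends, gives the
    -- Wallis recursion.
    have hd : ∀ u : ℝ, HasDerivAt (fun u : ℝ => u * (1 - u ^ 2) ^ (n + 1))
        ((2 * (n + 1) + 1) * (1 - u ^ 2) ^ (n + 1) - 2 * (n + 1) * (1 - u ^ 2) ^ n) u := by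
      intro u
      have := (hasDerivAt_id' u).mul ((((hasDerivAt_id' u).pow 2).const_sub 1).pow (n + 1))
      refine HasDerivAt.congr_deriv this ?_
      simp only [Nat.cast_add, Nat.cast_one, Nat.cast_ofNat, Nat.add_sub_cancel, Pi.pow_apply]
      ring
    have h := intervalIntegral.integral_eq_sub_of_hasDerivAt (a := -1) (b := 1)
      (fun u _ => hd u) (Continuous.intervalIntegrable (by fun_prop) _ _)
    rw [intervalIntegral.integral_sub (Continuous.intervalIntegrable (by fun_prop) _ _)
      (Continuous.intervalIntegrable (by fun_prop) _ _), intervalIntegral.integral_const_mul,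
      intervalIntegral.integral_const_mul, ih] at h
    norm_num at h
    have h2 : (∫ u in (-1 : ℝ)..1, (1 - u ^ 2) ^ (n + 1)) =
      2 * (n + 1) * (2 ^ (2 * n + 1) * (n.factorial : ℝ) ^ 2 / (2 * n + 1).factorial) /
        (2 * (n + 1) + 1) := by
      field_simp at h ⊢
      linarith
    rw [h2, show 2 * (n + 1) + 1 = 2 * n + 1 + 1 + 1 by ring, Nat.factorial_succ (2 * n + 1 + 1),
      Nat.factorial_succ (2 * n + 1), Nat.factorial_succ n]
    push_cast
    have := Nat.factorial_pos (2 * n + 1)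
    field_simp
    ring

theorem iterate_derivative_top (ℓ : ℕ) :
    derivative^[2 * ℓ] ((X ^ 2 - 1 : ℝ[X]) ^ ℓ) = C ((2 * ℓ).factorial : ℝ) := by
  have hdeg : (X ^ 2 - 1 : ℝ[X]).natDegree = 2 := by
    rw [show (1 : ℝ[X]) = C 1 by simp]; exact natDegree_X_pow_sub_C
  have hm : (X ^ 2 - 1 : ℝ[X]).Monic := by
    rw [show (1 : ℝ[X]) = C 1 by simp]; exact monic_X_pow_sub_C 1 (by norm_num)
  have hd : ((X ^ 2 - 1 : ℝ[X]) ^ ℓ).natDegree = 2 * ℓ := by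
    rw [hm.natDegree_pow, hdeg, mul_comm]
  have h0 : (derivative^[2 * ℓ] ((X ^ 2 - 1 : ℝ[X]) ^ ℓ)).natDegree = 0 := by
    have := natDegree_iterate_derivative ((X ^ 2 - 1 : ℝ[X]) ^ ℓ) (2 * ℓ)
    omega
  rw [eq_C_of_natDegree_eq_zero h0, coeff_iterate_derivative, zero_add, ← hd,
    (hm.pow ℓ).coeff_natDegree, Nat.descFactorial_self]
  simp

/-- `rodrigues_relation` absorbs the weight by lowering one derivative to order `ℓ - m`. Then `ℓ -
m` integrations by parts leave the constant derivative of order `2ℓ` against `(u² - 1)^ℓ`. -/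
theorem integral_rodrigues_sq (ℓ m : ℕ) (hm : m ≤ ℓ) :
    ∫ u in (-1 : ℝ)..1, (1 - u ^ 2) ^ m * (rodrigues ℓ m).eval u ^ 2 =
      2 / (2 * (ℓ : ℝ) + 1) * (((ℓ + m).factorial : ℝ) / ((ℓ - m).factorial : ℝ)) := by
  have h1 : ∀ u : ℝ, (1 - u ^ 2) ^ m * (rodrigues ℓ m).eval u ^ 2 =
      ((1 / ((2 : ℝ) ^ ℓ * (ℓ.factorial : ℝ))) ^ 2 * ((-1) ^ m * ((ℓ + m).factorial / (ℓ - m).factorial))) *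
        ((derivative^[ℓ - m] ((X ^ 2 - 1 : ℝ[X]) ^ ℓ)).eval u *
          (derivative^[ℓ + m] ((X ^ 2 - 1 : ℝ[X]) ^ ℓ)).eval u) := by
    intro u
    rw [rodrigues, eval_mul, eval_C]
    have := rodrigues_relation ℓ m hm u
    linear_combination (1 / (2 ^ ℓ * ℓ.factorial : ℝ)) ^ 2 *
      (derivative^[ℓ + m] ((X ^ 2 - 1 : ℝ[X]) ^ ℓ)).eval u * this
  simp_rw [h1]
  rw [intervalIntegral.integral_const_mul, integral_iterate_derivative_mul ℓ _ (by omega),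
    ← Function.iterate_add_apply, show ℓ - m + (ℓ + m) = 2 * ℓ by omega, iterate_derivative_top]
  have h2 : ∀ u : ℝ, ((X ^ 2 - 1 : ℝ[X]) ^ ℓ).eval u * (C ((2 * ℓ).factorial : ℝ)).eval u =
      ((-1) ^ ℓ * (2 * ℓ).factorial) * (1 - u ^ 2) ^ ℓ := by
    intro u
    rw [show (1 - u ^ 2) = (-1) * (u ^ 2 - 1) by ring, mul_pow, mul_mul_mul_comm, ← mul_pow]
    simp [mul_comm]
  simp_rw [h2]
  rw [intervalIntegral.integral_const_mul, integral_one_sub_sq_pow, Nat.factorial_succ (2 * ℓ)]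
  have e1 : (-1 : ℝ) ^ m * ((-1) ^ (ℓ - m) * (-1) ^ ℓ) = 1 := by
    rw [← pow_add, ← pow_add, show m + (ℓ - m + ℓ) = 2 * ℓ by omega, pow_mul]; simp
  have := Nat.factorial_pos ℓ
  have := Nat.factorial_pos (2 * ℓ)
  have := Nat.factorial_pos (ℓ - m)
  push_cast
  rw [show ∀ A B F I : ℝ, (A * ((-1) ^ m * B)) * ((-1) ^ (ℓ - m) * ((-1) ^ ℓ * F * I)) =
    ((-1 : ℝ) ^ m * ((-1) ^ (ℓ - m) * (-1) ^ ℓ)) * (A * B * F * I) from fun A B F I => by ring, e1]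
  field_simp
  ring

theorem natDegree_rodrigues_le (ℓ : ℕ) : (rodrigues ℓ 0).natDegree ≤ ℓ := by
  refine (natDegree_C_mul_le _ _).trans ((natDegree_iterate_derivative _ _).trans ?_)
  have : ((X ^ 2 - 1 : ℝ[X]) ^ ℓ).natDegree ≤ ℓ * 2 :=
    natDegree_pow_le_of_le ℓ (by compute_degree)
  omega

theorem integral_legendreP_mul_of_lt {ℓ k : ℕ} (h : k < ℓ) :
    ∫ u in (-1 : ℝ)..1, legendreP ℓ u * legendreP k u = 0 := by
  unfold legendreP
  conv_lhs => enter [1, u]; rw [rodrigues, eval_mul, eval_C, mul_assoc]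
  rw [intervalIntegral.integral_const_mul, add_zero, integral_iterate_derivative_mul ℓ ℓ le_rfl,
    iterate_derivative_eq_zero ((natDegree_rodrigues_le k).trans_lt h)]
  simp

theorem integral_legendreP_mul (ℓ k : ℕ) :
    ∫ u in (-1 : ℝ)..1, legendreP ℓ u * legendreP k u = if ℓ = k then 2 / (2 * (ℓ : ℝ) + 1) else 0 := by
  rcases lt_trichotomy ℓ k with h | rfl | h
  · simp_rw [mul_comm (legendreP ℓ _)]
    rw [integral_legendreP_mul_of_lt h, if_neg h.ne]
  · have := integral_rodrigues_sq ℓ 0 (Nat.zero_le _)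
    have h2 := Nat.factorial_pos ℓ
    simpa [legendreP, sq, h2.ne'] using this
  · rw [integral_legendreP_mul_of_lt h, if_neg h.ne']

theorem continuous_legendreP (ℓ : ℕ) : Continuous (legendreP ℓ) :=
  (rodrigues ℓ 0).continuous

end Legendre

/-! ### Rotations: transitivity on pairs of points, and rotations about the third axis. -/

section Rotations

theorem det_reflection_eq_or (K : Submodule ℝ R3) :
    LinearMap.det (K.reflection.toLinearEquiv : R3 →ₗ[ℝ] R3) = 1 ∨
      LinearMap.det (K.reflection.toLinearEquiv : R3 →ₗ[ℝ] R3) = -1 := by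
  have := K.det_reflection
  change LinearMap.det K.reflection.toLinearMap = 1 ∨ LinearMap.det K.reflection.toLinearMap = -1
  rw [this]
  exact neg_one_pow_eq_or ℝ _

theorem det_trans (R S : R3 ≃ₗᵢ[ℝ] R3) :
    LinearMap.det ((R.trans S).toLinearEquiv : R3 →ₗ[ℝ] R3) =
      LinearMap.det (S.toLinearEquiv : R3 →ₗ[ℝ] R3) *
        LinearMap.det (R.toLinearEquiv : R3 →ₗ[ℝ] R3) := by
  rw [← LinearMap.det_comp]; rfl

theorem exists_ne_zero_orthogonal (x y : R3) : ∃ n : R3, n ≠ 0 ∧ inner ℝ n x = 0 ∧ inner ℝ n y = 0 := by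
  have h : (Submodule.span ℝ ({x, y} : Set R3))ᗮ ≠ ⊥ := by
    rw [Ne, Submodule.orthogonal_eq_bot_iff]
    intro h
    have h1 : Module.finrank ℝ (Submodule.span ℝ ({x, y} : Set R3)) ≤ 2 := by
      have := finrank_span_finset_le_card (R := ℝ) ({x, y} : Finset R3)
      simp only [Finset.coe_insert, Finset.coe_singleton] at this
      exact this.trans Finset.card_le_two
    rw [h] at h1
    simp at h1
  obtain ⟨n, hn, hn0⟩ := Submodule.exists_mem_ne_zero_of_ne_bot h
  refine ⟨n, hn0, ?_, ?_⟩
  · rw [real_inner_comm]; exact hn x (Submodule.subset_span (by simp))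
  · rw [real_inner_comm]; exact hn y (Submodule.subset_span (by simp))

/-- The rotation group acts transitively on pairs of points with a given angle. -/
theorem exists_rotation {x y x' y' : R3} (hx : ‖x‖ = ‖x'‖) (hy : ‖y‖ = ‖y'‖)
    (h : inner ℝ x y = inner ℝ x' y') : ∃ R, IsRotation R ∧ R x = x' ∧ R y = y' := by
  set R₁ : R3 ≃ₗᵢ[ℝ] R3 := (ℝ ∙ (x - x'))ᗮ.reflection
  have h1 : R₁ x = x' := Submodule.reflection_sub hx
  set R₂ : R3 ≃ₗᵢ[ℝ] R3 := (ℝ ∙ (R₁ y - y'))ᗮ.reflection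
  have h2 : R₂ (R₁ y) = y' := Submodule.reflection_sub (by rw [R₁.norm_map, hy])
  -- The second reflection does not undo the first: equality of the inner products makes `x'`
  -- orthogonal to `R₁ y - y'`.
  have h3 : R₂ x' = x' := by
    refine Submodule.reflection_mem_subspace_eq_self ?_
    rw [Submodule.mem_orthogonal_singleton_iff_inner_right, inner_sub_left, real_inner_comm,
      real_inner_comm x' y', ← h, ← h1, R₁.inner_map_map, sub_self]
  have hd : LinearMap.det ((R₁.trans R₂).toLinearEquiv : R3 →ₗ[ℝ] R3) = 1 ∨
      LinearMap.det ((R₁.trans R₂).toLinearEquiv : R3 →ₗ[ℝ] R3) = -1 := by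
    rw [det_trans]
    rcases det_reflection_eq_or (ℝ ∙ (x - x'))ᗮ with e1 | e1 <;>
    rcases det_reflection_eq_or (ℝ ∙ (R₁ y - y'))ᗮ with e2 | e2 <;> simp only [R₁, R₂, e1, e2] <;>
      norm_num
  rcases hd with hd | hd
  · exact ⟨R₁.trans R₂, hd, by simp [h1, h3], by simp [h2]⟩
  -- A reflection above may be the identity, so the determinant can be `-1`. One further reflection,
  -- in a plane containing `x'` and `y'`, corrects the sign and keeps the images.
  · obtain ⟨n, hn, hnx, hny⟩ := exists_ne_zero_orthogonal x' y'
    have h4 : (ℝ ∙ n)ᗮ.reflection x' = x' := Submodule.reflection_mem_subspace_eq_self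
      (Submodule.mem_orthogonal_singleton_iff_inner_right.2 hnx)
    have h5 : (ℝ ∙ n)ᗮ.reflection y' = y' := Submodule.reflection_mem_subspace_eq_self
      (Submodule.mem_orthogonal_singleton_iff_inner_right.2 hny)
    refine ⟨(R₁.trans R₂).trans (ℝ ∙ n)ᗮ.reflection, ?_, by simp [h1, h3, h4], by simp [h2, h5]⟩
    have h6 : LinearMap.det ((ℝ ∙ n)ᗮ.reflection.toLinearEquiv : R3 →ₗ[ℝ] R3) = -1 := by
      refine ((ℝ ∙ n)ᗮ.det_reflection).trans ?_
      rw [Submodule.orthogonal_orthogonal, finrank_span_singleton hn, pow_one]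
    rw [IsRotation, det_trans, hd, h6]
    norm_num

/-- The rotation by the angle `α` around the third axis. -/
def axisRotation (α : ℝ) : R3 ≃ₗᵢ[ℝ] R3 where
  toFun x := !₂[Real.cos α * x 0 - Real.sin α * x 1, Real.sin α * x 0 + Real.cos α * x 1, x 2]
  invFun x := !₂[Real.cos α * x 0 + Real.sin α * x 1, -Real.sin α * x 0 + Real.cos α * x 1, x 2]
  map_add' x y := by ext i; fin_cases i <;> simp <;> ring
  map_smul' c x := by ext i; fin_cases i <;> simp <;> ring
  left_inv x := by
    ext i; fin_cases i <;> simp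
    · linear_combination x 0 * Real.sin_sq_add_cos_sq α
    · linear_combination x 1 * Real.sin_sq_add_cos_sq α
  right_inv x := by
    ext i; fin_cases i <;> simp
    · linear_combination x 0 * Real.sin_sq_add_cos_sq α
    · linear_combination x 1 * Real.sin_sq_add_cos_sq α
  norm_map' x := by
    rw [← sq_eq_sq₀ (norm_nonneg _) (norm_nonneg _), EuclideanSpace.norm_sq_eq,
      EuclideanSpace.norm_sq_eq]
    simp only [Fin.sum_univ_three, Real.norm_eq_abs, sq_abs]
    simp
    linear_combination (x 0 ^ 2 + x 1 ^ 2) * Real.sin_sq_add_cos_sq α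

end Rotations

/-! ### Weights under rotations about the third axis. -/

section Weights

/-- The complex horizontal coordinate of a point of the sphere. -/
def planar (x : Sphere2) : ℂ := ⟨(x : R3) 0, (x : R3) 1⟩

theorem continuous_planar : Continuous planar := by
  have : planar = fun x : Sphere2 => (((x : R3) 0 : ℝ) : ℂ) + (((x : R3) 1 : ℝ) : ℂ) * Complex.I := by
    ext x; exact Complex.mk_eq_add_mul_I _ _
  rw [this]; fun_prop

theorem normSq_planar (x : Sphere2) : Complex.normSq (planar x) = 1 - cosColat x ^ 2 := by
  have h : ‖(x : R3)‖ ^ 2 = 1 := by rw [mem_sphere_zero_iff_norm.1 x.2, one_pow]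
  rw [EuclideanSpace.norm_sq_eq, Fin.sum_univ_three] at h
  simp only [Real.norm_eq_abs, sq_abs] at h
  simp only [planar, cosColat, Complex.normSq_mk]
  linarith

theorem planar_mul_conj (x : Sphere2) :
    planar x * (starRingEnd ℂ) (planar x) = 1 - (cosColat x : ℂ) ^ 2 := by
  rw [Complex.mul_conj, normSq_planar]; push_cast; ring

theorem cosColat_axisRotation (α : ℝ) (x : Sphere2) :
    cosColat (rotate (axisRotation α) x) = cosColat x := rfl

theorem planar_axisRotation (α : ℝ) (x : Sphere2) :
    planar (rotate (axisRotation α) x) = Complex.exp (α * Complex.I) * planar x := by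
  rw [Complex.exp_mul_I]
  apply Complex.ext <;>
  simp [planar, rotate, axisRotation, ← Complex.ofReal_cos, ← Complex.ofReal_sin]
  ring

/-- A function of nonzero weight under the rotations around the third axis integrates to zero. -/
theorem integral_eq_zero_of_weight {f : Sphere2 → ℂ} {n : ℤ} (hn : n ≠ 0)
    (h : ∀ (α : ℝ) x, f (rotate (axisRotation α) x) = Complex.exp (α * Complex.I) ^ n * f x) :
    ∫ x, f x ∂surface = 0 := by
  -- The angle `π / n` makes the factor `e^{iαn}` equal to `-1`.
  have h1 := integral_rotate (axisRotation (Real.pi / n)) f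
  simp_rw [h] at h1
  rw [integral_const_mul, ← Complex.exp_int_mul] at h1
  have h2 : (n : ℂ) * (((Real.pi / n : ℝ) : ℂ) * Complex.I) = Real.pi * Complex.I := by
    have : (n : ℂ) ≠ 0 := by exact_mod_cast hn
    push_cast
    field_simp
  rw [h2, Complex.exp_pi_mul_I] at h1
  have : (2 : ℂ) * ∫ x, f x ∂surface = 0 := by linear_combination -h1
  simpa using this

/-- For unimodular `w` the substitution `s ↦ w s` is a dilation by `w` followed by a scaling by
`w⁻¹`, so the `k`-th coefficient has weight `k - ℓ`. -/
theorem quadCoeff_weight (ℓ k : ℕ) (b a c w s ζ : ℂ) (hw : w ≠ 0) (hw' : (starRingEnd ℂ) w = w⁻¹) :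
    quadCoeff ℓ k (c * (starRingEnd ℂ) (w * s)) (a * ζ) (b * (w * s)) =
      w ^ ((k : ℤ) - ℓ) * quadCoeff ℓ k (c * (starRingEnd ℂ) s) (a * ζ) (b * s) := by
  have h1 := quadCoeff_smul ℓ k w⁻¹ (c * (starRingEnd ℂ) s) (a * ζ * w) (b * s * w ^ 2)
  rw [quadCoeff_dilate] at h1
  rw [map_mul, hw', show c * (w⁻¹ * (starRingEnd ℂ) s) = w⁻¹ * (c * (starRingEnd ℂ) s) by ring,
    show a * ζ = w⁻¹ * (a * ζ * w) by field_simp,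
    show b * (w * s) = w⁻¹ * (b * s * w ^ 2) by field_simp, h1, zpow_sub₀ hw, zpow_natCast,
    zpow_natCast, show w⁻¹ * (a * ζ * w) = a * ζ by field_simp, inv_pow]
  field_simp

end Weights

/-! ### The Funk–Hecke formula for powers of null linear forms. -/

section FunkHecke

theorem continuous_cosAngle (x : Sphere2) : Continuous (cosAngle x) := by
  unfold cosAngle; fun_prop

theorem continuous_cosAngle_prod : Continuous fun q : Sphere2 × Sphere2 => cosAngle q.1 q.2 := by
  unfold cosAngle; fun_prop

theorem cosAngle_comm (x y : Sphere2) : cosAngle x y = cosAngle y x := real_inner_comm _ _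

theorem norm_sphere (x : Sphere2) : ‖(x : R3)‖ = 1 := mem_sphere_zero_iff_norm.1 x.2

theorem cosAngle_mem (x y : Sphere2) : cosAngle x y ∈ Set.Icc (-1 : ℝ) 1 := by
  rw [Set.mem_Icc, ← abs_le]
  have := abs_real_inner_le_norm (x : R3) (y : R3)
  rwa [norm_sphere, norm_sphere, one_mul] at this

theorem cosAngle_self (x : Sphere2) : cosAngle x x = 1 := by
  simp [cosAngle]

theorem legendreP_eq_quadCoeff (ℓ : ℕ) (u : ℝ) :
    legendreP ℓ u = quadCoeff ℓ ℓ ((u ^ 2 - 1) / 2) u (1 / 2) := by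
  have := rodrigues_eval ℓ 0 u
  have h2 := Nat.factorial_pos ℓ
  rw [legendreP, this]
  simp [h2.ne']

theorem sum_quadCoeff (ℓ : ℕ) (c a b v : ℂ) :
    ∑ k ∈ Finset.range (2 * ℓ + 1), quadCoeff ℓ k c a b * v ^ k = (c + a * v + b * v ^ 2) ^ ℓ := by
  rw [← eval_quad, ← Polynomial.eval_pow, Polynomial.eval_eq_sum_range' (n := 2 * ℓ + 1)]
  · rfl
  · have := Polynomial.natDegree_pow_le_of_le ℓ (natDegree_quad_le c a b)
    omega

theorem continuousOn_cosColat_comp {κ : ℝ → ℝ} (hκ : ContinuousOn κ (Set.Icc (-1) 1)) :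
    Continuous fun y => κ (cosColat y) :=
  hκ.comp_continuous continuous_cosColat cosColat_mem

theorem continuousOn_cosAngle_comp {κ : ℝ → ℝ} (hκ : ContinuousOn κ (Set.Icc (-1) 1))
    (x : Sphere2) : Continuous fun y => κ (cosAngle x y) :=
  hκ.comp_continuous (continuous_cosAngle x) (cosAngle_mem x)

/-- The middle coefficient sees only the product of the outer ones, and nullity of `b` turns that
product into `b₂²` times the one occurring for `P_ℓ`. -/
theorem quadCoeff_null_central (ℓ : ℕ) (b₀ b₁ b₂ : ℂ) (hb : b₀ ^ 2 + b₁ ^ 2 + b₂ ^ 2 = 0)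
    (y : Sphere2) :
    quadCoeff ℓ ℓ ((b₀ + Complex.I * b₁) / 2 * (starRingEnd ℂ) (planar y)) (b₂ * cosColat y)
      ((b₀ - Complex.I * b₁) / 2 * planar y) = b₂ ^ ℓ * legendreP ℓ (cosColat y) := by
  have h := quadCoeff_map Complex.ofRealHom ℓ ℓ ((cosColat y ^ 2 - 1) / 2) (cosColat y) (1 / 2)
  rw [← legendreP_eq_quadCoeff] at h
  simp only [Complex.ofRealHom_eq_coe] at h
  rw [h, ← quadCoeff_smul, quadCoeff_central, quadCoeff_central ℓ (b₂ * _)]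
  congr 1
  push_cast
  linear_combination (b₀ ^ 2 + b₁ ^ 2) / 4 * planar_mul_conj y -
    (1 - (cosColat y : ℂ) ^ 2) / 4 * (-hb) - b₁ ^ 2 / 4 *
      (planar y * (starRingEnd ℂ) (planar y)) * Complex.I_sq

/-- Decompose the power of the null form into weight vectors for the rotations about the pole. The
zonal factor has weight zero, so only the middle term, `b₂^ℓ P_ℓ`, contributes to the integral. -/
theorem integral_cosColat_null_pow {κ : ℝ → ℝ} (hκ : ContinuousOn κ (Set.Icc (-1) 1)) (ℓ : ℕ)
    (b₀ b₁ b₂ : ℂ) (hb : b₀ ^ 2 + b₁ ^ 2 + b₂ ^ 2 = 0) :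
    ∫ y : Sphere2, (κ (cosColat y) : ℂ) *
      (b₀ * ((y : R3) 0 : ℝ) + b₁ * ((y : R3) 1 : ℝ) + b₂ * ((y : R3) 2 : ℝ)) ^ ℓ ∂surface =
      kernelCoeff κ ℓ * b₂ ^ ℓ := by
  set c : Sphere2 → ℕ → ℂ := fun y k =>
    quadCoeff ℓ k ((b₀ + Complex.I * b₁) / 2 * (starRingEnd ℂ) (planar y)) (b₂ * cosColat y)
      ((b₀ - Complex.I * b₁) / 2 * planar y) with hc
  have h1 : ∀ y : Sphere2, (κ (cosColat y) : ℂ) *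
      (b₀ * ((y : R3) 0 : ℝ) + b₁ * ((y : R3) 1 : ℝ) + b₂ * ((y : R3) 2 : ℝ)) ^ ℓ =
      ∑ k ∈ Finset.range (2 * ℓ + 1), (κ (cosColat y) : ℂ) * c y k := by
    intro y
    rw [← Finset.mul_sum]
    have h := sum_quadCoeff ℓ ((b₀ + Complex.I * b₁) / 2 * (starRingEnd ℂ) (planar y))
      (b₂ * cosColat y) ((b₀ - Complex.I * b₁) / 2 * planar y) 1
    simp only [one_pow, mul_one] at h
    simp only [hc]
    rw [h]
    congr 2
    have e : planar y = (((y : R3) 0 : ℝ) : ℂ) + (((y : R3) 1 : ℝ) : ℂ) * Complex.I :=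
      Complex.mk_eq_add_mul_I _ _
    rw [e]
    simp only [map_add, map_mul, Complex.conj_ofReal, Complex.conj_I, cosColat]
    linear_combination b₁ * ((y : R3) 1 : ℝ) * Complex.I_sq
  simp_rw [h1]
  have hcont : ∀ k, Continuous fun y => (κ (cosColat y) : ℂ) * c y k := by
    intro k
    refine (Complex.continuous_ofReal.comp (continuousOn_cosColat_comp hκ)).mul ?_
    have := continuous_planar
    have := continuous_cosColat
    exact continuous_quadCoeff (by fun_prop) (by fun_prop) (by fun_prop) _ _
  rw [integral_finsetSum _ fun k _ => integrable_surface (hcont k), Finset.sum_eq_single ℓ]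
  · simp only [hc, quadCoeff_null_central ℓ b₀ b₁ b₂ hb]
    have h2 := integral_surface_cosColat (hκ.mul (continuous_legendreP ℓ).continuousOn)
    calc _ = ∫ y, ((κ (cosColat y) * legendreP ℓ (cosColat y) : ℝ) : ℂ) * b₂ ^ ℓ ∂surface := by
          refine integral_congr_ae (Eventually.of_forall fun y => ?_)
          push_cast; ring
      _ = _ := by
          rw [integral_mul_const, integral_complex_ofReal, kernelCoeff]
          congr 2
  · intro k _ hk
    refine integral_eq_zero_of_weight (n := (k : ℤ) - ℓ) (by omega) fun α y => ?_
    simp only [hc, cosColat_axisRotation, planar_axisRotation]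
    rw [quadCoeff_weight ℓ k _ _ _ _ _ _ (Complex.exp_ne_zero _)]
    · ring
    · rw [← Complex.exp_conj, ← Complex.exp_neg]
      simp
  · intro h; exact absurd (Finset.mem_range.2 (by omega)) h

/-- Powers of null linear forms are eigenfunctions of the operators with isotropic kernels. -/
theorem integral_cosAngle_null_pow {κ : ℝ → ℝ} (hκ : ContinuousOn κ (Set.Icc (-1) 1)) (ℓ : ℕ)
    (p q : R3) (hpq : ‖p‖ = ‖q‖) (h0 : inner ℝ p q = 0) (x : Sphere2) :
    ∫ y : Sphere2, (κ (cosAngle x y) : ℂ) *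
      ((inner ℝ p (y : R3) : ℝ) + Complex.I * (inner ℝ q (y : R3) : ℝ)) ^ ℓ ∂surface =
      kernelCoeff κ ℓ *
        ((inner ℝ p (x : R3) : ℝ) + Complex.I * (inner ℝ q (x : R3) : ℝ)) ^ ℓ := by
  -- Rotating the pole to `x` reduces to the polar case. The vector `p + iq` is null because `‖p‖ =
  -- ‖q‖` and `p ⊥ q`; its preimage under `R` is again null, with third coordinate equal to the
  -- value of the form at `x`.
  set e : R3 := EuclideanSpace.single 2 1 with he
  obtain ⟨R, -, hR, -⟩ := exists_rotation (x := e) (x' := x) (y := 0) (y' := 0)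
    (by rw [norm_sphere]; simp [he]) rfl (by simp)
  rw [← integral_rotate R]
  have h1 : ∀ y : Sphere2, cosAngle x (rotate R y) = cosColat y := by
    intro y
    simp only [cosAngle, rotate, cosColat]
    rw [← hR, R.inner_map_map, he, EuclideanSpace.inner_single_left]
    simp
  have h2 : ∀ (p : R3) (y : R3), inner ℝ p (R y) =
      (R.symm p) 0 * y 0 + (R.symm p) 1 * y 1 + (R.symm p) 2 * y 2 := by
    intro p y
    rw [← R.symm.inner_map_map, R.symm_apply_apply, PiLp.inner_apply, Fin.sum_univ_three]
    simp [mul_comm]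
  have h3 : inner ℝ (R.symm p) (R.symm q) = 0 := by rw [R.symm.inner_map_map, h0]
  have h4 : ‖R.symm p‖ ^ 2 = ‖R.symm q‖ ^ 2 := by rw [R.symm.norm_map, R.symm.norm_map, hpq]
  rw [EuclideanSpace.norm_sq_eq, EuclideanSpace.norm_sq_eq, Fin.sum_univ_three,
    Fin.sum_univ_three] at h4
  rw [PiLp.inner_apply, Fin.sum_univ_three] at h3
  simp only [Real.norm_eq_abs, sq_abs] at h4
  simp at h3
  have h5 := integral_cosColat_null_pow hκ ℓ ((R.symm p) 0 + Complex.I * (R.symm q) 0)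
    ((R.symm p) 1 + Complex.I * (R.symm q) 1) ((R.symm p) 2 + Complex.I * (R.symm q) 2) (by
      have h3' := congrArg (fun r : ℝ => (r : ℂ)) h3
      have h4' := congrArg (fun r : ℝ => (r : ℂ)) h4
      push_cast at h3' h4'
      linear_combination h4' + 2 * Complex.I * h3' +
        (((R.symm q) 0 : ℂ) ^ 2 + ((R.symm q) 1 : ℂ) ^ 2 + ((R.symm q) 2 : ℂ) ^ 2) * Complex.I_sq)
  rw [← hR, h2 p e, h2 q e]
  simp only [h1]
  convert h5 using 1
  · refine integral_congr_ae (Eventually.of_forall fun y => ?_)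
    simp only [rotate, h2]
    push_cast
    ring
  · simp [he]

/-- The coefficients of `v ↦ (b(v)·x)^ℓ`, where `b(v)` is a parametrisation of the null cone. -/
def harmQ (ℓ k : ℕ) (x : Sphere2) : ℂ :=
  quadCoeff ℓ k (-(starRingEnd ℂ) (planar x) / 2) (cosColat x) (planar x / 2)

theorem continuous_harmQ (ℓ k : ℕ) : Continuous (harmQ ℓ k) := by
  have := continuous_planar
  have := continuous_cosColat
  exact continuous_quadCoeff (by fun_prop) (by fun_prop) (by fun_prop) _ _

/-- Both sides are coefficients of polynomials in the parameter `v` of the null cone, and these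
polynomials agree at every `v` by the formula for powers of null forms. -/
theorem integral_cosAngle_harmQ {κ : ℝ → ℝ} (hκ : ContinuousOn κ (Set.Icc (-1) 1)) (ℓ k : ℕ)
    (hk : k < 2 * ℓ + 1) (x : Sphere2) :
    ∫ y : Sphere2, (κ (cosAngle x y) : ℂ) * harmQ ℓ k y ∂surface =
      kernelCoeff κ ℓ * harmQ ℓ k x := by
  set F : Polynomial ℂ := ∑ k ∈ Finset.range (2 * ℓ + 1), Polynomial.C
    (∫ y : Sphere2, (κ (cosAngle x y) : ℂ) * harmQ ℓ k y ∂surface) * Polynomial.X ^ k with hF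
  set G : Polynomial ℂ := ∑ k ∈ Finset.range (2 * ℓ + 1), Polynomial.C
    (kernelCoeff κ ℓ * harmQ ℓ k x) * Polynomial.X ^ k with hG
  have hFG : F = G := by
    refine Polynomial.funext fun v => ?_
    have hcont : ∀ k, Continuous fun y => (κ (cosAngle x y) : ℂ) * harmQ ℓ k y := fun k =>
      (Complex.continuous_ofReal.comp (continuousOn_cosAngle_comp hκ x)).mul (continuous_harmQ ℓ k)
    have e1 : F.eval v = ∫ y : Sphere2, (κ (cosAngle x y) : ℂ) *
        (-(starRingEnd ℂ) (planar y) / 2 + cosColat y * v + planar y / 2 * v ^ 2) ^ ℓ ∂surface := by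
      simp only [hF, Polynomial.eval_finsetSum, Polynomial.eval_mul, Polynomial.eval_C,
        Polynomial.eval_pow, Polynomial.eval_X]
      simp_rw [← integral_mul_const]
      rw [← integral_finsetSum _ fun k _ => (integrable_surface (hcont k)).mul_const _]
      refine integral_congr_ae (Eventually.of_forall fun y => ?_)
      simp only
      rw [← sum_quadCoeff, Finset.mul_sum]
      exact Finset.sum_congr rfl fun k _ => by rw [harmQ, mul_assoc]
    have e2 : G.eval v = kernelCoeff κ ℓ *
        (-(starRingEnd ℂ) (planar x) / 2 + cosColat x * v + planar x / 2 * v ^ 2) ^ ℓ := by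
      simp only [hG, Polynomial.eval_finsetSum, Polynomial.eval_mul, Polynomial.eval_C,
        Polynomial.eval_pow, Polynomial.eval_X]
      rw [← sum_quadCoeff, Finset.mul_sum]
      exact Finset.sum_congr rfl fun k _ => by rw [harmQ, mul_assoc]
    rw [e1, e2]
    -- The null vector is `b(v) = ((v² - 1)/2, i(v² + 1)/2, v)`; its real and imaginary parts are
    -- the `p` and `q` required by the formula.
    set b₀ : ℂ := (v ^ 2 - 1) / 2 with hb0
    set b₁ : ℂ := Complex.I * (v ^ 2 + 1) / 2 with hb1
    have hb : b₀ ^ 2 + b₁ ^ 2 + v ^ 2 = 0 := by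
      rw [hb0, hb1]
      linear_combination (v ^ 2 + 1) ^ 2 / 4 * Complex.I_sq
    set p : R3 := !₂[b₀.re, b₁.re, v.re] with hp
    set q : R3 := !₂[b₀.im, b₁.im, v.im] with hq
    have hre := congrArg Complex.re hb
    have him := congrArg Complex.im hb
    simp [sq] at hre him
    have e3 : ∀ y : Sphere2, ((inner ℝ p (y : R3) : ℝ) + Complex.I * (inner ℝ q (y : R3) : ℝ) : ℂ) =
        -(starRingEnd ℂ) (planar y) / 2 + cosColat y * v + planar y / 2 * v ^ 2 := by
      intro y
      have e : planar y = (((y : R3) 0 : ℝ) : ℂ) + (((y : R3) 1 : ℝ) : ℂ) * Complex.I :=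
        Complex.mk_eq_add_mul_I _ _
      have e' : ((inner ℝ p (y : R3) : ℝ) + Complex.I * (inner ℝ q (y : R3) : ℝ) : ℂ) =
          b₀ * ((y : R3) 0 : ℝ) + b₁ * ((y : R3) 1 : ℝ) + v * ((y : R3) 2 : ℝ) := by
        rw [PiLp.inner_apply, Fin.sum_univ_three, PiLp.inner_apply, Fin.sum_univ_three]
        apply Complex.ext <;> simp [hp, hq] <;> ring
      rw [e', e, hb0, hb1]
      simp only [map_add, map_mul, Complex.conj_ofReal, Complex.conj_I, cosColat]
      ring
    simp_rw [← e3]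
    refine integral_cosAngle_null_pow hκ ℓ p q ?_ ?_ x
    · rw [← sq_eq_sq₀ (norm_nonneg _) (norm_nonneg _), EuclideanSpace.norm_sq_eq,
        EuclideanSpace.norm_sq_eq, Fin.sum_univ_three, Fin.sum_univ_three]
      simp [hp, hq]
      linarith
    · rw [PiLp.inner_apply, Fin.sum_univ_three]
      simp [hp, hq]
      linarith
  have := congrArg (fun P : Polynomial ℂ => P.coeff k) hFG
  simp only [hF, hG, Polynomial.finsetSum_coeff, Polynomial.coeff_C_mul_X_pow] at this
  rw [Finset.sum_ite_eq, Finset.sum_ite_eq, if_pos (Finset.mem_range.2 hk),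
    if_pos (Finset.mem_range.2 hk)] at this
  exact this

end FunkHecke

/-! ### Spherical harmonics: eigenfunctions, orthonormality, and `|P_ℓ| ≤ 1`. -/

section Harmonics

/-- The complex spherical harmonic of order `m ≥ 0`, without its normalisation. -/
def zharm (ℓ m : ℕ) (x : Sphere2) : ℂ :=
  (((rodrigues ℓ m).eval (cosColat x) : ℝ) : ℂ) * planar x ^ m

theorem continuous_zharm (ℓ m : ℕ) : Continuous (zharm ℓ m) := by
  have h1 : Continuous fun x => (rodrigues ℓ m).eval (cosColat x) :=
    (rodrigues ℓ m).continuous.comp continuous_cosColat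
  exact (Complex.continuous_ofReal.comp h1).mul (continuous_planar.pow m)

/-- `quadCoeff_null` with `|x₁ + i x₂|² = 1 - x₃²` identifies the Rodrigues expression with a
null-cone coefficient, and so transfers the eigenfunction property. -/
theorem zharm_eq_harmQ (ℓ m : ℕ) (x : Sphere2) :
    zharm ℓ m x = ((ℓ + m).factorial / ℓ.factorial : ℝ) * harmQ ℓ (ℓ + m) x := by
  have h := quadCoeff_map Complex.ofRealHom ℓ (ℓ + m) ((cosColat x ^ 2 - 1) / 2) (cosColat x) (1 / 2)
  simp only [Complex.ofRealHom_eq_coe] at h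
  rw [zharm, rodrigues_eval, harmQ, quadCoeff_null, Complex.ofReal_mul, h, planar_mul_conj]
  push_cast
  rw [neg_sub]
  ring

theorem zharm_axisRotation (ℓ m : ℕ) (α : ℝ) (x : Sphere2) :
    zharm ℓ m (rotate (axisRotation α) x) = Complex.exp (α * Complex.I) ^ m * zharm ℓ m x := by
  rw [zharm, cosColat_axisRotation, planar_axisRotation, mul_pow, zharm]
  ring

theorem integral_cosAngle_zharm {κ : ℝ → ℝ} (hκ : ContinuousOn κ (Set.Icc (-1) 1)) (ℓ m : ℕ)
    (hm : m ≤ ℓ) (x : Sphere2) :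
    ∫ y : Sphere2, (κ (cosAngle x y) : ℂ) * zharm ℓ m y ∂surface =
      kernelCoeff κ ℓ * zharm ℓ m x := by
  have h := integral_cosAngle_harmQ hκ ℓ (ℓ + m) (by omega) x
  simp_rw [zharm_eq_harmQ, mul_left_comm _ (((ℓ + m).factorial / ℓ.factorial : ℝ) : ℂ)]
  rw [integral_const_mul, h]

theorem conj_exp_mul_I (α : ℝ) :
    (starRingEnd ℂ) (Complex.exp (α * Complex.I)) = (Complex.exp (α * Complex.I))⁻¹ := by
  rw [← Complex.exp_conj, ← Complex.exp_neg]
  simp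

theorem integral_zharm_mul (ℓ m m' : ℕ) (h : m ≠ 0 ∨ m' ≠ 0) :
    ∫ x, zharm ℓ m x * zharm ℓ m' x ∂surface = 0 := by
  refine integral_eq_zero_of_weight (n := (m : ℤ) + m') (by omega) fun α x => ?_
  rw [zharm_axisRotation, zharm_axisRotation, zpow_add₀ (Complex.exp_ne_zero _), zpow_natCast,
    zpow_natCast]
  ring

theorem integral_zharm_mul_conj (ℓ m m' : ℕ) (h : m ≠ m') :
    ∫ x, zharm ℓ m x * (starRingEnd ℂ) (zharm ℓ m' x) ∂surface = 0 := by
  refine integral_eq_zero_of_weight (n := (m : ℤ) - m') (by omega) fun α x => ?_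
  rw [zharm_axisRotation, zharm_axisRotation, zpow_sub₀ (Complex.exp_ne_zero _), zpow_natCast,
    zpow_natCast, map_mul, map_pow, conj_exp_mul_I, inv_pow]
  field_simp

/-- The modulus depends on the height only, so Archimedes' theorem reduces the norm to an integral
over `[-1,1]`. -/
theorem integral_zharm_self (ℓ m : ℕ) (hm : m ≤ ℓ) :
    ∫ x, zharm ℓ m x * (starRingEnd ℂ) (zharm ℓ m x) ∂surface =
      ((2 * Real.pi * (2 / (2 * (ℓ : ℝ) + 1) *
        (((ℓ + m).factorial : ℝ) / ((ℓ - m).factorial : ℝ))) : ℝ) : ℂ) := by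
  rw [← integral_rodrigues_sq ℓ m hm, ← integral_surface_cosColat
    (κ := fun u => (1 - u ^ 2) ^ m * (rodrigues ℓ m).eval u ^ 2)
    (Continuous.continuousOn (by have := (rodrigues ℓ m).continuous; fun_prop)),
    ← integral_complex_ofReal]
  refine integral_congr_ae (Eventually.of_forall fun x => ?_)
  simp only [zharm, map_mul, map_pow, Complex.conj_ofReal]
  push_cast
  rw [← planar_mul_conj]
  ring

/-- The normalisation constant of the real harmonic, seen as a real part. -/
def harmConst (ℓ : ℕ) (m : ℤ) : ℂ :=
  if 0 < m then
    (√((2 * ℓ + 1) / (2 * Real.pi) *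
      ((((ℓ - m.natAbs).factorial : ℕ) : ℝ) / (((ℓ + m.natAbs).factorial : ℕ) : ℝ))) : ℝ)
  else if m = 0 then (√((2 * ℓ + 1) / (4 * Real.pi)) : ℝ)
  else -Complex.I * (√((2 * ℓ + 1) / (2 * Real.pi) *
      ((((ℓ - m.natAbs).factorial : ℕ) : ℝ) / (((ℓ + m.natAbs).factorial : ℕ) : ℝ))) : ℝ)

theorem planar_pow (m : ℕ) (x : Sphere2) :
    planar x ^ m = (√(1 - cosColat x ^ 2) ^ m : ℝ) *
      (Real.cos (m * longitude x) + Real.sin (m * longitude x) * Complex.I) := by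
  have h1 : ‖planar x‖ = √(1 - cosColat x ^ 2) := by
    rw [← normSq_planar, Complex.norm_def]
  have h2 : planar x = ‖planar x‖ * Complex.exp (longitude x * Complex.I) :=
    (Complex.norm_mul_exp_arg_mul_I _).symm
  rw [h2, mul_pow, ← Complex.exp_nat_mul, h1, ← mul_assoc, Complex.exp_mul_I]
  push_cast
  ring

/-- `longitude` is the argument of `planar`, so `planar ^ m` carries both trigonometric factors; for
`m < 0` the factor `-i` in `harmConst` selects the sine. -/
theorem sphHarm_eq_re (ℓ : ℕ) (m : ℤ) (x : Sphere2) :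
    sphHarm ℓ m x = (harmConst ℓ m * zharm ℓ m.natAbs x).re := by
  rw [zharm, planar_pow, sphHarm, harmConst]
  simp only [assocLegendre]
  split_ifs with h1 h2
  · rw [← mul_assoc (Complex.ofReal (Polynomial.eval _ _)), ← Complex.ofReal_mul,
      Complex.re_ofReal_mul, Complex.re_ofReal_mul, Complex.add_re, Complex.re_ofReal_mul,
      Complex.I_re, Complex.ofReal_re]
    ring
  · subst h2
    simp [legendreP]
  · rw [← mul_assoc (Complex.ofReal (Polynomial.eval _ _)), ← Complex.ofReal_mul,
      mul_comm (-Complex.I), mul_assoc (Complex.ofReal _) (-Complex.I), Complex.re_ofReal_mul,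
      mul_left_comm (-Complex.I),
      Complex.re_ofReal_mul, neg_mul, Complex.neg_re, Complex.I_mul_re, Complex.add_im,
      Complex.im_ofReal_mul, Complex.I_im, Complex.ofReal_im]
    ring

theorem continuous_sphHarm (ℓ : ℕ) (m : ℤ) : Continuous (sphHarm ℓ m) := by
  have : sphHarm ℓ m = fun x => (harmConst ℓ m * zharm ℓ m.natAbs x).re :=
    funext fun x => sphHarm_eq_re ℓ m x
  rw [this]
  exact Complex.continuous_re.comp (continuous_const.mul (continuous_zharm _ _))

/-- The Funk–Hecke formula. -/
theorem integral_cosAngle_sphHarm {κ : ℝ → ℝ} (hκ : ContinuousOn κ (Set.Icc (-1) 1)) (ℓ : ℕ) (m : ℤ)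
    (hm : m.natAbs ≤ ℓ) (x : Sphere2) :
    ∫ y : Sphere2, κ (cosAngle x y) * sphHarm ℓ m y ∂surface = kernelCoeff κ ℓ * sphHarm ℓ m x := by
  have h := integral_cosAngle_zharm hκ ℓ m.natAbs hm x
  have hint : Integrable (fun y => harmConst ℓ m * ((κ (cosAngle x y) : ℂ) * zharm ℓ m.natAbs y))
      surface := integrable_surface (continuous_const.mul
    ((Complex.continuous_ofReal.comp (continuousOn_cosAngle_comp hκ x)).mul (continuous_zharm _ _)))
  have h2 := integral_re hint
  rw [integral_const_mul, h] at h2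
  calc _ = ∫ y : Sphere2, (harmConst ℓ m * ((κ (cosAngle x y) : ℂ) * zharm ℓ m.natAbs y)).re
        ∂surface := by
        refine integral_congr_ae (Eventually.of_forall fun y => ?_)
        simp only
        rw [sphHarm_eq_re, ← Complex.re_ofReal_mul]
        congr 1
        ring
    _ = _ := by
        refine h2.trans ?_
        rw [sphHarm_eq_re, ← Complex.re_ofReal_mul]
        change Complex.re _ = _
        congr 1
        ring

/-- `Re a · Re b = Re (ab + a b̄) / 2`, integrated. -/
theorem integral_sphHarm_mul_aux (ℓ : ℕ) (m m' : ℤ) :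
    ∫ x, sphHarm ℓ m x * sphHarm ℓ m' x ∂surface =
      (harmConst ℓ m * harmConst ℓ m' *
          ∫ x, zharm ℓ m.natAbs x * zharm ℓ m'.natAbs x ∂surface +
        harmConst ℓ m * (starRingEnd ℂ) (harmConst ℓ m') *
          ∫ x, zharm ℓ m.natAbs x * (starRingEnd ℂ) (zharm ℓ m'.natAbs x) ∂surface).re / 2 := by
  have c1 := continuous_zharm ℓ m.natAbs
  have c2 := continuous_zharm ℓ m'.natAbs
  have i1 : Integrable (fun x => harmConst ℓ m * harmConst ℓ m' *
      (zharm ℓ m.natAbs x * zharm ℓ m'.natAbs x)) surface := integrable_surface (by fun_prop)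
  have i2 : Integrable (fun x => harmConst ℓ m * (starRingEnd ℂ) (harmConst ℓ m') *
      (zharm ℓ m.natAbs x * (starRingEnd ℂ) (zharm ℓ m'.natAbs x))) surface :=
    integrable_surface (continuous_const.mul (c1.mul (Complex.continuous_conj.comp c2)))
  rw [← integral_const_mul, ← integral_const_mul, ← integral_add i1 i2, eq_div_iff two_ne_zero,
    ← integral_mul_const]
  refine Eq.trans ?_ (integral_re (i1.add i2))
  refine integral_congr_ae (Eventually.of_forall fun x => ?_)
  simp only [sphHarm_eq_re]
  simp
  ring

theorem harmConst_mul_conj (ℓ : ℕ) (m : ℤ) :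
    harmConst ℓ m * (starRingEnd ℂ) (harmConst ℓ m) =
      if m = 0 then (((2 * ℓ + 1) / (4 * Real.pi) : ℝ) : ℂ) else
      (((2 * ℓ + 1) / (2 * Real.pi) * (((ℓ - m.natAbs).factorial : ℝ) /
        ((ℓ + m.natAbs).factorial : ℝ)) : ℝ) : ℂ) := by
  rw [harmConst]
  have e1 : (0 : ℝ) ≤ (2 * ℓ + 1) / (2 * Real.pi) * (((ℓ - m.natAbs).factorial : ℝ) /
        ((ℓ + m.natAbs).factorial : ℝ)) := by positivity
  have e2 : (0 : ℝ) ≤ (2 * ℓ + 1) / (4 * Real.pi) := by positivity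
  split_ifs with h1 h2 h2
  · omega
  · rw [Complex.conj_ofReal, ← Complex.ofReal_mul, Real.mul_self_sqrt e1]
  · rw [Complex.conj_ofReal, ← Complex.ofReal_mul, Real.mul_self_sqrt e2]
  · rw [map_mul, map_neg, Complex.conj_I, Complex.conj_ofReal, mul_mul_mul_comm, neg_neg,
      neg_mul, Complex.I_mul_I, neg_neg, one_mul, ← Complex.ofReal_mul, Real.mul_self_sqrt e1]

/-- The real spherical harmonics of a given degree are orthonormal. -/
theorem integral_sphHarm_mul (ℓ : ℕ) (m m' : ℤ) (hm : m.natAbs ≤ ℓ) :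
    ∫ x, sphHarm ℓ m x * sphHarm ℓ m' x ∂surface = if m = m' then 1 else 0 := by
  rw [integral_sphHarm_mul_aux]
  have hpi := Real.pi_pos
  by_cases h0 : m = 0 ∧ m' = 0
  · obtain ⟨rfl, rfl⟩ := h0
    have e : ∀ x, zharm ℓ (Int.natAbs 0) x * zharm ℓ (Int.natAbs 0) x =
        zharm ℓ (Int.natAbs 0) x * (starRingEnd ℂ) (zharm ℓ (Int.natAbs 0) x) := by
      intro x; simp [zharm]
    have e' : harmConst ℓ 0 * harmConst ℓ 0 = harmConst ℓ 0 * (starRingEnd ℂ) (harmConst ℓ 0) := by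
      simp [harmConst]
    simp_rw [e, e']
    rw [integral_zharm_self ℓ _ (by simp), harmConst_mul_conj, if_pos rfl,
      ← Complex.ofReal_mul, ← Complex.ofReal_add, Complex.ofReal_re]
    have := Nat.factorial_pos ℓ
    simp
    field_simp
    norm_num
  · rw [integral_zharm_mul _ _ _ (by omega), mul_zero, zero_add]
    by_cases h1 : m = m'
    · subst h1
      rw [integral_zharm_self ℓ _ hm, harmConst_mul_conj, if_neg (by tauto), if_pos rfl,
        ← Complex.ofReal_mul, Complex.ofReal_re]
      have := Nat.factorial_pos (ℓ + m.natAbs)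
      have := Nat.factorial_pos (ℓ - m.natAbs)
      field_simp
    · rw [if_neg h1]
      by_cases h2 : m.natAbs = m'.natAbs
      · rw [← h2, integral_zharm_self ℓ _ hm, Complex.re_mul_ofReal]
        -- Here `m' = -m ≠ 0`, so one constant is real and the other purely imaginary.
        have : (harmConst ℓ m * (starRingEnd ℂ) (harmConst ℓ m')).re = 0 := by
          rw [harmConst, harmConst]
          split_ifs <;> first | omega | simp
        rw [this]; simp
      · rw [integral_zharm_mul_conj _ _ _ h2]; simp

/-- Funk–Hecke with kernel `P_ℓ` writes `4π/(2ℓ+1) · P_ℓ(u)` as an `L²` pairing of two rotated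
copies of the zonal function. Each copy has squared norm `4π/(2ℓ+1)`. -/
theorem abs_legendreP_le_one (ℓ : ℕ) {u : ℝ} (hu : u ∈ Set.Icc (-1 : ℝ) 1) : |legendreP ℓ u| ≤ 1 := by
  set e : Sphere2 := ⟨EuclideanSpace.single 2 1, by simp⟩ with he
  set x : Sphere2 := ⟨!₂[√(1 - u ^ 2), 0, u], by
    rw [mem_sphere_zero_iff_norm, EuclideanSpace.norm_eq, Fin.sum_univ_three]
    have : 0 ≤ 1 - u ^ 2 := by nlinarith [hu.1, hu.2]
    simp [Real.sq_sqrt this]⟩ with hx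
  have hxu : cosColat x = u := by simp [cosColat, hx]
  have hc := continuous_legendreP ℓ
  have hsum := integral_cosAngle_zharm hc.continuousOn ℓ 0 (Nat.zero_le _) x
  have e1 : ∀ y, zharm ℓ 0 y = (legendreP ℓ (cosColat y) : ℂ) := by intro y; simp [zharm, legendreP]
  simp_rw [e1, ← Complex.ofReal_mul] at hsum
  rw [integral_complex_ofReal] at hsum
  have hsum' := Complex.ofReal_injective hsum
  rw [hxu] at hsum'
  have hk : kernelCoeff (legendreP ℓ) ℓ = 4 * Real.pi / (2 * ℓ + 1) := by
    rw [kernelCoeff, integral_legendreP_mul, if_pos rfl]; ring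
  have hkpos : 0 < 4 * Real.pi / (2 * (ℓ : ℝ) + 1) := by have := Real.pi_pos; positivity
  have h1 : ∫ y, legendreP ℓ (cosColat y) ^ 2 ∂surface = 4 * Real.pi / (2 * ℓ + 1) := by
    rw [← hk, kernelCoeff]
    refine Eq.trans ?_ (integral_surface_cosColat (hc.mul hc).continuousOn)
    simp [sq]
  have h2 : ∫ y, legendreP ℓ (cosAngle x y) ^ 2 ∂surface = 4 * Real.pi / (2 * ℓ + 1) := by
    obtain ⟨R, -, hR, -⟩ := exists_rotation (x := e) (x' := x) (y := 0) (y' := 0)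
      (by rw [norm_sphere, norm_sphere]) rfl (by simp)
    rw [← integral_rotate R, ← h1]
    refine integral_congr_ae (Eventually.of_forall fun y => ?_)
    simp only [cosAngle, rotate, cosColat]
    rw [← hR, R.inner_map_map, he, EuclideanSpace.inner_single_left]
    simp
  have i1 : Integrable (fun y => legendreP ℓ (cosColat y) ^ 2) surface :=
    integrable_surface ((hc.comp continuous_cosColat).pow 2)
  have i2 : Integrable (fun y => legendreP ℓ (cosAngle x y) ^ 2) surface :=
    integrable_surface ((hc.comp (continuous_cosAngle x)).pow 2)
  have h3 : |∫ y, legendreP ℓ (cosAngle x y) * legendreP ℓ (cosColat y) ∂surface| ≤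
      4 * Real.pi / (2 * ℓ + 1) := by
    calc _ ≤ ∫ y, |legendreP ℓ (cosAngle x y) * legendreP ℓ (cosColat y)| ∂surface :=
          abs_integral_le_integral_abs
      _ ≤ ∫ y, (legendreP ℓ (cosAngle x y) ^ 2 + legendreP ℓ (cosColat y) ^ 2) / 2 ∂surface := by
          refine integral_mono (integrable_surface ?_) ((i2.add i1).div_const 2) fun y => ?_
          · exact ((hc.comp (continuous_cosAngle x)).mul (hc.comp continuous_cosColat)).abs
          · simp only
            rw [abs_le]
            constructor <;> nlinarith [sq_nonneg (legendreP ℓ (cosAngle x y) - legendreP ℓ (cosColat y)),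
              sq_nonneg (legendreP ℓ (cosAngle x y) + legendreP ℓ (cosColat y))]
      _ = _ := by rw [integral_div, integral_add i2 i1, h1, h2]; ring
  rw [hsum', hk, abs_mul, abs_of_pos hkpos] at h3
  exact le_of_mul_le_mul_left (by linarith) hkpos

end Harmonics

/-! ### Concentration of squared norms of Gaussian vectors. -/

section Concentration

open scoped NNReal

/-- With `x = s v` the left side is the exact exponential moment of `s (g² - v)` for `g` centered
Gaussian of variance `v`. The bound follows from `log y ≥ 1 - 1/y` and `1/(1 - 2x) ≤ 1 + 2x + 8x²`.
-/
theorem exp_neg_mul_div_sqrt_le {x : ℝ} (hx : |x| ≤ 1 / 8) :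
    Real.exp (-x) * (√(1 - 2 * x))⁻¹ ≤ Real.exp (4 * x ^ 2) := by
  rw [abs_le] at hx
  have h1 : 0 < 1 - 2 * x := by linarith
  have h2 : (√(1 - 2 * x))⁻¹ = Real.exp (-(1 / 2) * Real.log (1 - 2 * x)) := by
    rw [Real.sqrt_eq_rpow, ← Real.rpow_neg h1.le, Real.rpow_def_of_pos h1, mul_comm]
  rw [h2, ← Real.exp_add, Real.exp_le_exp]
  have h3 := Real.one_sub_inv_le_log_of_pos h1
  have h4 : (1 - 2 * x)⁻¹ ≤ 1 + 2 * x + 8 * x ^ 2 := by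
    rw [inv_le_iff_one_le_mul₀ h1]
    nlinarith [mul_nonneg (sq_nonneg x) (show 0 ≤ 1 - 4 * x by linarith)]
  linarith

theorem integrable_exp_sq_gaussianReal (v : ℝ≥0) (s : ℝ) (hs : |s * v| ≤ 1 / 8) :
    Integrable (fun x => Real.exp (s * (x ^ 2 - v))) (gaussianReal 0 v) ∧
      ∫ x, Real.exp (s * (x ^ 2 - v)) ∂(gaussianReal 0 v) ≤ Real.exp (4 * (s * v) ^ 2) := by
  by_cases hv : v = 0
  · subst hv
    simp only [gaussianReal_zero_var]
    exact ⟨integrable_dirac (by simp), by simp⟩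
  · have hv0 : (0 : ℝ) < v := by positivity
    have hb : 0 < 1 / (2 * (v : ℝ)) - s := by
      rw [abs_le] at hs
      rw [sub_pos, lt_div_iff₀ (by positivity)]
      linarith
    have e1 : ∀ x : ℝ, gaussianPDFReal 0 v x * Real.exp (s * (x ^ 2 - v)) =
        ((√(2 * Real.pi * v))⁻¹ * Real.exp (-(s * v))) *
          Real.exp (-(1 / (2 * (v : ℝ)) - s) * x ^ 2) := by
      intro x
      rw [gaussianPDFReal, mul_assoc, ← Real.exp_add, mul_assoc (√(2 * Real.pi * (v : ℝ)))⁻¹,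
        ← Real.exp_add]
      congr 2
      field_simp
      ring
    constructor
    · rw [gaussianReal_of_var_ne_zero 0 hv]
      have : gaussianPDF 0 v = fun x => ENNReal.ofReal (gaussianPDFReal 0 v x) := rfl
      rw [this, integrable_withDensity_iff_integrable_smul₀'
        (measurable_gaussianPDFReal 0 v).ennreal_ofReal.aemeasurable
        (Eventually.of_forall fun _ => ENNReal.ofReal_lt_top)]
      simp_rw [ENNReal.toReal_ofReal (gaussianPDFReal_nonneg 0 v _), smul_eq_mul, e1]
      exact (integrable_exp_neg_mul_sq hb).const_mul _
    · rw [integral_gaussianReal_eq_integral_smul hv]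
      simp_rw [smul_eq_mul, e1]
      rw [integral_const_mul, integral_gaussian]
      have h1 : 0 < 1 - 2 * (s * v) := by
        rw [abs_le] at hs
        linarith
      have h2 : √(Real.pi / (1 / (2 * (v : ℝ)) - s)) = √(2 * Real.pi * v) * (√(1 - 2 * (s * v)))⁻¹ := by
        rw [← Real.sqrt_inv, ← Real.sqrt_mul (by positivity)]
        congr 1
        rw [show 1 / (2 * (v : ℝ)) - s = (1 - 2 * (s * v)) / (2 * v) by field_simp]
        field_simp
      have h3 : √(2 * Real.pi * v) ≠ 0 := (Real.sqrt_pos.2 (by positivity)).ne'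
      refine le_trans (le_of_eq ?_) (exp_neg_mul_div_sqrt_le hs)
      rw [h2]
      field_simp

theorem exp_sq_of_hasGaussianLaw {Ω : Type*} [MeasurableSpace Ω] {P : Measure Ω}
    {X : Ω → ℝ} (hX : HasGaussianLaw X P) (h0 : ∫ ω, X ω ∂P = 0)
    (s : ℝ) (hs : |s * ∫ ω, X ω ^ 2 ∂P| ≤ 1 / 8) :
    Integrable (fun ω => Real.exp (s * (X ω ^ 2 - ∫ ω, X ω ^ 2 ∂P))) P ∧
      ∫ ω, Real.exp (s * (X ω ^ 2 - ∫ ω, X ω ^ 2 ∂P)) ∂P ≤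
        Real.exp (4 * (s * ∫ ω, X ω ^ 2 ∂P) ^ 2) := by
  have hv0 : 0 ≤ ∫ ω, X ω ^ 2 ∂P := integral_nonneg fun _ => sq_nonneg _
  set v : ℝ≥0 := (∫ ω, X ω ^ 2 ∂P).toNNReal with hv
  have hv' : ∫ ω, X ω ^ 2 ∂P = v := (Real.coe_toNNReal _ hv0).symm
  have hmap : P.map X = gaussianReal 0 v := by
    rw [hX.map_eq_gaussianReal, h0, variance_of_integral_eq_zero hX.aemeasurable h0]
  have h := integrable_exp_sq_gaussianReal v s (by rwa [← hv'])
  rw [← hmap] at h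
  rw [integrable_map_measure (by fun_prop) hX.aemeasurable,
    integral_map hX.aemeasurable (by fun_prop)] at h
  rw [hv']
  exact h

/-- Concentration of a sum of squares of independent centered Gaussian variables. -/
theorem exp_sum_sq_of_indep {Ω ι : Type*} [Fintype ι] [MeasurableSpace Ω] {P : Measure Ω}
    [IsProbabilityMeasure P] {G : ι → Ω → ℝ} (hGm : ∀ i, Measurable (G i))
    (hG : ∀ i, HasGaussianLaw (G i) P)
    (hind : iIndepFun G P) (h0 : ∀ i, ∫ ω, G i ω ∂P = 0) {K : ℝ}
    (hK : ∀ i, ∫ ω, G i ω ^ 2 ∂P ≤ K) (s : ℝ) (hs : |s| * K ≤ 1 / 8) :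
    Integrable (fun ω => Real.exp (s * ∑ i, (G i ω ^ 2 - ∫ ω, G i ω ^ 2 ∂P))) P ∧
      ∫ ω, Real.exp (s * ∑ i, (G i ω ^ 2 - ∫ ω, G i ω ^ 2 ∂P)) ∂P ≤
        Real.exp (4 * Fintype.card ι * (s * K) ^ 2) := by
  have hv0 : ∀ i, 0 ≤ ∫ ω, G i ω ^ 2 ∂P := fun i => integral_nonneg fun _ => sq_nonneg _
  set X : ι → Ω → ℝ := fun i ω => G i ω ^ 2 - ∫ ω, G i ω ^ 2 ∂P with hX
  have hXind : iIndepFun X P :=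
    hind.comp (fun i x => x ^ 2 - ∫ ω, G i ω ^ 2 ∂P) (fun i => by fun_prop)
  have hXm : ∀ i, Measurable (X i) := fun i => ((hGm i).pow_const 2).sub_const _
  have hb : ∀ i, |s * ∫ ω, G i ω ^ 2 ∂P| ≤ |s| * K := fun i => by
    rw [abs_mul, abs_of_nonneg (hv0 i)]
    exact mul_le_mul_of_nonneg_left (hK i) (abs_nonneg _)
  have h1 := fun i => exp_sq_of_hasGaussianLaw (hG i) (h0 i) s ((hb i).trans hs)
  have e : ∀ ω, ∑ i, (G i ω ^ 2 - ∫ ω, G i ω ^ 2 ∂P) = (∑ i, X i) ω := by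
    intro ω; simp [hX]
  simp_rw [e]
  constructor
  · exact hXind.integrable_exp_mul_sum hXm fun i _ => (h1 i).1
  · have := hXind.mgf_sum (t := s) hXm (s := Finset.univ)
    rw [mgf] at this
    rw [this]
    calc ∏ i, mgf (X i) P s ≤ ∏ i : ι, Real.exp (4 * (s * K) ^ 2) := by
          refine Finset.prod_le_prod (fun i _ => mgf_nonneg) fun i _ => (h1 i).2.trans ?_
          rw [Real.exp_le_exp]
          have := pow_le_pow_left₀ (abs_nonneg _) (hb i) 2
          rw [sq_abs, mul_pow |s| K, sq_abs, ← mul_pow s K] at this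
          linarith
      _ = _ := by
          rw [Finset.prod_const, ← Real.exp_nat_mul, Finset.card_univ]
          congr 1; ring

/-- The Gaussian Hanson–Wright inequality, for a squared norm. -/
theorem measure_abs_sum_sq_sub_gt_le {Ω ι : Type*} [Fintype ι] [Nonempty ι] [MeasurableSpace Ω]
    {P : Measure Ω} [IsProbabilityMeasure P] {W : ι → Ω → ℝ} (hWm : ∀ i, Measurable (W i))
    (hW : HasGaussianLaw (fun ω i => W i ω) P) (h0 : ∀ i, ∫ ω, W i ω ∂P = 0) {K : ℝ}
    (hK : 0 ≤ K) (hQ : ∀ w : ι → ℝ, ∫ ω, (∑ i, w i * W i ω) ^ 2 ∂P ≤ K * ∑ i, w i ^ 2)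
    {η : ℝ} (hη : 0 ≤ η) :
    P.real {ω | |∑ i, W i ω ^ 2 - ∑ i, ∫ ω, W i ω ^ 2 ∂P| > Fintype.card ι * K * η} ≤
      2 * Real.exp (-(1 / 16) * Fintype.card ι * min (η ^ 2) η) := by
  classical
  have hn : (0 : ℝ) < Fintype.card ι := by exact_mod_cast Fintype.card_pos
  have hL2 : ∀ i, MemLp (W i) 2 P := fun i => (hW.eval i).memLp_two
  have hLint : ∀ i j, Integrable (fun ω => W i ω * W j ω) P := fun i j =>
    (hL2 i).integrable_mul (hL2 j)
  -- For `K = 0` the vector vanishes almost surely and the strict deviation event is null. This case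
  -- is separate because the Chernoff parameter below divides by `K`.
  rcases hK.eq_or_lt with rfl | hKpos
  · have hz : ∀ i, W i =ᵐ[P] 0 := by
      intro i
      have h1 := hQ (Pi.single i 1)
      simp only [Pi.single_apply, ite_mul, one_mul, zero_mul, Finset.sum_ite_eq',
        Finset.mem_univ, if_true] at h1
      have h2 := (integral_eq_zero_iff_of_nonneg (fun ω => sq_nonneg (W i ω))
        (hL2 i).integrable_sq).1 (le_antisymm h1 (integral_nonneg fun ω => sq_nonneg _))
      filter_upwards [h2] with ω hω
      simpa using hω
    have hz' : ∀ i, ∫ ω, W i ω ^ 2 ∂P = 0 := fun i => by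
      rw [integral_eq_zero_of_ae]
      filter_upwards [hz i] with ω hω
      simp [hω]
    have h3 : P.real {ω | |∑ i, W i ω ^ 2 - ∑ i, ∫ ω, W i ω ^ 2 ∂P| > Fintype.card ι * 0 * η} = 0 := by
      rw [measureReal_def, ENNReal.toReal_eq_zero_iff]
      left
      rw [← compl_mem_ae_iff]
      filter_upwards [eventually_all.2 hz] with ω hω
      simp [hω, hz']
    rw [h3]; positivity
  set Q : Matrix ι ι ℝ := Matrix.of fun i j => ∫ ω, W i ω * W j ω ∂P with hQdef
  have hQh : Q.IsHermitian := by
    ext i j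
    simp [hQdef, mul_comm]
  -- Coordinates in an eigenbasis of the covariance are uncorrelated and jointly Gaussian, hence
  -- independent, and the orthogonal change of basis keeps the sum of squares.
  set b := hQh.eigenvectorBasis with hb
  have hbil : ∀ u v : ι → ℝ, ∫ ω, (∑ i, u i * W i ω) * (∑ j, v j * W j ω) ∂P = u ⬝ᵥ (Q *ᵥ v) := by
    intro u v
    simp_rw [Finset.sum_mul_sum]
    have hi : ∀ i j, Integrable (fun ω => u i * W i ω * (v j * W j ω)) P := fun i j => by
      have := (hLint i j).const_mul (u i * v j)
      refine this.congr (Eventually.of_forall fun ω => ?_)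
      simp only; ring
    rw [integral_finsetSum _ fun i _ => integrable_finsetSum _ fun j _ => hi i j]
    simp_rw [integral_finsetSum _ fun j _ => hi _ j]
    simp only [dotProduct, Matrix.mulVec, hQdef, Matrix.of_apply, Finset.mul_sum]
    refine Finset.sum_congr rfl fun i _ => Finset.sum_congr rfl fun j _ => ?_
    rw [← integral_mul_const, ← integral_const_mul]
    refine integral_congr_ae (Eventually.of_forall fun ω => ?_)
    simp only; ring
  set G : ι → Ω → ℝ := fun k ω => ∑ i, b k i * W i ω with hG
  have hGm : ∀ k, Measurable (G k) := fun k =>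
    Finset.measurable_fun_sum _ fun i _ => (hWm i).const_mul _
  have hGlaw : HasGaussianLaw (fun ω k => G k ω) P := by
    have := hW.map (LinearMap.toContinuousLinearMap
      (Matrix.toLin' (Matrix.of fun k i => b k i : Matrix ι ι ℝ)))
    exact this
  have hG0 : ∀ k, ∫ ω, G k ω ∂P = 0 := fun k => by
    simp only [hG]
    rw [integral_finsetSum _ fun i _ => ((hL2 i).integrable one_le_two).const_mul _]
    simp [integral_const_mul, h0]
  have hGG : ∀ k l, ∫ ω, G k ω * G l ω ∂P = if k = l then hQh.eigenvalues l else 0 := by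
    intro k l
    simp only [hG]
    rw [hbil, hb, hQh.mulVec_eigenvectorBasis, dotProduct_smul]
    have := hQh.eigenvectorBasis.inner_eq_ite k l
    rw [EuclideanSpace.inner_eq_star_dotProduct] at this
    simp only [star_trivial] at this
    rw [dotProduct_comm, this]
    simp
  have hGL2 : ∀ k, MemLp (G k) 2 P := fun k => (hGlaw.eval k).memLp_two
  have hind : iIndepFun G P := by
    refine hGlaw.iIndepFun_of_covariance_eq_zero fun k l hkl => ?_
    rw [covariance_eq_sub (hGL2 k) (hGL2 l), hG0, zero_mul, sub_zero]
    refine Eq.trans ?_ ((hGG k l).trans (if_neg hkl))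
    rfl
  have hsum : ∀ ω, ∑ k, G k ω ^ 2 = ∑ i, W i ω ^ 2 := by
    intro ω
    have h1 := b.sum_sq_norm_inner_right (WithLp.toLp 2 fun i => W i ω)
    rw [EuclideanSpace.norm_sq_eq] at h1
    simp only [Real.norm_eq_abs, sq_abs] at h1
    rw [← h1]
    refine Finset.sum_congr rfl fun k _ => ?_
    rw [EuclideanSpace.inner_eq_star_dotProduct, dotProduct_comm]
    simp [hG, dotProduct]
  have hGK : ∀ k, ∫ ω, G k ω ^ 2 ∂P ≤ K := by
    intro k
    have h1 := hQ (b k)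
    have h2 : ∑ i, b k i ^ 2 = 1 := by
      have := b.norm_eq_one k
      have h3 : ‖b k‖ ^ 2 = 1 := by rw [this, one_pow]
      rw [EuclideanSpace.norm_sq_eq] at h3
      simpa using h3
    rw [h2, mul_one] at h1
    exact h1
  have hsumE : ∑ k, ∫ ω, G k ω ^ 2 ∂P = ∑ i, ∫ ω, W i ω ^ 2 ∂P := by
    rw [← integral_finsetSum _ fun k _ => (hGL2 k).integrable_sq,
      ← integral_finsetSum _ fun i _ => (hL2 i).integrable_sq]
    simp_rw [hsum]
  set S : Ω → ℝ := fun ω => ∑ i, W i ω ^ 2 - ∑ i, ∫ ω, W i ω ^ 2 ∂P with hS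
  have hSG : ∀ ω, ∑ k, (G k ω ^ 2 - ∫ ω, G k ω ^ 2 ∂P) = S ω := by
    intro ω
    rw [Finset.sum_sub_distrib, hsum, hsumE]
  -- With `m = min η 1` this gives `θK = m/8 ≤ 1/8`, as the moment bound requires, and the Chernoff
  -- exponent `-n m η/8 + n m²/16 ≤ -n m η/16`. Since `m η = min (η²) η`, this is where the constant
  -- `1/16` originates.
  set θ : ℝ := min η 1 / (8 * K) with hθ
  have hm0 : 0 ≤ min η 1 := le_min hη zero_le_one
  have hθ0 : 0 ≤ θ := by positivity
  have hθK : θ * K = min η 1 / 8 := by rw [hθ]; field_simp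
  have hθK' : θ * K ≤ 1 / 8 := by
    rw [hθK]; linarith [min_le_right η 1]
  have hminsq : min (η ^ 2) η = η * min η 1 := by
    rcases le_total η 1 with h | h
    · rw [min_eq_left h, min_eq_left (by nlinarith)]; ring
    · rw [min_eq_right h, min_eq_right (by nlinarith)]; ring
  have hexp : Real.exp (-θ * (Fintype.card ι * K * η)) *
      Real.exp (4 * Fintype.card ι * (θ * K) ^ 2) ≤
      Real.exp (-(1 / 16) * Fintype.card ι * min (η ^ 2) η) := by
    rw [← Real.exp_add, Real.exp_le_exp, show -θ * (Fintype.card ι * K * η) =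
      -(Fintype.card ι * (θ * K) * η) by ring, hθK, hminsq]
    have : min η 1 * min η 1 ≤ η * min η 1 := mul_le_mul_of_nonneg_right (min_le_left _ _) hm0
    nlinarith
  have hup := exp_sum_sq_of_indep hGm (fun k => hGlaw.eval k) hind hG0 hGK θ
    (by rwa [abs_of_nonneg hθ0])
  have hlo := exp_sum_sq_of_indep hGm (fun k => hGlaw.eval k) hind hG0 hGK (-θ)
    (by rwa [abs_neg, abs_of_nonneg hθ0])
  simp_rw [hSG] at hup hlo
  have c1 := measure_ge_le_exp_mul_mgf (μ := P) (X := S) (Fintype.card ι * K * η) hθ0 hup.1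
  have c2 := measure_le_le_exp_mul_mgf (μ := P) (X := S) (-(Fintype.card ι * K * η))
    (neg_nonpos.2 hθ0) hlo.1
  have d1 : P.real {ω | Fintype.card ι * K * η ≤ S ω} ≤
      Real.exp (-(1 / 16) * Fintype.card ι * min (η ^ 2) η) :=
    c1.trans ((mul_le_mul_of_nonneg_left hup.2 (Real.exp_pos _).le).trans hexp)
  have d2 : P.real {ω | S ω ≤ -(Fintype.card ι * K * η)} ≤
      Real.exp (-(1 / 16) * Fintype.card ι * min (η ^ 2) η) := by
    refine c2.trans ((mul_le_mul_of_nonneg_left hlo.2 (Real.exp_pos _).le).trans ?_)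
    rwa [neg_neg, mul_neg, ← neg_mul, neg_mul θ K, neg_sq]
  calc _ ≤ P.real ({ω | Fintype.card ι * K * η ≤ S ω} ∪ {ω | S ω ≤ -(Fintype.card ι * K * η)}) := by
        refine measureReal_mono fun ω hω => ?_
        have hω' : Fintype.card ι * K * η < |S ω| := hω
        rcases lt_abs.1 hω' with h | h
        · exact Or.inl h.le
        · exact Or.inr (show S ω ≤ _ by linarith)
    _ ≤ _ := (measureReal_union_le _ _).trans (by linarith)

end Concentration

/-! ### The closed `L²` span of a Gaussian process. -/

section GaussianSpan

/-- Cauchy–Schwarz, from the nonpositive discriminant of `t ↦ ∫ (f t + g)²`. -/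
theorem sq_integral_mul_le {α : Type*} [MeasurableSpace α] {μ : Measure α} {f g : α → ℝ}
    (hf : MemLp f 2 μ) (hg : MemLp g 2 μ) :
    (∫ x, f x * g x ∂μ) ^ 2 ≤ (∫ x, f x ^ 2 ∂μ) * ∫ x, g x ^ 2 ∂μ := by
  have hfg : Integrable (fun x => f x * g x) μ := hf.integrable_mul hg
  have h := discrim_le_zero (a := ∫ x, f x ^ 2 ∂μ) (b := 2 * ∫ x, f x * g x ∂μ)
    (c := ∫ x, g x ^ 2 ∂μ) fun t => by
      have : ∫ x, (f x * t + g x) ^ 2 ∂μ = (∫ x, f x ^ 2 ∂μ) * (t * t) +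
          2 * (∫ x, f x * g x ∂μ) * t + ∫ x, g x ^ 2 ∂μ := by
        have i1 := hf.integrable_sq.mul_const (t * t)
        have i2 := hfg.mul_const (2 * t)
        have i3 : Integrable (fun x => f x ^ 2 * (t * t) + f x * g x * (2 * t)) μ := i1.add i2
        rw [mul_comm 2, mul_assoc, ← integral_mul_const, ← integral_mul_const, ← integral_add i1 i2,
          ← integral_add i3 hg.integrable_sq]
        refine integral_congr_ae (Eventually.of_forall fun x => ?_)
        simp only
        ring
      rw [← this]
      exact integral_nonneg fun x => sq_nonneg _
  rw [discrim] at h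
  linarith

variable {Ω : Type*} [MeasurableSpace Ω] {ι : Type*}

/-- The closed linear span of a family of random variables in `L²`. -/
def gaussSpan (P : Measure Ω) (X : ι → Ω → ℝ) : Submodule ℝ (Lp ℝ 2 P) :=
  (Submodule.span ℝ {g : Lp ℝ 2 P | ∃ i, g =ᵐ[P] X i}).topologicalClosure

/-- `f` belongs to the closed linear span of the family `X`. -/
def MemGaussSpan (P : Measure Ω) (X : ι → Ω → ℝ) (f : Ω → ℝ) : Prop :=
  ∃ g ∈ gaussSpan P X, f =ᵐ[P] g

variable {P : Measure Ω} {X : ι → Ω → ℝ} {f g : Ω → ℝ}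

theorem MemGaussSpan.memLp (hf : MemGaussSpan P X f) : MemLp f 2 P := by
  obtain ⟨g, -, hg⟩ := hf
  exact (Lp.memLp g).ae_eq hg.symm

theorem MemGaussSpan.congr (hf : MemGaussSpan P X f) (h : g =ᵐ[P] f) : MemGaussSpan P X g := by
  obtain ⟨k, hk, e⟩ := hf
  exact ⟨k, hk, h.trans e⟩

theorem MemGaussSpan.add (hf : MemGaussSpan P X f) (hg : MemGaussSpan P X g) :
    MemGaussSpan P X fun ω => f ω + g ω := by
  obtain ⟨k, hk, e⟩ := hf
  obtain ⟨l, hl, e'⟩ := hg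
  refine ⟨k + l, add_mem hk hl, ?_⟩
  filter_upwards [e, e', Lp.coeFn_add k l] with ω h1 h2 h3
  rw [h3, h1, h2]; rfl

theorem MemGaussSpan.const_mul (hf : MemGaussSpan P X f) (c : ℝ) :
    MemGaussSpan P X fun ω => c * f ω := by
  obtain ⟨k, hk, e⟩ := hf
  refine ⟨c • k, Submodule.smul_mem _ _ hk, ?_⟩
  filter_upwards [e, Lp.coeFn_smul c k] with ω h1 h3
  rw [h3, h1]; rfl

theorem MemGaussSpan.zero : MemGaussSpan P X fun _ => 0 :=
  ⟨0, zero_mem _, (Lp.coeFn_zero ℝ 2 P).symm⟩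

theorem MemGaussSpan.sum {κ : Type*} {s : Finset κ} {F : κ → Ω → ℝ}
    (h : ∀ i ∈ s, MemGaussSpan P X (F i)) : MemGaussSpan P X fun ω => ∑ i ∈ s, F i ω := by
  classical
  induction s using Finset.induction_on with
  | empty => simpa using MemGaussSpan.zero
  | insert a s ha ih =>
    simp only [Finset.sum_insert ha]
    exact (h a (Finset.mem_insert_self _ _)).add
      (ih fun i hi => h i (Finset.mem_insert_of_mem hi))

/-- The double orthogonal complement of a family in `L²` is its closed span. -/
theorem memGaussSpan_of_orthogonal (hX : ∀ i, MemLp (X i) 2 P) (hf : MemLp f 2 P)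
    (h : ∀ Y : Ω → ℝ, MemLp Y 2 P → (∀ i, ∫ ω, Y ω * X i ω ∂P = 0) → ∫ ω, Y ω * f ω ∂P = 0) :
    MemGaussSpan P X f := by
  refine ⟨hf.toLp f, ?_, hf.coeFn_toLp.symm⟩
  rw [gaussSpan, ← Submodule.orthogonal_orthogonal_eq_closure, Submodule.mem_orthogonal]
  intro u hu
  rw [L2.inner_def]
  have h1 := h u (Lp.memLp u) fun i => by
    have h2 := hu ((hX i).toLp (X i)) (Submodule.subset_span ⟨i, (hX i).coeFn_toLp⟩)
    rw [L2.inner_def] at h2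
    rw [← h2]
    refine integral_congr_ae ?_
    filter_upwards [(hX i).coeFn_toLp] with ω hω
    simp [hω]
  rw [← h1]
  refine integral_congr_ae ?_
  filter_upwards [hf.coeFn_toLp] with ω hω
  simp [hω, mul_comm]

/-- `|e^{ia} - 1| ≤ |a|` and the domination of the `L¹` norm by the `L²` norm make the
characteristic function Lipschitz on `L²`, so having a given Gaussian one is a closed condition. -/
theorem norm_integral_exp_sub_le [IsProbabilityMeasure P] (s : ℝ) (f g : Lp ℝ 2 P) :
    ‖∫ ω, Complex.exp (Complex.I * ((s * f ω : ℝ) : ℂ)) ∂P -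
      ∫ ω, Complex.exp (Complex.I * ((s * g ω : ℝ) : ℂ)) ∂P‖ ≤ |s| * ‖f - g‖ := by
  have hi : ∀ f : Lp ℝ 2 P, Integrable (fun ω => Complex.exp (Complex.I * ((s * f ω : ℝ) : ℂ))) P := by
    intro f
    refine Integrable.of_bound (C := 1) ?_ (Eventually.of_forall fun ω => ?_)
    · have := (Lp.aestronglyMeasurable f).aemeasurable
      exact AEMeasurable.aestronglyMeasurable (by fun_prop)
    · rw [mul_comm, Complex.norm_exp_ofReal_mul_I]
  rw [← integral_sub (hi f) (hi g)]
  have hsub : MemLp (fun ω => f ω - g ω) 2 P := (Lp.memLp f).sub (Lp.memLp g)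
  have hint : Integrable (fun ω => |f ω - g ω|) P := (hsub.integrable one_le_two).abs
  calc _ ≤ ∫ ω, |s| * |f ω - g ω| ∂P := by
        refine norm_integral_le_of_norm_le (hint.const_mul _) (Eventually.of_forall fun ω => ?_)
        have h1 : Complex.exp (Complex.I * ((s * f ω : ℝ) : ℂ)) -
            Complex.exp (Complex.I * ((s * g ω : ℝ) : ℂ)) =
            Complex.exp (((s * g ω : ℝ) : ℂ) * Complex.I) *
              (Complex.exp (Complex.I * ((s * (f ω - g ω) : ℝ) : ℂ)) - 1) := by
          rw [mul_sub, ← Complex.exp_add, mul_one, mul_comm Complex.I ((s * g ω : ℝ) : ℂ)]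
          congr 2
          push_cast
          ring
        rw [h1, norm_mul, Complex.norm_exp_ofReal_mul_I, one_mul, ← abs_mul]
        exact Real.norm_exp_I_mul_ofReal_sub_one_le
    _ = |s| * ∫ ω, |f ω - g ω| ∂P := integral_const_mul _ _
    _ ≤ |s| * ‖f - g‖ := by
        refine mul_le_mul_of_nonneg_left ?_ (abs_nonneg s)
        have h2 := sq_integral_mul_le (f := fun ω => |f ω - g ω|) (g := fun _ => (1 : ℝ)) (μ := P)
          hsub.abs (memLp_const 1)
        simp only [mul_one, sq_abs, one_pow, integral_const, probReal_univ, smul_eq_mul] at h2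
        have h3 : ‖f - g‖ ^ 2 = ∫ ω, (f ω - g ω) ^ 2 ∂P := by
          rw [← real_inner_self_eq_norm_sq, L2.inner_def]
          refine integral_congr_ae ?_
          filter_upwards [Lp.coeFn_sub f g] with ω hω
          simp only [RCLike.inner_apply, conj_trivial]
          rw [hω, Pi.sub_apply, sq]
        rw [← h3] at h2
        exact (le_abs_self _).trans (abs_le_of_sq_le_sq h2 (norm_nonneg _))

theorem norm_sq_Lp (f : Lp ℝ 2 P) : ‖f‖ ^ 2 = ∫ ω, f ω ^ 2 ∂P := by
  rw [← real_inner_self_eq_norm_sq, L2.inner_def]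
  simp [sq]

/-- The formula holds for finite linear combinations, which are Gaussian, and both sides are
continuous in `L²`. -/
theorem integral_exp_of_mem_gaussSpan [IsProbabilityMeasure P] (hX : IsGaussianProcess X P)
    (h0 : ∀ i, ∫ ω, X i ω ∂P = 0) {f : Lp ℝ 2 P} (hf : f ∈ gaussSpan P X) (s : ℝ) :
    ∫ ω, Complex.exp (Complex.I * ((s * f ω : ℝ) : ℂ)) ∂P =
      Complex.exp (((-(s ^ 2 * ‖f‖ ^ 2 / 2) : ℝ)) : ℂ) := by
  have hclosed : IsClosed {f : Lp ℝ 2 P | ∫ ω, Complex.exp (Complex.I * ((s * f ω : ℝ) : ℂ)) ∂P =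
      Complex.exp (((-(s ^ 2 * ‖f‖ ^ 2 / 2) : ℝ)) : ℂ)} := by
    refine isClosed_eq ?_ (by fun_prop)
    have : LipschitzWith (Real.toNNReal |s|)
        (fun f : Lp ℝ 2 P => ∫ ω, Complex.exp (Complex.I * ((s * f ω : ℝ) : ℂ)) ∂P) := by
      refine LipschitzWith.of_dist_le_mul fun f g => ?_
      rw [dist_eq_norm, dist_eq_norm, Real.coe_toNNReal _ (abs_nonneg s)]
      exact norm_integral_exp_sub_le s f g
    exact this.continuous
  refine closure_minimal (fun f hf => ?_) hclosed hf
  obtain ⟨n, c, g, hg⟩ := Submodule.mem_span_set'.1 hf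
  choose i hi using fun k => (g k).2
  have hLp : ∀ j, MemLp (X j) 2 P := fun j => (hX.hasGaussianLaw_eval j).memLp_two
  have hfae : f =ᵐ[P] fun ω => ∑ k, c k * X (i k) ω := by
    have h1 : ∀ k, ((c k • (g k : Lp ℝ 2 P) : Lp ℝ 2 P) : Ω → ℝ) =ᵐ[P] fun ω => c k * X (i k) ω := by
      intro k
      filter_upwards [Lp.coeFn_smul (c k) (g k : Lp ℝ 2 P), hi k] with ω h1 h2
      rw [h1, Pi.smul_apply, h2, smul_eq_mul]
    rw [← hg]
    filter_upwards [Lp.coeFn_finsetSum Finset.univ fun k => c k • (g k : Lp ℝ 2 P), eventually_all.2 h1]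
      with ω h2 h3
    rw [h2]
    simp [h3]
  have hlaw : HasGaussianLaw (fun ω => ∑ k, c k * X (i k) ω) P := by
    classical
    have h1 := (hX.comp_right i).hasGaussianLaw Finset.univ
    have h2 := h1.map (∑ k : Fin n, c k • ContinuousLinearMap.proj
      (R := ℝ) (φ := fun _ : (Finset.univ : Finset (Fin n)) => ℝ) ⟨k, Finset.mem_univ k⟩)
    refine h2.congr (Eventually.of_forall fun ω => ?_)
    simp [Finset.restrict_def]
  have hlaw' : HasGaussianLaw f P := hlaw.congr hfae.symm
  have hmean : ∫ ω, f ω ∂P = 0 := by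
    rw [integral_congr_ae hfae, integral_finsetSum _ fun k _ =>
      ((hLp (i k)).integrable one_le_two).const_mul _]
    simp [integral_const_mul, h0]
  have h := hlaw'.charFun_map_eq s
  rw [charFun_apply_real, integral_map hlaw'.aemeasurable (by fun_prop)] at h
  simp only [RCLike.inner_apply, conj_trivial] at h
  have hv : Var[fun ω => f ω * s; P] = s ^ 2 * ‖f‖ ^ 2 := by
    rw [variance_of_integral_eq_zero (hlaw'.aemeasurable.mul_const s)
      (by rw [integral_mul_const, hmean, zero_mul]), norm_sq_Lp, ← integral_const_mul]
    refine integral_congr_ae (Eventually.of_forall fun ω => ?_)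
    simp only; ring
  rw [hv, integral_mul_const, hmean] at h
  rw [Set.mem_ofPred_eq]
  refine Eq.trans ?_ (h.trans ?_)
  · refine integral_congr_ae (Eventually.of_forall fun ω => ?_)
    simp only
    congr 1
    push_cast
    ring
  · congr 1
    push_cast
    ring

/-- The mean is the inner product with the constant `1`, a continuous functional that vanishes on
the generators. -/
theorem MemGaussSpan.integral_eq_zero [IsProbabilityMeasure P] (h0 : ∀ i, ∫ ω, X i ω ∂P = 0) (hf : MemGaussSpan P X f) : ∫ ω, f ω ∂P = 0 := by
  obtain ⟨g, hg, e⟩ := hf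
  rw [integral_congr_ae e]
  have h1 : g ∈ ((innerSL ℝ ((memLp_const (1 : ℝ)).toLp _ : Lp ℝ 2 P)).ker : Submodule ℝ (Lp ℝ 2 P)) := by
    refine Submodule.topologicalClosure_minimal _ ?_ (ContinuousLinearMap.isClosed_ker _) hg
    rw [Submodule.span_le]
    rintro k ⟨i, hi⟩
    simp only [SetLike.mem_coe, LinearMap.mem_ker, ContinuousLinearMap.coe_coe, innerSL_apply_apply]
    rw [L2.inner_def, ← h0 i]
    refine integral_congr_ae ?_
    filter_upwards [hi] with ω h2
    simp [h2]
  simp only [LinearMap.mem_ker, ContinuousLinearMap.coe_coe, innerSL_apply_apply] at h1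
  rw [L2.inner_def] at h1
  rw [← h1]
  simp

/-- Finite families in the closed span of a centered Gaussian process are jointly Gaussian. -/
theorem hasGaussianLaw_of_memGaussSpan [IsProbabilityMeasure P] (hX : IsGaussianProcess X P)
    (h0 : ∀ i, ∫ ω, X i ω ∂P = 0) {κ : Type*} [Fintype κ] {W : κ → Ω → ℝ}
    (hW : ∀ k, MemGaussSpan P X (W k)) : HasGaussianLaw (fun ω k => W k ω) P := by
  classical
  have hm : ∀ k, AEMeasurable (W k) P := fun k => (hW k).memLp.aestronglyMeasurable.aemeasurable
  have hmW : AEMeasurable (fun ω k => W k ω) P := aemeasurable_pi_lambda _ hm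
  rw [hasGaussianLaw_iff_charFunDual_map_eq hmW]
  intro L
  rw [charFunDual_apply, integral_map hmW (by fun_prop)]
  have hL : ∀ ω, L (fun k => W k ω) = ∑ k, L (Pi.single k 1) * W k ω := by
    intro ω
    conv_lhs => rw [← Finset.univ_sum_single (fun k => W k ω), map_sum]
    refine Finset.sum_congr rfl fun k _ => ?_
    have : (Pi.single k (W k ω) : κ → ℝ) = W k ω • Pi.single k 1 := by
      ext j; simp [Pi.single_apply]
    rw [this, map_smul, smul_eq_mul, mul_comm]
  have hmem : MemGaussSpan P X fun ω => L fun k => W k ω := by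
    simp_rw [hL]
    exact MemGaussSpan.sum fun k _ => (hW k).const_mul _
  have hmean : ∫ ω, (L ∘ fun ω k => W k ω) ω ∂P = 0 := hmem.integral_eq_zero h0
  rw [hmean]
  have hmem' := hmem
  obtain ⟨g, hg, e⟩ := hmem
  have h := integral_exp_of_mem_gaussSpan hX h0 hg 1
  have hv : Var[L ∘ fun ω k => W k ω; P] = ‖g‖ ^ 2 := by
    refine (variance_of_integral_eq_zero (hmem'.memLp.aestronglyMeasurable.aemeasurable :
      AEMeasurable (L ∘ fun ω k => W k ω) P) hmean).trans ?_
    rw [norm_sq_Lp]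
    refine integral_congr_ae ?_
    filter_upwards [e] with ω hω
    simp [← hω]
  rw [hv]
  refine Eq.trans ?_ (h.trans ?_)
  · refine integral_congr_ae ?_
    filter_upwards [e] with ω hω
    rw [← hω]
    simp [mul_comm]
  · congr 1
    push_cast
    ring

end GaussianSpan

/-! ### Second-order random fields on the sphere and their integrals. -/

section Fields

variable {Ω : Type*} [MeasurableSpace Ω] {P : Measure Ω}

/-- A measurable random field on the sphere with bounded second moments. -/
structure IsL2Field (P : Measure Ω) (F : Sphere2 → Ω → ℝ) : Prop where
  measurable : Measurable fun q : Sphere2 × Ω => F q.1 q.2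
  memLp : ∀ x, MemLp (F x) 2 P
  bounded : ∃ K, ∀ x, ∫ ω, F x ω ^ 2 ∂P ≤ K

namespace IsL2Field

variable {F : Sphere2 → Ω → ℝ} {g : Sphere2 → ℝ}

theorem integrable_sq [IsProbabilityMeasure P] (hF : IsL2Field P F) :
    Integrable (fun q : Sphere2 × Ω => F q.1 q.2 ^ 2) (surface.prod P) := by
  have hm : Measurable fun q : Sphere2 × Ω => F q.1 q.2 ^ 2 := hF.measurable.pow_const 2
  obtain ⟨K, hK⟩ := hF.bounded
  rw [integrable_prod_iff hm.aestronglyMeasurable]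
  refine ⟨Eventually.of_forall fun x => (hF.memLp x).integrable_sq, ?_⟩
  refine Integrable.of_bound (C := K)
    (hm.norm.stronglyMeasurable.integral_prod_right').aestronglyMeasurable
    (Eventually.of_forall fun x => ?_)
  rw [Real.norm_of_nonneg (integral_nonneg fun _ => norm_nonneg _)]
  refine le_trans (le_of_eq ?_) (hK x)
  simp

theorem ae_memLp [IsProbabilityMeasure P] (hF : IsL2Field P F) :
    ∀ᵐ ω ∂P, MemLp (fun x => F x ω) 2 surface := by
  filter_upwards [hF.integrable_sq.swap.prod_right_ae] with ω hω
  have hm : Measurable fun x => F x ω := hF.measurable.comp (measurable_id.prodMk measurable_const)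
  exact (memLp_two_iff_integrable_sq hm.aestronglyMeasurable).2 hω

theorem measurable_integral (hF : IsL2Field P F) (hg : Continuous g) :
    Measurable fun ω => ∫ x, F x ω * g x ∂surface := by
  have hm : Measurable fun q : Sphere2 × Ω => F q.1 q.2 * g q.1 :=
    hF.measurable.mul (hg.measurable.comp measurable_fst)
  exact (hm.stronglyMeasurable.integral_prod_left').measurable

theorem memLp_of_continuous (hg : Continuous g) : MemLp g 2 surface :=
  (memLp_two_iff_integrable_sq hg.measurable.aestronglyMeasurable).2 (integrable_surface (hg.pow 2))

theorem memLp_integral [IsProbabilityMeasure P] (hF : IsL2Field P F) (hg : Continuous g) :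
    MemLp (fun ω => ∫ x, F x ω * g x ∂surface) 2 P := by
  have hm := (hF.measurable_integral hg).aestronglyMeasurable (μ := P)
  rw [memLp_two_iff_integrable_sq hm]
  have h1 : Integrable (fun ω => (∫ x, F x ω ^ 2 ∂surface) * ∫ x, g x ^ 2 ∂surface) P :=
    hF.integrable_sq.integral_prod_right.mul_const _
  refine h1.mono' (hm.pow 2) ?_
  filter_upwards [hF.ae_memLp] with ω hω
  rw [Real.norm_of_nonneg (sq_nonneg _)]
  exact sq_integral_mul_le hω (memLp_of_continuous hg)

theorem integral_mul_integral [IsProbabilityMeasure P] (hF : IsL2Field P F) (hg : Continuous g)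
    {Y : Ω → ℝ} (hY : MemLp Y 2 P) :
    ∫ ω, Y ω * ∫ x, F x ω * g x ∂surface ∂P = ∫ x, (∫ ω, Y ω * F x ω ∂P) * g x ∂surface := by
  have hi : Integrable (fun q : Sphere2 × Ω => Y q.2 * F q.1 q.2 * g q.1) (surface.prod P) := by
    obtain ⟨C, hC⟩ : ∃ C, ∀ x, |g x| ≤ C := by
      obtain ⟨C, hC⟩ := isCompact_univ.exists_bound_of_continuousOn hg.continuousOn
      exact ⟨C, fun x => hC x (Set.mem_univ x)⟩
    have h1 : Integrable (fun q : Sphere2 × Ω => Y q.2 ^ 2) (surface.prod P) :=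
      hY.integrable_sq.comp_snd _
    refine ((h1.add hF.integrable_sq).const_mul C).mono' ?_ (Eventually.of_forall fun q => ?_)
    · exact ((hY.aestronglyMeasurable.comp_snd).mul hF.measurable.aestronglyMeasurable).mul
        (hg.measurable.comp measurable_fst).aestronglyMeasurable
    · rw [Real.norm_eq_abs, abs_mul, mul_comm]
      refine mul_le_mul (hC _) ?_ (abs_nonneg _) ((abs_nonneg _).trans (hC q.1))
      simp only [Pi.add_apply]
      rw [abs_le]
      constructor <;> nlinarith [sq_nonneg (Y q.2 - F q.1 q.2), sq_nonneg (Y q.2 + F q.1 q.2),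
        sq_nonneg (Y q.2), sq_nonneg (F q.1 q.2)]
  calc _ = ∫ ω, ∫ x, Y ω * F x ω * g x ∂surface ∂P := by
        refine integral_congr_ae (Eventually.of_forall fun ω => ?_)
        simp only
        rw [← integral_const_mul]
        simp_rw [mul_assoc]
    _ = ∫ x, ∫ ω, Y ω * F x ω * g x ∂P ∂surface := (integral_integral_swap hi).symm
    _ = _ := by simp_rw [integral_mul_const]

/-- By Fubini, whatever is orthogonal to every `X i` is orthogonal to the integral; this takes the
place of an approximation by Riemann sums. -/
theorem memGaussSpan_integral [IsProbabilityMeasure P] (hF : IsL2Field P F) (hg : Continuous g)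
    {ι : Type*} {X : ι → Ω → ℝ} (hX : ∀ i, MemLp (X i) 2 P) (h : ∀ x, ∃ i, F x = X i) :
    MemGaussSpan P X fun ω => ∫ x, F x ω * g x ∂surface := by
  refine memGaussSpan_of_orthogonal hX (hF.memLp_integral hg) fun Y hY h0 => ?_
  rw [hF.integral_mul_integral hg hY]
  have : ∀ x, ∫ ω, Y ω * F x ω ∂P = 0 := fun x => by
    obtain ⟨i, hi⟩ := h x
    rw [hi, h0]
  simp [this]

/-- Covariance of harmonic coefficients for fields with isotropic cross-covariance. -/
theorem integral_integral_mul_sphHarm [IsProbabilityMeasure P] {G : Sphere2 → Ω → ℝ}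
    (hF : IsL2Field P F) (hG : IsL2Field P G) {κ : ℝ → ℝ} (hκ : ContinuousOn κ (Set.Icc (-1) 1))
    (h : ∀ x y, ∫ ω, F x ω * G y ω ∂P = κ (cosAngle x y)) (ℓ : ℕ) (m m' : ℤ)
    (hm : m.natAbs ≤ ℓ) :
    ∫ ω, (∫ x, F x ω * sphHarm ℓ m x ∂surface) * (∫ y, G y ω * sphHarm ℓ m' y ∂surface) ∂P =
      if m = m' then kernelCoeff κ ℓ else 0 := by
  rw [hG.integral_mul_integral (continuous_sphHarm ℓ m')
    (hF.memLp_integral (continuous_sphHarm ℓ m))]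
  have h1 : ∀ y, ∫ ω, (∫ x, F x ω * sphHarm ℓ m x ∂surface) * G y ω ∂P =
      kernelCoeff κ ℓ * sphHarm ℓ m y := by
    intro y
    simp_rw [mul_comm _ (G y _)]
    rw [hF.integral_mul_integral (continuous_sphHarm ℓ m) (hG.memLp y),
      ← integral_cosAngle_sphHarm hκ ℓ m hm y]
    simp_rw [mul_comm (G y _), h, cosAngle_comm y]
  simp_rw [h1, mul_assoc]
  rw [integral_const_mul, integral_sphHarm_mul ℓ m m' hm]
  split_ifs <;> simp

end IsL2Field

end Fields

/-! ### The angular power spectrum of the noise. -/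

section Spectra

variable {Ω : Type*} [MeasurableSpace Ω] {P : Measure Ω}

theorem IsSphericalWhiteNoise.isL2Field {CZ : ℕ → ℝ} {Z : Sphere2 → ℤ → Ω → ℝ}
    (hZ : IsSphericalWhiteNoise P CZ Z) (t : ℤ) : IsL2Field P fun x ω => Z x t ω where
  measurable := hZ.measurable t
  memLp x := ((hZ.gaussian t).hasGaussianLaw_eval x).memLp_two
  bounded := by
    refine ⟨∑' ℓ : ℕ, (2 * (ℓ : ℝ) + 1) / (4 * Real.pi) * CZ ℓ, fun x => ?_⟩
    have h := hZ.covariance x x t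
    simp_rw [sq]
    refine h.tsum_eq ▸ h.summable.tsum_le_tsum (fun ℓ => ?_) hZ.power_summable
    have h1 := (abs_le.1 (abs_legendreP_le_one ℓ (cosAngle_mem x x))).2
    have h2 := hZ.power_pos ℓ
    have := Real.pi_pos
    exact mul_le_of_le_one_right (by positivity) h1

/-- The covariance function of the noise in terms of the cosine of the angle. -/
def noiseCov (CZ : ℕ → ℝ) (u : ℝ) : ℝ :=
  ∑' ℓ : ℕ, (2 * (ℓ : ℝ) + 1) / (4 * Real.pi) * CZ ℓ * legendreP ℓ u

theorem IsSphericalWhiteNoise.bound {CZ : ℕ → ℝ} {Z : Sphere2 → ℤ → Ω → ℝ}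
    (hZ : IsSphericalWhiteNoise P CZ Z) (ℓ : ℕ) {u : ℝ} (hu : u ∈ Set.Icc (-1 : ℝ) 1) :
    ‖(2 * (ℓ : ℝ) + 1) / (4 * Real.pi) * CZ ℓ * legendreP ℓ u‖ ≤
      (2 * (ℓ : ℝ) + 1) / (4 * Real.pi) * CZ ℓ := by
  have h2 := hZ.power_pos ℓ
  have := Real.pi_pos
  rw [norm_mul, Real.norm_of_nonneg (by positivity)]
  exact mul_le_of_le_one_right (by positivity) (abs_legendreP_le_one ℓ hu)

theorem IsSphericalWhiteNoise.continuousOn_noiseCov {CZ : ℕ → ℝ} {Z : Sphere2 → ℤ → Ω → ℝ}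
    (hZ : IsSphericalWhiteNoise P CZ Z) : ContinuousOn (noiseCov CZ) (Set.Icc (-1) 1) :=
  continuousOn_tsum (fun ℓ => (continuous_const.mul (continuous_legendreP ℓ)).continuousOn)
    hZ.power_summable fun ℓ _ hu => hZ.bound ℓ hu

/-- The series is integrated termwise, dominated by the summable spectrum since `|P_ℓ| ≤ 1`, and
orthogonality leaves a single term. -/
theorem IsSphericalWhiteNoise.kernelCoeff_noiseCov {CZ : ℕ → ℝ} {Z : Sphere2 → ℤ → Ω → ℝ}
    (hZ : IsSphericalWhiteNoise P CZ Z) (ℓ : ℕ) : kernelCoeff (noiseCov CZ) ℓ = CZ ℓ := by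
  have hc : ∀ k : ℕ, Continuous fun u => (2 * (k : ℝ) + 1) / (4 * Real.pi) * CZ k * legendreP k u *
      legendreP ℓ u := fun k =>
    (continuous_const.mul (continuous_legendreP k)).mul (continuous_legendreP ℓ)
  have h := intervalIntegral.hasSum_integral_of_dominated_convergence (μ := volume)
    (a := -1) (b := 1)
    (F := fun (k : ℕ) u => (2 * (k : ℝ) + 1) / (4 * Real.pi) * CZ k * legendreP k u * legendreP ℓ u)
    (f := fun u => noiseCov CZ u * legendreP ℓ u)
    (fun (k : ℕ) _ => (2 * (k : ℝ) + 1) / (4 * Real.pi) * CZ k)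
    (fun k => (hc k).aestronglyMeasurable)
    (fun k => Eventually.of_forall fun u hu => by
      rw [Set.uIoc_of_le (by norm_num)] at hu
      have hu' : u ∈ Set.Icc (-1 : ℝ) 1 := ⟨hu.1.le, hu.2⟩
      rw [norm_mul]
      exact (mul_le_of_le_one_right (norm_nonneg _) (abs_legendreP_le_one ℓ hu')).trans
        (hZ.bound k hu'))
    (Eventually.of_forall fun _ _ => hZ.power_summable)
    (by simp)
    (Eventually.of_forall fun u hu => by
      rw [Set.uIoc_of_le (by norm_num)] at hu
      have hu' : u ∈ Set.Icc (-1 : ℝ) 1 := ⟨hu.1.le, hu.2⟩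
      exact (Summable.of_norm_bounded hZ.power_summable fun k => hZ.bound k hu').hasSum.mul_right _)
  rw [kernelCoeff, ← h.tsum_eq, tsum_eq_single ℓ]
  · simp_rw [mul_assoc ((2 * (ℓ : ℝ) + 1) / (4 * Real.pi) * CZ ℓ)]
    rw [intervalIntegral.integral_const_mul, integral_legendreP_mul, if_pos rfl]
    have := Real.pi_pos
    field_simp
    norm_num
  · intro k hk
    simp_rw [mul_assoc ((2 * (k : ℝ) + 1) / (4 * Real.pi) * CZ k)]
    rw [intervalIntegral.integral_const_mul, integral_legendreP_mul, if_neg hk, mul_zero]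

/-- The harmonic coefficients of the noise are uncorrelated, with variance `C_ℓ`. -/
theorem IsSphericalWhiteNoise.integral_harmCoeff_mul [IsProbabilityMeasure P] {CZ : ℕ → ℝ} {Z : Sphere2 → ℤ → Ω → ℝ}
    (hZ : IsSphericalWhiteNoise P CZ Z) (ℓ : ℕ) (m m' : ℤ) (t s : ℤ)
    (hm : m.natAbs ≤ ℓ) :
    ∫ ω, harmCoeff Z ℓ m t ω * harmCoeff Z ℓ m' s ω ∂P = if m = m' ∧ t = s then CZ ℓ else 0 := by
  by_cases hts : t = s
  · subst hts
    have h := (hZ.isL2Field t).integral_integral_mul_sphHarm (hZ.isL2Field t)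
      hZ.continuousOn_noiseCov (fun x y => (hZ.covariance x y t).tsum_eq.symm) ℓ m m' hm
    rw [hZ.kernelCoeff_noiseCov] at h
    simpa [harmCoeff] using h
  -- At distinct times independence makes the cross-covariance zero, which is isotropic with kernel
  -- `κ = 0`.
  · have h := (hZ.isL2Field t).integral_integral_mul_sphHarm (hZ.isL2Field s) (κ := fun _ => 0)
      continuousOn_const (fun x y => by
        have hp : ∀ x, Measurable fun f : Sphere2 → ℝ => f x := fun x => measurable_pi_apply x
        have hind := (hZ.indep.indepFun hts).comp (φ := fun f : Sphere2 → ℝ => f x)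
          (ψ := fun f : Sphere2 → ℝ => f y) (hp x) (hp y)
        have h2 := hind.integral_fun_mul_eq_mul_integral
          ((hZ.isL2Field t).memLp x).aestronglyMeasurable
          ((hZ.isL2Field s).memLp y).aestronglyMeasurable
        refine h2.trans ?_
        have := hZ.centered x t
        simp only [Function.comp_def, this, zero_mul]) ℓ m m' hm
    simpa [harmCoeff, kernelCoeff, hts] using h

end Spectra

/-! ### Isotropic stationary fields and the equation for their coefficients. -/

section Stationary

variable {Ω : Type*} [MeasurableSpace Ω] {P : Measure Ω} {p : ℕ} {k : Fin p → ℝ → ℝ} {CZ : ℕ → ℝ}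
  {T Z : Sphere2 → ℤ → Ω → ℝ}

theorem IsSPHAR.memLp (h : IsSPHAR P k CZ T Z) (x : Sphere2) (t : ℤ) :
    MemLp (fun ω => T x t ω) 2 P :=
  (h.gaussian.hasGaussianLaw_eval (x, t)).memLp_two

theorem IsSPHAR.integral_rotate_mul (h : IsSPHAR P k CZ T Z) {R : R3 ≃ₗᵢ[ℝ] R3} (hR : IsRotation R)
    (τ : ℤ) (x y : Sphere2) (t s : ℤ) :
    ∫ ω, T (rotate R x) (t + τ) ω * T (rotate R y) (s + τ) ω ∂P = ∫ ω, T x t ω * T y s ω ∂P := by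
  have hm : Measurable fun f : Sphere2 × ℤ → ℝ => f (x, t) * f (y, s) :=
    (measurable_pi_apply (x, t)).mul (measurable_pi_apply (y, s))
  exact ((h.isotropic_stationary R hR τ).comp hm).integral_eq

/-- The point of colatitude `θ` on the zero meridian. -/
def meridian (θ : ℝ) : Sphere2 :=
  ⟨!₂[Real.sin θ, 0, Real.cos θ], by
    rw [mem_sphere_zero_iff_norm, EuclideanSpace.norm_eq, Fin.sum_univ_three]
    simp⟩

theorem cosAngle_meridian (θ : ℝ) : cosAngle (meridian 0) (meridian θ) = Real.cos θ := by
  simp only [cosAngle, meridian]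
  rw [PiLp.inner_apply, Fin.sum_univ_three]
  simp

theorem continuous_meridian : Continuous meridian := by
  refine Continuous.subtype_mk ?_ _
  refine (PiLp.continuous_toLp 2 _).comp (continuous_pi fun i => ?_)
  fin_cases i
  · exact Real.continuous_sin
  · exact continuous_const
  · exact Real.continuous_cos

/-- The covariance at time lag `τ`, in terms of the cosine of the angle. -/
def fieldCov (P : Measure Ω) (T : Sphere2 → ℤ → Ω → ℝ) (τ : ℤ) (u : ℝ) : ℝ :=
  ∫ ω, T (meridian 0) τ ω * T (meridian (Real.arccos u)) 0 ω ∂P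

/-- A rotation moves the reference pair on the zero meridian to `(x, y)`, and a time shift by `s`
accounts for the lag. -/
theorem IsSPHAR.integral_mul_eq_fieldCov (h : IsSPHAR P k CZ T Z) (x y : Sphere2) (t s : ℤ) :
    ∫ ω, T x t ω * T y s ω ∂P = fieldCov P T (t - s) (cosAngle x y) := by
  have hu := cosAngle_mem x y
  obtain ⟨R, hR, h1, h2⟩ := exists_rotation (x := (meridian 0 : R3)) (x' := x)
    (y := meridian (Real.arccos (cosAngle x y))) (y' := y)
    (by rw [norm_sphere, norm_sphere]) (by rw [norm_sphere, norm_sphere])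
    ((cosAngle_meridian _).trans (Real.cos_arccos hu.1 hu.2))
  have h3 := h.integral_rotate_mul hR s (meridian 0) (meridian (Real.arccos (cosAngle x y))) (t - s) 0
  rw [sub_add_cancel, zero_add, show rotate R (meridian 0) = x from Subtype.ext h1,
    show rotate R (meridian (Real.arccos (cosAngle x y))) = y from Subtype.ext h2] at h3
  exact h3

theorem IsSPHAR.isL2Field (h : IsSPHAR P k CZ T Z) (t : ℤ) : IsL2Field P fun x ω => T x t ω where
  measurable := h.measurable t
  memLp x := h.memLp x t
  bounded := ⟨fieldCov P T 0 1, fun x => by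
    have := h.integral_mul_eq_fieldCov x x t t
    rw [sub_self, cosAngle_self] at this
    rw [← this]
    simp_rw [sq]
    exact le_rfl⟩

/-- Mean-square continuity passes to covariances by Cauchy–Schwarz, and `arccos` parametrises the
meridian continuously. Continuity is what Funk–Hecke asks of a kernel. -/
theorem IsSPHAR.continuousOn_fieldCov (h : IsSPHAR P k CZ T Z) (τ : ℤ) :
    ContinuousOn (fieldCov P T τ) (Set.Icc (-1) 1) := by
  have hc : Continuous fun y => ∫ ω, T (meridian 0) τ ω * T y 0 ω ∂P := by
    rw [continuous_iff_continuousAt]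
    intro x
    rw [ContinuousAt, tendsto_iff_dist_tendsto_zero]
    have hlim : Tendsto (fun y => √((∫ ω, T (meridian 0) τ ω ^ 2 ∂P) *
        ∫ ω, (T y 0 ω - T x 0 ω) ^ 2 ∂P)) (𝓝 x) (𝓝 0) := by
      have := ((h.meanSquare_continuous x 0).const_mul (∫ ω, T (meridian 0) τ ω ^ 2 ∂P)).sqrt
      simpa using this
    refine squeeze_zero (fun _ => dist_nonneg) (fun y => ?_) hlim
    have hx := h.memLp x 0
    have hy := h.memLp y 0
    have he := h.memLp (meridian 0) τ
    have i1 : Integrable (fun ω => T (meridian 0) τ ω * T y 0 ω) P := he.integrable_mul hy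
    have i2 : Integrable (fun ω => T (meridian 0) τ ω * T x 0 ω) P := he.integrable_mul hx
    rw [Real.dist_eq, ← integral_sub i1 i2]
    refine Real.abs_le_sqrt ?_
    have := sq_integral_mul_le he (hy.sub hx)
    simp_rw [← mul_sub]
    exact this
  exact (hc.comp (continuous_meridian.comp Real.continuous_arccos)).continuousOn

theorem IsSPHAR.measurable_harmCoeff (h : IsSPHAR P k CZ T Z) (ℓ : ℕ) (m t : ℤ) :
    Measurable (harmCoeff T ℓ m t) :=
  (h.isL2Field t).measurable_integral (continuous_sphHarm ℓ m)

theorem IsSPHAR.measurable_harmCoeff_noise (h : IsSPHAR P k CZ T Z) (ℓ : ℕ) (m t : ℤ) :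
    Measurable (harmCoeff Z ℓ m t) :=
  (h.noise.isL2Field t).measurable_integral (continuous_sphHarm ℓ m)

variable [IsProbabilityMeasure P]

theorem IsSPHAR.integral_harmCoeff_mul (h : IsSPHAR P k CZ T Z) (ℓ : ℕ) (m m' : ℤ) (t s : ℤ)
    (hm : m.natAbs ≤ ℓ) :
    ∫ ω, harmCoeff T ℓ m t ω * harmCoeff T ℓ m' s ω ∂P =
      if m = m' then kernelCoeff (fieldCov P T (t - s)) ℓ else 0 :=
  (h.isL2Field t).integral_integral_mul_sphHarm (h.isL2Field s) (h.continuousOn_fieldCov (t - s))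
    (fun x y => h.integral_mul_eq_fieldCov x y t s) ℓ m m' hm

theorem IsSPHAR.memGaussSpan_harmCoeff (h : IsSPHAR P k CZ T Z) (ℓ : ℕ) (m t : ℤ) :
    MemGaussSpan P (fun (q : Sphere2 × ℤ) ω => T q.1 q.2 ω) (harmCoeff T ℓ m t) :=
  (h.isL2Field t).memGaussSpan_integral (continuous_sphHarm ℓ m) (fun q => h.memLp q.1 q.2)
    fun x => ⟨(x, t), rfl⟩

/-- Fubini moves the symmetric kernel operator onto `Y_{ℓ,m}`, where Funk–Hecke applies. -/
theorem integral_kernelOp_mul_sphHarm {κ : ℝ → ℝ} (hκ : ContinuousOn κ (Set.Icc (-1) 1))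
    {f : Sphere2 → ℝ} (hf : Integrable f surface) (ℓ : ℕ) (m : ℤ) (hm : m.natAbs ≤ ℓ) :
    Integrable (fun x => kernelOp κ f x * sphHarm ℓ m x) surface ∧
      ∫ x, kernelOp κ f x * sphHarm ℓ m x ∂surface =
        kernelCoeff κ ℓ * ∫ x, f x * sphHarm ℓ m x ∂surface := by
  have hc : Continuous fun q : Sphere2 × Sphere2 => κ (cosAngle q.1 q.2) * sphHarm ℓ m q.1 :=
    (hκ.comp_continuous continuous_cosAngle_prod fun q => cosAngle_mem q.1 q.2).mul
      ((continuous_sphHarm ℓ m).comp continuous_fst)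
  obtain ⟨C, hC⟩ := isCompact_univ.exists_bound_of_continuousOn hc.continuousOn
  have hi : Integrable (fun q : Sphere2 × Sphere2 =>
      κ (cosAngle q.1 q.2) * sphHarm ℓ m q.1 * f q.2) (surface.prod surface) :=
    (hf.comp_snd surface).bdd_mul hc.aestronglyMeasurable
      (Eventually.of_forall fun q => hC q (Set.mem_univ q))
  have e : ∀ x, kernelOp κ f x * sphHarm ℓ m x =
      ∫ y, κ (cosAngle x y) * sphHarm ℓ m x * f y ∂surface := by
    intro x
    rw [kernelOp, ← integral_mul_const]
    refine integral_congr_ae (Eventually.of_forall fun y => ?_)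
    simp only; ring
  simp_rw [e]
  refine ⟨hi.integral_prod_left, ?_⟩
  rw [integral_integral_swap hi, ← integral_const_mul]
  refine integral_congr_ae (Eventually.of_forall fun y => ?_)
  simp only
  rw [integral_mul_const]
  have := integral_cosAngle_sphHarm hκ ℓ m hm y
  simp_rw [cosAngle_comm y] at this
  rw [this]
  ring

/-- The harmonic coefficients of the field form autoregressive processes. -/
theorem IsSPHAR.harmCoeff_equation (h : IsSPHAR P k CZ T Z) (ℓ : ℕ) (m t : ℤ) (hm : m.natAbs ≤ ℓ) :
    ∀ᵐ ω ∂P, harmCoeff T ℓ m t ω =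
      ∑ j : Fin p, kernelCoeff (k j) ℓ * harmCoeff T ℓ m (t - ((j : ℕ) + 1)) ω +
        harmCoeff Z ℓ m t ω := by
  have h1 : ∀ᵐ ω ∂P, ∀ j : Fin p, MemLp (fun x => T x (t - ((j : ℕ) + 1)) ω) 2 surface :=
    eventually_all.2 fun j => (h.isL2Field (t - ((j : ℕ) + 1))).ae_memLp
  filter_upwards [h.equation t, h1, (h.noise.isL2Field t).ae_memLp] with ω e hT hZ
  have hk := fun j => integral_kernelOp_mul_sphHarm (h.kernel_continuous j)
    ((hT j).integrable one_le_two) ℓ m hm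
  have hZi : Integrable (fun x => Z x t ω * sphHarm ℓ m x) surface :=
    hZ.integrable_mul (IsL2Field.memLp_of_continuous (continuous_sphHarm ℓ m))
  simp only [harmCoeff]
  simp_rw [← fun j => (hk j).2]
  rw [← integral_finsetSum _ fun j _ => (hk j).1, ← integral_add
    (integrable_finsetSum _ fun j _ => (hk j).1) hZi]
  refine integral_congr_ae ?_
  filter_upwards [e] with x hx
  rw [hx, add_mul, Finset.sum_mul]

end Stationary

/-! ### Causal inversion of the autoregressive polynomial. -/

section Autoregression

/-- The power series `f` has an inverse with absolutely summable coefficients. -/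
def HasSummableInverse (f : PowerSeries ℂ) : Prop :=
  ∃ g : PowerSeries ℂ, (Summable fun n => ‖PowerSeries.coeff n g‖) ∧ f * g = 1

theorem HasSummableInverse.mul {f₁ f₂ : PowerSeries ℂ} (h₁ : HasSummableInverse f₁)
    (h₂ : HasSummableInverse f₂) : HasSummableInverse (f₁ * f₂) := by
  obtain ⟨g₁, s₁, e₁⟩ := h₁
  obtain ⟨g₂, s₂, e₂⟩ := h₂
  have e : f₁ * f₂ * (g₁ * g₂) = (f₁ * g₁) * (f₂ * g₂) := by ring
  refine ⟨g₁ * g₂, ?_, by rw [e, e₁, e₂, one_mul]⟩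
  have := summable_norm_sum_mul_antidiagonal_of_summable_norm s₁ s₂
  exact this.congr fun n => by rw [PowerSeries.coeff_mul]

theorem hasSummableInverse_C {c : ℂ} (hc : c ≠ 0) : HasSummableInverse (PowerSeries.C c) := by
  refine ⟨PowerSeries.C c⁻¹, ?_, by rw [← map_mul, mul_inv_cancel₀ hc, map_one]⟩
  refine summable_of_ne_finset_zero (s := {0}) fun n hn => ?_
  rw [PowerSeries.coeff_C, if_neg (by simpa using hn), norm_zero]

theorem hasSummableInverse_X_sub_C {ρ : ℂ} (hρ : 1 < ‖ρ‖) :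
    HasSummableInverse (PowerSeries.X - PowerSeries.C ρ) := by
  have h0 : ρ ≠ 0 := norm_pos_iff.1 (zero_lt_one.trans hρ)
  refine ⟨PowerSeries.mk fun n => -(ρ⁻¹) ^ (n + 1), ?_, ?_⟩
  · simp_rw [PowerSeries.coeff_mk, norm_neg, norm_pow]
    refine (summable_nat_add_iff 1).2 (summable_geometric_of_lt_one (norm_nonneg _) ?_)
    rw [norm_inv]
    exact inv_lt_one_of_one_lt₀ hρ
  · ext n
    rw [sub_mul, map_sub, PowerSeries.coeff_C_mul]
    cases n with
    | zero => simp [h0]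
    | succ n =>
      rw [PowerSeries.coeff_succ_X_mul, PowerSeries.coeff_mk, PowerSeries.coeff_mk,
        PowerSeries.coeff_one, if_neg n.succ_ne_zero]
      have : ρ * ρ⁻¹ = 1 := mul_inv_cancel₀ h0
      linear_combination (ρ⁻¹) ^ (n + 1) * this

/-- Factor `q` into linear terms. A root outside the closed disk gives a convergent geometric
series, and Cauchy products preserve absolute summability. -/
theorem hasSummableInverse_of_no_roots {q : Polynomial ℂ} (hq : ∀ z : ℂ, ‖z‖ ≤ 1 → q.eval z ≠ 0) :
    HasSummableInverse (q : PowerSeries ℂ) := by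
  have hq0 : q ≠ 0 := fun h => hq 0 (by simp) (by simp [h])
  rw [(IsAlgClosed.splits q).eq_prod_roots, Polynomial.coe_mul, Polynomial.coe_C]
  refine (hasSummableInverse_C (Polynomial.leadingCoeff_ne_zero.2 hq0)).mul ?_
  have hr : ∀ ρ ∈ q.roots, 1 < ‖ρ‖ := fun ρ hρ => by
    by_contra! h
    exact hq ρ h (Polynomial.isRoot_of_mem_roots hρ)
  generalize q.roots = s at hr
  induction s using Multiset.induction with
  | empty => simpa using hasSummableInverse_C one_ne_zero
  | cons a s ih =>
    rw [Multiset.map_cons, Multiset.prod_cons, Polynomial.coe_mul, Polynomial.coe_sub,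
      Polynomial.coe_X, Polynomial.coe_C]
    exact (hasSummableInverse_X_sub_C (hr a (Multiset.mem_cons_self a s))).mul
      (ih fun ρ hρ => hr ρ (Multiset.mem_cons_of_mem hρ))

/-- The coefficients of the causal moving average representation of an autoregressive process. -/
theorem exists_causal_inverse {p : ℕ} (φ : Fin p → ℝ)
    (hφ : ∀ z : ℂ, ‖z‖ ≤ 1 → 1 - ∑ j : Fin p, (φ j : ℂ) * z ^ ((j : ℕ) + 1) ≠ 0) :
    ∃ Ψ : ℤ → ℝ, Summable Ψ ∧ (∀ n < 0, Ψ n = 0) ∧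
      ∀ n, Ψ n - ∑ j : Fin p, φ j * Ψ (n - ((j : ℕ) + 1)) = if n = 0 then 1 else 0 := by
  let q : Polynomial ℂ :=
    1 - ∑ j : Fin p, Polynomial.C (φ j : ℂ) * Polynomial.X ^ ((j : ℕ) + 1)
  have hq : ∀ z : ℂ, ‖z‖ ≤ 1 → q.eval z ≠ 0 := fun z hz => by
    have := hφ z hz
    simpa [q, Polynomial.eval_finsetSum] using this
  obtain ⟨g, hs, hg⟩ := hasSummableInverse_of_no_roots hq
  have hqc : (q : PowerSeries ℂ) =
      1 - ∑ j : Fin p, PowerSeries.C (φ j : ℂ) * PowerSeries.X ^ ((j : ℕ) + 1) := by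
    have := map_sum (Polynomial.coeToPowerSeries.ringHom (R := ℂ))
      (fun j : Fin p => Polynomial.C (φ j : ℂ) * Polynomial.X ^ ((j : ℕ) + 1)) Finset.univ
    simp only [Polynomial.coeToPowerSeries.ringHom_apply] at this
    simp [q, this]
  -- Real parts still satisfy the recursion because the `φ_j` are real. Extension by zero to
  -- negative indices is what makes the filter causal.
  let ψ : ℤ → ℝ := fun n => if 0 ≤ n then (PowerSeries.coeff n.toNat g).re else 0
  have hn : ∀ n : ℕ, ψ n = (PowerSeries.coeff n g).re := fun n => by simp [ψ]
  have hneg : ∀ n < 0, ψ n = 0 := fun n hn => if_neg (not_le.2 hn)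
  refine ⟨ψ, ?_, hneg, fun n => ?_⟩
  · have h1 : Summable fun n : ℕ => ψ n := by
      simp_rw [hn]
      exact Summable.of_norm_bounded hs fun n => Complex.abs_re_le_norm _
    have h2 : Summable fun n : ℕ => ψ (-(n + 1)) := by
      refine summable_zero.congr fun n => (hneg _ (by omega)).symm
    exact Summable.of_nat_of_neg_add_one h1 h2
  · rcases lt_or_ge n 0 with h0 | h0
    · rw [hneg n h0, if_neg h0.ne, Finset.sum_eq_zero, sub_zero]
      exact fun j _ => by rw [hneg _ (by omega), mul_zero]
    · lift n to ℕ using h0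
      have := congrArg (fun f => (PowerSeries.coeff n f).re) hg
      simp only [hqc, sub_mul, one_mul, Finset.sum_mul, map_sub, map_sum, mul_assoc,
        PowerSeries.coeff_C_mul, PowerSeries.coeff_X_pow_mul', PowerSeries.coeff_one,
        Complex.sub_re, Complex.re_sum, Complex.re_ofReal_mul] at this
      rw [hn]
      convert this using 2
      · refine Finset.sum_congr rfl fun j _ => ?_
        congr 1
        split_ifs with h
        · rw [← hn]
          congr 1
          push_cast [Nat.cast_sub h]
          ring
        · rw [hneg _ (by omega), Complex.zero_re]
      · simp only [Nat.cast_eq_zero]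
        split_ifs <;> simp

theorem summable_mul_of_bounded {ι : Type*} {f b : ι → ℝ} (hf : Summable f) {B : ℝ}
    (hb : ∀ i, |b i| ≤ B) : Summable fun i => f i * b i := by
  refine Summable.of_norm_bounded (g := fun i => |f i| * B) (hf.abs.mul_right B) fun i => ?_
  rw [Real.norm_eq_abs, abs_mul]
  exact mul_le_mul_of_nonneg_left (hb i) (abs_nonneg _)

/-- In `∑ Ψ(n) e(t-n)` the autoregressive filter can be moved from `b` onto `Ψ`, where it yields a
unit impulse. Boundedness of `b` and summability of `Ψ` justify the rearrangement, so a bounded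
solution is determined by `e`. -/
theorem eq_tsum_of_autoregression {p : ℕ} {φ : Fin p → ℝ} {Ψ b e : ℤ → ℝ} (hs : Summable Ψ)
    (hΨ : ∀ n, Ψ n - ∑ j : Fin p, φ j * Ψ (n - ((j : ℕ) + 1)) = if n = 0 then 1 else 0)
    {B : ℝ} (hb : ∀ t, |b t| ≤ B)
    (he : ∀ t, b t - ∑ j : Fin p, φ j * b (t - ((j : ℕ) + 1)) = e t) (t : ℤ) :
    b t = ∑' n, Ψ n * e (t - n) := by
  have h1 : ∀ d : ℤ, HasSum (fun n => Ψ (n - d) * b (t - n)) (∑' n, Ψ n * b (t - n - d)) := by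
    intro d
    have := (summable_mul_of_bounded hs fun n => hb (t - n - d)).hasSum
    rw [← (Equiv.subRight d).hasSum_iff] at this
    convert this using 3 with n
    simp only [Function.comp_apply, Equiv.subRight_apply]
    congr 2
    ring
  have h2 : ∀ d : ℤ, HasSum (fun n => Ψ n * b (t - n - d)) (∑' n, Ψ n * b (t - n - d)) := fun d =>
    (summable_mul_of_bounded hs fun n => hb (t - n - d)).hasSum
  have h3 := (h1 0).sub (hasSum_sum (s := Finset.univ) fun (j : Fin p) _ =>
    (h1 ((j : ℕ) + 1)).mul_left (φ j))
  have h4 := (h2 0).sub (hasSum_sum (s := Finset.univ) fun (j : Fin p) _ =>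
    (h2 ((j : ℕ) + 1)).mul_left (φ j))
  have e4 : ∀ n, Ψ n * e (t - n) = Ψ n * b (t - n - 0) -
      ∑ j : Fin p, φ j * (Ψ n * b (t - n - ((j : ℕ) + 1))) := fun n => by
    rw [← he, mul_sub, Finset.mul_sum, sub_zero]
    congr 1
    exact Finset.sum_congr rfl fun j _ => by ring
  have e3 : ∀ n, Ψ (n - 0) * b (t - n) - ∑ j : Fin p, φ j * (Ψ (n - ((j : ℕ) + 1)) * b (t - n)) =
      if n = 0 then b t else 0 := fun n => by
    have : (Ψ n - ∑ j : Fin p, φ j * Ψ (n - ((j : ℕ) + 1))) * b (t - n) =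
      if n = 0 then b t else 0 := by
      rw [hΨ]
      split_ifs with h
      · rw [h, sub_zero, one_mul]
      · rw [zero_mul]
    rw [← this, sub_mul, Finset.sum_mul, sub_zero]
    congr 1
    exact Finset.sum_congr rfl fun j _ => by ring
  simp_rw [e3] at h3
  simp_rw [e4]
  rw [h4.tsum_eq, ← h3.unique (hasSum_ite_eq 0 (b t))]

/-- Autocovariances of a causal autoregression are absolutely summable, and the past is
uncorrelated with the innovations. -/
theorem autoregression_covariance {p : ℕ} {φ : Fin p → ℝ} {Ψ γ : ℤ → ℝ} {c : ℤ → ℤ → ℝ} {C : ℝ}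
    (hs : Summable Ψ)
    (hΨ : ∀ n, Ψ n - ∑ j : Fin p, φ j * Ψ (n - ((j : ℕ) + 1)) = if n = 0 then 1 else 0)
    {B : ℝ} (hγ : ∀ t, |γ t| ≤ B) (hc : ∀ t s, |c t s| ≤ B)
    (hcz : ∀ t s, c t s - ∑ j : Fin p, φ j * c (t - ((j : ℕ) + 1)) s = if t = s then C else 0)
    (hγc : ∀ t, γ t - ∑ j : Fin p, φ j * γ (t - ((j : ℕ) + 1)) = c 0 t) :
    (∀ t s, c t s = C * Ψ (t - s)) ∧ Summable γ := by
  have h1 : ∀ t s, c t s = C * Ψ (t - s) := by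
    intro t s
    rw [eq_tsum_of_autoregression hs hΨ (b := fun t => c t s) (fun t => hc t s)
      (fun t => hcz t s) t, tsum_eq_single (t - s)]
    · rw [if_pos (by ring), mul_comm]
    · intro n hn
      rw [if_neg (fun h => hn (by linarith)), mul_zero]
  refine ⟨h1, ?_⟩
  have h2 : ∀ t, γ t = ∑' n, Ψ n * (C * Ψ (n - t)) := by
    intro t
    rw [eq_tsum_of_autoregression hs hΨ hγ hγc t]
    refine tsum_congr fun n => ?_
    rw [h1]
    congr 3
    ring
  have h3 : Summable fun q : ℤ × ℤ => Ψ q.1 * (C * Ψ q.2) :=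
    summable_mul_of_summable_norm hs.norm (hs.mul_left C).norm
  -- The reindexing `(t, n) ↦ (n, n - t)` turns the correlation sum for `γ t` into a product of two
  -- absolutely summable families; summing over `n` leaves summability in `t`.
  let e : ℤ × ℤ ≃ ℤ × ℤ :=
    { toFun := fun q => (q.2, q.2 - q.1)
      invFun := fun q => (q.1 - q.2, q.1)
      left_inv := fun q => by simp
      right_inv := fun q => by simp }
  have h4 := ((e.summable_iff).2 h3).prod
  refine h4.congr fun t => ?_
  rw [h2]
  rfl

end Autoregression

/-! ### Toeplitz forms are bounded by their symbol. -/

section SpectralBound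

theorem integral_cos_int_mul (k : ℤ) :
    ∫ ν in (-Real.pi)..Real.pi, Real.cos (k * ν) = if k = 0 then 2 * Real.pi else 0 := by
  split_ifs with h
  · simp [h]; ring
  · have : (k : ℝ) ≠ 0 := Int.cast_ne_zero.2 h
    rw [intervalIntegral.integral_comp_mul_left (fun x => Real.cos x) this, integral_cos,
      mul_neg, Real.sin_neg, Real.sin_int_mul_pi]
    simp

theorem integral_cos_int_mul_mul_cos (d n : ℤ) :
    ∫ ν in (-Real.pi)..Real.pi, Real.cos (d * ν) * Real.cos (n * ν) =
      (if n = d then Real.pi else 0) + if n = -d then Real.pi else 0 := by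
  have e : ∀ ν : ℝ, Real.cos (d * ν) * Real.cos (n * ν) =
      2⁻¹ * (Real.cos (((d - n : ℤ) : ℝ) * ν) + Real.cos (((d + n : ℤ) : ℝ) * ν)) := fun ν => by
    push_cast
    rw [sub_mul, add_mul, Real.cos_sub, Real.cos_add]
    ring
  have hc : ∀ k : ℤ, IntervalIntegrable (fun ν : ℝ => Real.cos (k * ν)) volume (-Real.pi) Real.pi :=
    fun k => Continuous.intervalIntegrable (by fun_prop) _ _
  simp_rw [e]
  rw [intervalIntegral.integral_const_mul, intervalIntegral.integral_add (hc _) (hc _),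
    integral_cos_int_mul, integral_cos_int_mul, mul_add]
  congr 1
  · simp only [show d - n = 0 ↔ n = d by omega]
    split_ifs <;> ring
  · simp only [show d + n = 0 ↔ n = -d by omega]
    split_ifs <;> ring

theorem integral_cos_mul_tsum {γ : ℤ → ℝ} (hγ : Summable γ) (d : ℤ) :
    ∫ ν in (-Real.pi)..Real.pi, Real.cos (d * ν) * ∑' n : ℤ, γ n * Real.cos (n * ν) =
      Real.pi * (γ d + γ (-d)) := by
  have h1 := intervalIntegral.hasSum_integral_of_dominated_convergence (μ := volume)
    (a := -Real.pi) (b := Real.pi)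
    (F := fun (n : ℤ) ν => γ n * (Real.cos (d * ν) * Real.cos (n * ν)))
    (f := fun ν => Real.cos (d * ν) * ∑' n : ℤ, γ n * Real.cos (n * ν))
    (fun n _ => |γ n|) (fun n => Continuous.aestronglyMeasurable (by fun_prop))
    (fun n => Eventually.of_forall fun ν _ => by
      rw [Real.norm_eq_abs, abs_mul, abs_mul]
      exact mul_le_of_le_one_right (abs_nonneg _)
        (mul_le_one₀ (Real.abs_cos_le_one _) (abs_nonneg _) (Real.abs_cos_le_one _)))
    (Eventually.of_forall fun _ _ => hγ.abs) (by simp)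
    (Eventually.of_forall fun ν _ => by
      have := (summable_mul_of_bounded hγ fun n : ℤ =>
        Real.abs_cos_le_one (n * ν)).hasSum.mul_left (Real.cos (d * ν))
      simp_rw [mul_left_comm] at this ⊢
      exact this)
  simp_rw [intervalIntegral.integral_const_mul, integral_cos_int_mul_mul_cos, mul_add] at h1
  have h2 : ∀ d : ℤ, HasSum (fun n => γ n * if n = d then Real.pi else 0) (γ d * Real.pi) := by
    intro d
    convert hasSum_ite_eq d (γ d * Real.pi) using 2 with n
    split_ifs with h
    · rw [h]
    · rw [mul_zero]
  rw [h1.unique ((h2 d).add (h2 (-d)))]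
  ring

/-- A covariance whose spectral density is bounded has a bounded quadratic form. -/
theorem sum_mul_mul_le_of_spectral_bound {ι : Type*} [Fintype ι] [DecidableEq ι] {γ : ℤ → ℝ} (hγ : Summable γ)
    {K : ℝ} (hK : ∀ z : Circle, (∑' n : ℤ, (γ n : ℂ) * (z : ℂ) ^ n).re ≤ K) {t : ι → ℤ}
    (ht : Function.Injective t) (w : ι → ℝ) :
    ∑ i, ∑ j, w i * w j * γ (t i - t j) ≤ K * ∑ i, w i ^ 2 := by
  let g : ℝ → ℝ := fun ν => ∑' n : ℤ, γ n * Real.cos (n * ν)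
  have hgK : ∀ ν, g ν ≤ K := fun ν => by
    refine le_of_eq_of_le ?_ (hK (Circle.exp ν))
    rw [Complex.re_tsum]
    · refine tsum_congr fun n => ?_
      rw [Complex.re_ofReal_mul, Circle.coe_exp, ← Complex.exp_int_mul, ← mul_assoc]
      norm_cast
      rw [Complex.exp_ofReal_mul_I_re]
    · refine Summable.of_norm_bounded hγ.abs fun n => ?_
      simp
  have hgc : Continuous g := continuous_tsum (fun n => by fun_prop) hγ.abs fun n ν => by
    rw [Real.norm_eq_abs, abs_mul]
    exact mul_le_of_le_one_right (abs_nonneg _) (Real.abs_cos_le_one _)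
  let F : ℝ → ℝ := fun ν => ∑ i, ∑ j, w i * w j * Real.cos (((t i - t j : ℤ) : ℝ) * ν)
  have hF : ∀ ν, F ν = (∑ i, w i * Real.cos (t i * ν)) ^ 2 + (∑ i, w i * Real.sin (t i * ν)) ^ 2 := by
    intro ν
    simp only [F, sq, Finset.sum_mul_sum, ← Finset.sum_add_distrib]
    refine Finset.sum_congr rfl fun i _ => Finset.sum_congr rfl fun j _ => ?_
    push_cast
    rw [sub_mul, Real.cos_sub]
    ring
  -- `F` is the squared modulus of `∑ w_i e^{i t_i ν}` and `g ≤ K`, so the integrand is nonnegative.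
  -- Expanding by orthogonality of cosines gives `2π` times the desired difference; injectivity of
  -- `t` keeps the `K` terms on the diagonal.
  have h0 : 0 ≤ ∫ ν in (-Real.pi)..Real.pi, F ν * (K - g ν) := by
    refine intervalIntegral.integral_nonneg (by linarith [Real.pi_pos]) fun ν _ => ?_
    refine mul_nonneg ?_ (sub_nonneg.2 (hgK ν))
    rw [hF]
    positivity
  have h1 : ∫ ν in (-Real.pi)..Real.pi, F ν * (K - g ν) =
      ∑ i, ∑ j, w i * w j * (K * (if i = j then 2 * Real.pi else 0) -
        Real.pi * (γ (t i - t j) + γ (-(t i - t j)))) := by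
    have e : ∀ ν, F ν * (K - g ν) = ∑ i, ∑ j, w i * w j *
        (K * Real.cos (((t i - t j : ℤ) : ℝ) * ν) -
          Real.cos (((t i - t j : ℤ) : ℝ) * ν) * g ν) := fun ν => by
      simp only [F, Finset.sum_mul]
      refine Finset.sum_congr rfl fun i _ => Finset.sum_congr rfl fun j _ => ?_
      ring
    simp_rw [e]
    rw [intervalIntegral.integral_finsetSum fun i _ =>
      Continuous.intervalIntegrable (by fun_prop) _ _]
    refine Finset.sum_congr rfl fun i _ => ?_
    rw [intervalIntegral.integral_finsetSum fun j _ =>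
      Continuous.intervalIntegrable (by fun_prop) _ _]
    refine Finset.sum_congr rfl fun j _ => ?_
    rw [intervalIntegral.integral_const_mul, intervalIntegral.integral_sub
      (Continuous.intervalIntegrable (by fun_prop) _ _)
      (Continuous.intervalIntegrable (by fun_prop) _ _), intervalIntegral.integral_const_mul,
      integral_cos_int_mul, integral_cos_mul_tsum hγ]
    simp only [sub_eq_zero, ht.eq_iff]
  -- Evenness of `γ` is not required: exchanging `i` and `j` symmetrises the form.
  have h2 : ∑ i, ∑ j, w i * w j * γ (-(t i - t j)) = ∑ i, ∑ j, w i * w j * γ (t i - t j) := by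
    rw [Finset.sum_comm]
    refine Finset.sum_congr rfl fun i _ => Finset.sum_congr rfl fun j _ => ?_
    rw [neg_sub, mul_comm (w j)]
  have h3 : ∑ i, ∑ j, w i * w j * (K * (if i = j then 2 * Real.pi else 0) -
        Real.pi * (γ (t i - t j) + γ (-(t i - t j)))) =
      2 * Real.pi * (K * ∑ i, w i ^ 2 - ∑ i, ∑ j, w i * w j * γ (t i - t j)) := by
    have h4 : ∑ i, ∑ j, w i * w j * (K * (if i = j then 2 * Real.pi else 0)) =
        2 * Real.pi * (K * ∑ i, w i ^ 2) := by
      simp only [mul_ite, mul_zero, Finset.sum_ite_eq, Finset.mem_univ, if_true, Finset.mul_sum]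
      exact Finset.sum_congr rfl fun i _ => by ring
    have h5 : ∀ i j, w i * w j * (K * (if i = j then 2 * Real.pi else 0) -
        Real.pi * (γ (t i - t j) + γ (-(t i - t j)))) =
        w i * w j * (K * (if i = j then 2 * Real.pi else 0)) -
          Real.pi * (w i * w j * γ (t i - t j)) - Real.pi * (w i * w j * γ (-(t i - t j))) :=
      fun i j => by ring
    simp_rw [h5, Finset.sum_sub_distrib, ← Finset.mul_sum]
    rw [h2, h4]
    ring
  rw [h1, h3] at h0
  have := nonneg_of_mul_nonneg_right h0 (by positivity : 0 < 2 * Real.pi)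
  linarith

end SpectralBound

/-! ### The spectral density of an autoregression. -/

section SpectralDensity

theorem summable_mul_zpow_circle {f : ℤ → ℝ} (hf : Summable f) (z : Circle) :
    Summable fun n : ℤ => (f n : ℂ) * (z : ℂ) ^ n :=
  Summable.of_norm_bounded hf.abs fun n => by
    rw [norm_mul, norm_zpow, Circle.norm_coe, one_zpow, mul_one, Complex.norm_real,
      Real.norm_eq_abs]

/-- On the unit circle the filter becomes multiplication by the polynomial, since a shift by `d`
multiplies the series by `z ^ d`. -/
theorem autoregression_tsum_zpow {p : ℕ} {φ : Fin p → ℝ} {f e : ℤ → ℝ} (hf : Summable f)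
    (he : ∀ n, f n - ∑ j : Fin p, φ j * f (n - ((j : ℕ) + 1)) = e n) (z : Circle) :
    (1 - ∑ j : Fin p, (φ j : ℂ) * (z : ℂ) ^ ((j : ℕ) + 1)) * ∑' n : ℤ, (f n : ℂ) * (z : ℂ) ^ n =
      ∑' n : ℤ, (e n : ℂ) * (z : ℂ) ^ n := by
  have hz : (z : ℂ) ≠ 0 := z.coe_ne_zero
  have h0 := (summable_mul_zpow_circle hf z).hasSum
  set S := ∑' n : ℤ, (f n : ℂ) * (z : ℂ) ^ n
  have h1 : ∀ d : ℤ, HasSum (fun n : ℤ => (f (n - d) : ℂ) * (z : ℂ) ^ n) ((z : ℂ) ^ d * S) := by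
    intro d
    have := h0.mul_left ((z : ℂ) ^ d)
    rw [← (Equiv.subRight d).hasSum_iff] at this
    have e : (fun n : ℤ => (f (n - d) : ℂ) * (z : ℂ) ^ n) =
        (fun n => (z : ℂ) ^ d * ((f n : ℂ) * (z : ℂ) ^ n)) ∘ Equiv.subRight d := funext fun n => by
      rw [Function.comp_apply, Equiv.subRight_apply, mul_left_comm, ← zpow_add₀ hz,
        add_sub_cancel]
    rw [e]
    exact this
  have h2 := h0.sub (hasSum_sum (s := Finset.univ) fun (j : Fin p) _ =>
    (h1 ((j : ℕ) + 1)).mul_left (φ j : ℂ))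
  have e2 : ∀ n, (e n : ℂ) * (z : ℂ) ^ n = (f n : ℂ) * (z : ℂ) ^ n -
      ∑ j : Fin p, (φ j : ℂ) * ((f (n - ((j : ℕ) + 1)) : ℂ) * (z : ℂ) ^ n) := fun n => by
    rw [← he]
    push_cast
    rw [sub_mul, Finset.sum_mul]
    simp_rw [mul_assoc]
  simp_rw [e2]
  rw [h2.tsum_eq, sub_mul, one_mul, Finset.sum_mul]
  congr 1
  refine Finset.sum_congr rfl fun j _ => ?_
  rw [mul_assoc]
  norm_cast

/-- The spectral density of an autoregression. -/
theorem autoregression_spectral_density {p : ℕ} {φ : Fin p → ℝ} {Ψ γ : ℤ → ℝ} {C : ℝ}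
    (hs : Summable Ψ) (hγ : Summable γ)
    (hΨ : ∀ n, Ψ n - ∑ j : Fin p, φ j * Ψ (n - ((j : ℕ) + 1)) = if n = 0 then 1 else 0)
    (hγΨ : ∀ n, γ n - ∑ j : Fin p, φ j * γ (n - ((j : ℕ) + 1)) = C * Ψ (-n)) (z : Circle) :
    ‖1 - ∑ j : Fin p, (φ j : ℂ) * (z : ℂ) ^ ((j : ℕ) + 1)‖ ^ 2 *
      (∑' n : ℤ, (γ n : ℂ) * (z : ℂ) ^ n).re = C := by
  have h1 := autoregression_tsum_zpow hs hΨ z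
  have h2 := autoregression_tsum_zpow hγ hγΨ z
  set Q := 1 - ∑ j : Fin p, (φ j : ℂ) * (z : ℂ) ^ ((j : ℕ) + 1)
  set G := ∑' n : ℤ, (γ n : ℂ) * (z : ℂ) ^ n
  have h0 : ∑' n : ℤ, ((if n = 0 then 1 else 0 : ℝ) : ℂ) * (z : ℂ) ^ n = 1 := by
    rw [tsum_eq_single 0 (fun n hn => by rw [if_neg hn, Complex.ofReal_zero, zero_mul]), if_pos rfl,
      Complex.ofReal_one, zpow_zero, mul_one]
  rw [h0] at h1
  have h3 : ∑' n : ℤ, ((C * Ψ (-n) : ℝ) : ℂ) * (z : ℂ) ^ n =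
      C * (starRingEnd ℂ) (∑' n : ℤ, (Ψ n : ℂ) * (z : ℂ) ^ n) := by
    rw [Complex.conj_tsum, ← tsum_mul_left, ← (Equiv.neg ℤ).tsum_eq]
    refine tsum_congr fun n => ?_
    simp only [Equiv.neg_apply, neg_neg, map_mul, Complex.conj_ofReal, map_zpow₀,
      ← Circle.coe_inv_eq_conj, Circle.coe_inv, inv_zpow', Complex.ofReal_mul]
    ring
  rw [h3] at h2
  -- With `S` the series of `Ψ`, one has `Q S = 1` and `Q G = C` times the conjugate of `S`.
  have h4 : (starRingEnd ℂ) Q * (Q * G) = C := by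
    rw [h2, mul_left_comm, ← map_mul, h1, map_one, mul_one]
  rw [← mul_assoc, mul_comm _ Q, Complex.mul_conj, Complex.normSq_eq_norm_sq] at h4
  have := congrArg Complex.re h4
  rwa [Complex.re_ofReal_mul, Complex.ofReal_re] at this

end SpectralDensity

/-! ### The largest eigenvalue as a bound on quadratic forms. -/

section LambdaMax

variable {ι : Type*} [Fintype ι] [DecidableEq ι]

-- All eigenvalues of `λ_max · 1 - A` are nonnegative, so this matrix is positive semidefinite.
open scoped ComplexOrder in
theorem re_dotProduct_mulVec_le_lambdaMax {A : Matrix ι ι ℂ} (hA : A.IsHermitian) (x : ι → ℂ) :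
    (star x ⬝ᵥ A *ᵥ x).re ≤ lambdaMax A * ∑ i, ‖x i‖ ^ 2 := by
  have hb : BddAbove (spectrum ℝ A) := by
    rw [hA.spectrum_real_eq_range_eigenvalues]
    exact (Set.finite_range _).bddAbove
  have hB : (algebraMap ℝ (Matrix ι ι ℂ) (lambdaMax A) - A).IsHermitian := by
    refine Matrix.IsHermitian.sub ?_ hA
    rw [Matrix.IsHermitian, Algebra.algebraMap_eq_smul_one, Matrix.conjTranspose_smul]
    simp
  have hp : (algebraMap ℝ (Matrix ι ι ℂ) (lambdaMax A) - A).PosSemidef := by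
    rw [hB.posSemidef_iff_eigenvalues_nonneg]
    intro i
    have := hB.eigenvalues_mem_spectrum_real i
    rw [← spectrum.singleton_sub_eq, Set.singleton_sub] at this
    obtain ⟨y, hy, e⟩ := this
    rw [← e]
    exact sub_nonneg.2 (le_csSup hb hy)
  have := hp.re_dotProduct_nonneg x
  rw [Matrix.sub_mulVec, dotProduct_sub, map_sub, sub_nonneg] at this
  refine this.trans_eq ?_
  rw [Algebra.algebraMap_eq_smul_one, Matrix.smul_mulVec, Matrix.one_mulVec, dotProduct_smul]
  simp [dotProduct, ← Complex.normSq_eq_conj_mul_self, Complex.normSq_eq_norm_sq]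
  exact Or.inl (by norm_cast)

-- An entrywise bound limits the whole spectrum uniformly. This makes the supremum over frequencies
-- in `stabilitySub` a supremum of a bounded family, rather than the default value `0` of an
-- unbounded one.
open scoped Matrix.Norms.Operator in
theorem exists_lambdaMax_le (ι : Type*) [Fintype ι] [DecidableEq ι] (D : ℝ) :
    ∃ B : ℝ, ∀ A : Matrix ι ι ℂ, (∀ i j, ‖A i j‖ ≤ D) → lambdaMax A ≤ B := by
  have hD := le_max_right D 0
  refine ⟨(Fintype.card ι * max D 0) * ‖(1 : Matrix ι ι ℂ)‖, fun A hA => ?_⟩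
  refine Real.sSup_le (fun x hx => ?_) (by positivity)
  refine (le_abs_self x).trans ((spectrum.norm_le_norm_mul_of_mem hx).trans ?_)
  gcongr
  rw [Matrix.linfty_opNorm_def]
  have : ∀ i, (∑ j, ‖A i j‖₊ : NNReal) ≤ Fintype.card ι * (max D 0).toNNReal := fun i => by
    refine (Finset.sum_le_card_nsmul _ _ _ fun j _ => ?_).trans_eq (nsmul_eq_mul _ _)
    rw [← NNReal.coe_le_coe, coe_nnnorm, Real.coe_toNNReal _ hD]
    exact (hA i j).trans (le_max_left _ _)
  have h2 := NNReal.coe_le_coe.2 (Finset.sup_le fun i (_ : i ∈ Finset.univ) => this i)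
  refine h2.trans_eq ?_
  push_cast
  rw [Real.coe_toNNReal _ hD]

end LambdaMax

/-! ### The scalar autoregressions formed by the harmonic coefficients. -/

section CoefficientProcess

variable {Ω : Type*} [MeasurableSpace Ω] {P : Measure Ω} {p : ℕ} {k : Fin p → ℝ → ℝ} {CZ : ℕ → ℝ}
  {T Z : Sphere2 → ℤ → Ω → ℝ}

/-- The common autocovariance function of the coefficient processes of degree `ℓ`. -/
def coeffCov (P : Measure Ω) (T : Sphere2 → ℤ → Ω → ℝ) (ℓ : ℕ) (τ : ℤ) : ℝ :=
  kernelCoeff (fieldCov P T τ) ℓ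

theorem continuous_norm_arPoly_sq (k : Fin p → ℝ → ℝ) (ℓ : ℕ) :
    Continuous fun z : Circle => ‖arPoly k ℓ z‖ ^ 2 := by
  unfold arPoly
  fun_prop

theorem IsSPHAR.muMin_pos (h : IsSPHAR P k CZ T Z) (ℓ : ℕ) : 0 < muMin k ℓ := by
  obtain ⟨z, -, hz⟩ := isCompact_univ.exists_isMinOn Set.univ_nonempty
    (continuous_norm_arPoly_sq k ℓ).continuousOn
  have h0 : 0 < ‖arPoly k ℓ z‖ := norm_pos_iff.2 (h.no_roots ℓ z (Circle.norm_coe z).le)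
  exact (pow_pos h0 2).trans_le (le_ciInf fun w => hz (Set.mem_univ w))

theorem muMax_nonneg (k : Fin p → ℝ → ℝ) (ℓ : ℕ) : 0 ≤ muMax k ℓ :=
  Real.iSup_nonneg fun _ => sq_nonneg _

/-- The autocovariance of the linear combination with weights `v` of the lagged coefficients. -/
def lagCov (P : Measure Ω) (T : Sphere2 → ℤ → Ω → ℝ) (ℓ : ℕ) (v : Fin p → ℝ) (τ : ℤ) : ℝ :=
  ∑ i, ∑ j, v i * v j * coeffCov P T ℓ (τ - (i : ℕ) + (j : ℕ))

theorem summable_lagCov (hγ : Summable (coeffCov P T ℓ)) (v : Fin p → ℝ) :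
    Summable (lagCov P T ℓ v) := by
  refine summable_sum fun i _ => summable_sum fun j _ => Summable.mul_left _ ?_
  have := (Equiv.addRight (-((i : ℕ) : ℤ) + (j : ℕ))).summable_iff.2 hγ
  refine this.congr fun n => ?_
  rw [Function.comp_apply, Equiv.coe_addRight]
  congr 1
  ring

variable [IsProbabilityMeasure P]

theorem IsSPHAR.memLp_harmCoeff (h : IsSPHAR P k CZ T Z) (ℓ : ℕ) (m t : ℤ) :
    MemLp (harmCoeff T ℓ m t) 2 P :=
  (h.isL2Field t).memLp_integral (continuous_sphHarm ℓ m)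

theorem IsSPHAR.memLp_harmCoeff_noise (h : IsSPHAR P k CZ T Z) (ℓ : ℕ) (m t : ℤ) :
    MemLp (harmCoeff Z ℓ m t) 2 P :=
  (h.noise.isL2Field t).memLp_integral (continuous_sphHarm ℓ m)

theorem IsSPHAR.integral_harmCoeff_mul_self (h : IsSPHAR P k CZ T Z) {ℓ : ℕ} {m : ℤ}
    (hm : m.natAbs ≤ ℓ) (t s : ℤ) :
    ∫ ω, harmCoeff T ℓ m t ω * harmCoeff T ℓ m s ω ∂P = coeffCov P T ℓ (t - s) := by
  rw [h.integral_harmCoeff_mul ℓ m m t s hm, if_pos rfl, coeffCov]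

theorem IsSPHAR.coeffCov_neg (h : IsSPHAR P k CZ T Z) (ℓ : ℕ) (τ : ℤ) :
    coeffCov P T ℓ (-τ) = coeffCov P T ℓ τ := by
  have h1 := h.integral_harmCoeff_mul_self (ℓ := ℓ) (m := 0) (by simp) τ 0
  have h2 := h.integral_harmCoeff_mul_self (ℓ := ℓ) (m := 0) (by simp) 0 τ
  rw [sub_zero] at h1
  rw [zero_sub] at h2
  rw [← h1, ← h2]
  simp_rw [mul_comm]

theorem IsSPHAR.integral_equation_mul (h : IsSPHAR P k CZ T Z) {ℓ : ℕ} {m : ℤ}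
    (hm : m.natAbs ≤ ℓ) (t : ℤ) {Y : Ω → ℝ} (hY : MemLp Y 2 P) :
    ∫ ω, harmCoeff T ℓ m t ω * Y ω ∂P - ∑ j : Fin p, kernelCoeff (k j) ℓ *
      ∫ ω, harmCoeff T ℓ m (t - ((j : ℕ) + 1)) ω * Y ω ∂P =
        ∫ ω, harmCoeff Z ℓ m t ω * Y ω ∂P := by
  have i1 : ∀ s, Integrable (fun ω => harmCoeff T ℓ m s ω * Y ω) P := fun s =>
    (h.memLp_harmCoeff ℓ m s).integrable_mul hY
  have i2 : Integrable (fun ω => harmCoeff Z ℓ m t ω * Y ω) P :=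
    (h.memLp_harmCoeff_noise ℓ m t).integrable_mul hY
  simp_rw [← integral_const_mul]
  rw [← integral_finsetSum _ fun j _ => (i1 _).const_mul _, ← integral_sub (i1 _)
    (integrable_finsetSum _ fun j _ => (i1 _).const_mul _)]
  refine integral_congr_ae ?_
  filter_upwards [h.harmCoeff_equation ℓ m t hm] with ω e
  rw [e, add_mul, Finset.sum_mul]
  simp_rw [mul_assoc]
  ring

/-- By Cauchy–Schwarz the covariances of `a(t)` with the noise and with `a(0)` are bounded, so they
are the bounded solutions of their recursions. Hence `𝔼[a(t) a_Z(s)] = C_ℓ Ψ(t-s)`, which vanishes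
for `t < s`, and filtering `γ` gives `C_ℓ Ψ(-n)`. -/
theorem IsSPHAR.coefficient_autoregression (h : IsSPHAR P k CZ T Z) (ℓ : ℕ) :
    Summable (coeffCov P T ℓ) ∧
      (∀ m : ℤ, m.natAbs ≤ ℓ → ∀ t s, t < s →
        ∫ ω, harmCoeff T ℓ m t ω * harmCoeff Z ℓ m s ω ∂P = 0) ∧
      ∀ z : Circle, ‖arPoly k ℓ z‖ ^ 2 *
        (∑' n : ℤ, (coeffCov P T ℓ n : ℂ) * (z : ℂ) ^ n).re = CZ ℓ := by
  obtain ⟨Ψ, hs, hneg, hΨ⟩ := exists_causal_inverse (fun j => kernelCoeff (k j) ℓ) (h.no_roots ℓ)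
  have hz : ∀ m : ℤ, m.natAbs ≤ ℓ → ∀ t s,
      ∫ ω, harmCoeff Z ℓ m t ω * harmCoeff Z ℓ m s ω ∂P = if t = s then CZ ℓ else 0 :=
    fun m hm t s => by
      rw [h.noise.integral_harmCoeff_mul ℓ m m t s hm]
      simp
  have key : ∀ m : ℤ, m.natAbs ≤ ℓ →
      (∀ t s, ∫ ω, harmCoeff T ℓ m t ω * harmCoeff Z ℓ m s ω ∂P = CZ ℓ * Ψ (t - s)) ∧
        Summable (coeffCov P T ℓ) ∧ ∀ n, coeffCov P T ℓ n - ∑ j : Fin p, kernelCoeff (k j) ℓ *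
          coeffCov P T ℓ (n - ((j : ℕ) + 1)) = CZ ℓ * Ψ (-n) := by
    intro m hm
    let c : ℤ → ℤ → ℝ := fun t s => ∫ ω, harmCoeff T ℓ m t ω * harmCoeff Z ℓ m s ω ∂P
    have hγ0 : ∀ t, ∫ ω, harmCoeff T ℓ m t ω ^ 2 ∂P = coeffCov P T ℓ 0 := fun t => by
      simp_rw [sq]
      rw [h.integral_harmCoeff_mul_self hm, sub_self]
    have hb1 : ∀ t, |coeffCov P T ℓ t| ≤ √(coeffCov P T ℓ 0 * coeffCov P T ℓ 0) := fun t => by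
      refine Real.abs_le_sqrt ?_
      have := sq_integral_mul_le (h.memLp_harmCoeff ℓ m t) (h.memLp_harmCoeff ℓ m 0)
      rwa [h.integral_harmCoeff_mul_self hm, hγ0, hγ0, sub_zero] at this
    have hb2 : ∀ t s, |c t s| ≤ √(coeffCov P T ℓ 0 * CZ ℓ) := fun t s => by
      refine Real.abs_le_sqrt ?_
      have := sq_integral_mul_le (h.memLp_harmCoeff ℓ m t) (h.memLp_harmCoeff_noise ℓ m s)
      have e := hz m hm s s
      rw [if_pos rfl] at e
      simp_rw [← sq] at e
      rwa [hγ0, e] at this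
    have hγc : ∀ t, coeffCov P T ℓ t - ∑ j : Fin p, kernelCoeff (k j) ℓ *
        coeffCov P T ℓ (t - ((j : ℕ) + 1)) = c 0 t := fun t => by
      have := h.integral_equation_mul hm t (h.memLp_harmCoeff ℓ m 0)
      simp_rw [h.integral_harmCoeff_mul_self hm, sub_zero] at this
      rw [this]
      simp_rw [mul_comm, c]
    have := autoregression_covariance hs hΨ
      (B := max √(coeffCov P T ℓ 0 * coeffCov P T ℓ 0) √(coeffCov P T ℓ 0 * CZ ℓ))
      (fun t => (hb1 t).trans (le_max_left _ _)) (fun t s => (hb2 t s).trans (le_max_right _ _))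
      (fun t s => (h.integral_equation_mul hm t (h.memLp_harmCoeff_noise ℓ m s)).trans
        (hz m hm t s)) hγc
    exact ⟨this.1, this.2, fun n => by rw [hγc, this.1, zero_sub]⟩
  obtain ⟨-, hγ, hγΨ⟩ := key 0 (by simp)
  refine ⟨hγ, fun m hm t s hts => ?_, fun z => autoregression_spectral_density hs hγ hΨ hγΨ z⟩
  rw [(key m hm).1, hneg _ (by omega), mul_zero]

/-- The density is `C_ℓ / |φ_ℓ(z)|²`, and `muMin` bounds the denominator from below. -/
theorem IsSPHAR.spectral_density_le (h : IsSPHAR P k CZ T Z) (ℓ : ℕ) (z : Circle) :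
    (∑' n : ℤ, (coeffCov P T ℓ n : ℂ) * (z : ℂ) ^ n).re ≤ CZ ℓ / muMin k ℓ := by
  have h1 := (h.coefficient_autoregression ℓ).2.2 z
  have h2 := h.muMin_pos ℓ
  have h3 : muMin k ℓ ≤ ‖arPoly k ℓ z‖ ^ 2 :=
    ciInf_le ⟨0, by rintro _ ⟨w, rfl⟩; positivity⟩ z
  have h4 := h.noise.power_pos ℓ
  set g := (∑' n : ℤ, (coeffCov P T ℓ n : ℂ) * (z : ℂ) ^ n).re
  have h5 : 0 < g := by
    by_contra! h6
    have := mul_nonpos_of_nonneg_of_nonpos (h2.le.trans h3) h6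
    linarith
  rw [le_div_iff₀ h2]
  calc g * muMin k ℓ ≤ g * ‖arPoly k ℓ z‖ ^ 2 := by gcongr
    _ = CZ ℓ := by rw [mul_comm, h1]

theorem IsSPHAR.autocov_apply (h : IsSPHAR P k CZ T Z) (ℓ : ℕ) (τ : ℤ) (i j : Fin p) :
    autocov P p T ℓ τ i j = coeffCov P T ℓ (τ - (i : ℕ) + (j : ℕ)) := by
  have := h.integral_harmCoeff_mul_self (ℓ := ℓ) (m := 0) (by simp) (τ - (i : ℕ)) (0 - (j : ℕ))
  rw [autocov, Matrix.of_apply]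
  simp only [stacked]
  rw [this]
  congr 1
  ring

end CoefficientProcess

/-! ### The stability measure as a bound on spectral densities. -/

section Stability

variable {Ω : Type*} [MeasurableSpace Ω] {P : Measure Ω} {p : ℕ} {k : Fin p → ℝ → ℝ} {CZ : ℕ → ℝ}
  {T Z : Sphere2 → ℤ → Ω → ℝ}

theorem exp_neg_I_mul_eq_zpow (τ : ℤ) (ν : ℝ) :
    Complex.exp (-(Complex.I * (τ : ℂ) * (ν : ℂ))) = (Circle.exp (-ν) : ℂ) ^ τ := by
  rw [Circle.coe_exp, ← Complex.exp_int_mul]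
  congr 1
  push_cast
  ring

theorem summable_coeffCov_shift {ℓ : ℕ} (hγ : Summable (coeffCov P T ℓ)) (i j : ℕ) :
    Summable fun τ : ℤ => coeffCov P T ℓ (τ - i + j) := by
  have := (Equiv.addRight (-(i : ℤ) + j)).summable_iff.2 hγ
  refine this.congr fun n => ?_
  rw [Function.comp_apply, Equiv.coe_addRight]
  congr 1
  ring

theorem isSparse_single {r : ℕ} (hr : 1 ≤ r) (i : Fin p) :
    IsSparse r (EuclideanSpace.single i (1 : ℝ)) := by
  refine le_trans ?_ hr
  rw [Set.ncard_le_one]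
  simp

theorem lagCov_single (P : Measure Ω) (T : Sphere2 → ℤ → Ω → ℝ) (ℓ : ℕ) (i : Fin p) (τ : ℤ) :
    lagCov P T ℓ (EuclideanSpace.single i (1 : ℝ)).ofLp τ = coeffCov P T ℓ τ := by
  rw [lagCov, Finset.sum_eq_single i, Finset.sum_eq_single i]
  · simp
  · intro j _ hj
    simp [hj]
  · simp
  · intro j _ hj
    simp [hj]
  · simp

variable [IsProbabilityMeasure P]

theorem IsSPHAR.specDensity_apply (h : IsSPHAR P k CZ T Z) (ℓ : ℕ) (ν : ℝ) (i j : Fin p) :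
    specDensity P p T ℓ ν i j = (1 / (2 * Real.pi) : ℂ) * ∑' τ : ℤ,
      (coeffCov P T ℓ (τ - (i : ℕ) + (j : ℕ)) : ℂ) * (Circle.exp (-ν) : ℂ) ^ τ := by
  rw [specDensity, Matrix.of_apply]
  simp_rw [h.autocov_apply, exp_neg_I_mul_eq_zpow]

theorem IsSPHAR.isHermitian_specDensity (h : IsSPHAR P k CZ T Z) (ℓ : ℕ) (ν : ℝ) :
    (specDensity P p T ℓ ν).IsHermitian := by
  ext i j
  rw [Matrix.conjTranspose_apply, h.specDensity_apply, h.specDensity_apply, Complex.star_def,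
    map_mul, Complex.conj_tsum, ← (Equiv.neg ℤ).tsum_eq]
  congr 1
  · norm_cast
    exact Complex.conj_ofReal _
  · refine tsum_congr fun n => ?_
    simp only [Equiv.neg_apply, map_mul, Complex.conj_ofReal, map_zpow₀, ← Circle.coe_inv_eq_conj,
      Circle.coe_inv, inv_zpow', neg_neg]
    rw [← h.coeffCov_neg]
    congr 3
    ring

theorem IsSPHAR.norm_specDensity_le (h : IsSPHAR P k CZ T Z) (ℓ : ℕ) (ν : ℝ) (i j : Fin p) :
    ‖specDensity P p T ℓ ν i j‖ ≤ (1 / (2 * Real.pi)) * ∑' τ : ℤ, |coeffCov P T ℓ τ| := by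
  have hγ := (h.coefficient_autoregression ℓ).1
  rw [h.specDensity_apply, norm_mul]
  have e : ‖(1 / (2 * Real.pi) : ℂ)‖ = 1 / (2 * Real.pi) := by
    have := Real.pi_pos
    rw [norm_div, norm_mul, Complex.norm_real, Real.norm_of_nonneg this.le]
    simp
  rw [e]
  gcongr
  have h1 : ∀ n : ℤ, ‖(coeffCov P T ℓ (n - (i : ℕ) + (j : ℕ)) : ℂ) * (Circle.exp (-ν) : ℂ) ^ n‖ =
      |coeffCov P T ℓ (n - (i : ℕ) + (j : ℕ))| := fun n => by
    rw [norm_mul, norm_zpow, Circle.norm_coe, one_zpow, mul_one, Complex.norm_real,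
      Real.norm_eq_abs]
  refine (norm_tsum_le_tsum_norm ?_).trans_eq ?_
  · simp_rw [h1]
    exact (summable_coeffCov_shift hγ i j).abs
  · simp_rw [h1]
    rw [← (Equiv.addRight (-((i : ℕ) : ℤ) + (j : ℕ))).tsum_eq fun τ => |coeffCov P T ℓ τ|]
    refine tsum_congr fun n => ?_
    rw [Equiv.coe_addRight]
    congr 2
    ring

theorem IsSPHAR.lambdaMax_le_stability (h : IsSPHAR P k CZ T Z) (ℓ : ℕ) {r : ℕ}
    {J : Finset (Fin p)} (hJ : J.Nonempty) (hr : J.card ≤ r) {ν : ℝ}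
    (hν : ν ∈ Set.Icc (-Real.pi) Real.pi) :
    lambdaMax ((specDensity P p T ℓ ν).submatrix (Subtype.val : J → Fin p) Subtype.val) ≤
      stability P p T ℓ r := by
  obtain ⟨B, hB⟩ := exists_lambdaMax_le J ((1 / (2 * Real.pi)) * ∑' τ : ℤ, |coeffCov P T ℓ τ|)
  have h1 := le_ciSup (f := fun ν : Set.Icc (-Real.pi) Real.pi => lambdaMax
      ((specDensity P p T ℓ (ν : ℝ)).submatrix (Subtype.val : J → Fin p) Subtype.val))
    ⟨B, by
      rintro _ ⟨ν, rfl⟩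
      exact hB _ fun i j => h.norm_specDensity_le ℓ ν i j⟩ ⟨ν, hν⟩
  refine h1.trans ?_
  exact le_ciSup (f := fun J : {J : Finset (Fin p) // J.Nonempty ∧ J.card ≤ r} =>
    stabilitySub P p T ℓ J.1) (Set.finite_range _).bddAbove ⟨J, hJ, hr⟩

/-- The spectral density of a sparse combination is bounded by the stability measure. -/
theorem IsSPHAR.spectral_density_lagCov_le (h : IsSPHAR P k CZ T Z) (ℓ : ℕ) {r : ℕ}
    {v : EuclideanSpace ℝ (Fin p)} (hv : IsSparse r v) (z : Circle) :
    (∑' n : ℤ, (lagCov P T ℓ v.ofLp n : ℂ) * (z : ℂ) ^ n).re ≤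
      2 * Real.pi * stability P p T ℓ r * ‖v‖ ^ 2 := by
  have hγ := (h.coefficient_autoregression ℓ).1
  let J : Finset (Fin p) := Finset.univ.filter fun i => v i ≠ 0
  have hJr : J.card ≤ r := by
    have : {i : Fin p | v i ≠ 0} = (J : Set (Fin p)) := by ext; simp [J]
    rwa [IsSparse, this, Set.ncard_coe_finset] at hv
  -- `stability` ranges over nonempty supports only, so `v = 0` is treated separately.
  rcases J.eq_empty_or_nonempty with hJ | hJ
  · have hv0 : v = 0 := by
      ext i
      by_contra hi
      have : i ∈ J := by simpa [J] using hi
      simp [hJ] at this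
    subst hv0
    simp [lagCov]
  -- The density is defined with `e^{-iτν}`, so the frequency belonging to `z` is minus its
  -- argument.
  let ν : ℝ := -(z : ℂ).arg
  have hν : ν ∈ Set.Icc (-Real.pi) Real.pi :=
    ⟨neg_le_neg (Complex.arg_le_pi _), neg_le.1 (Complex.neg_pi_lt_arg _).le⟩
  have hz : Circle.exp (-ν) = z := by rw [neg_neg, Circle.exp_arg]
  let A : Matrix J J ℂ := (specDensity P p T ℓ ν).submatrix (Subtype.val : J → Fin p) Subtype.val
  have hA : A.IsHermitian := (h.isHermitian_specDensity ℓ ν).submatrix _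
  have h1 := re_dotProduct_mulVec_le_lambdaMax hA fun i => (v i : ℂ)
  have hsum : ∀ f : Fin p → ℂ, ∑ i : J, (v i : ℂ) * f i = ∑ i, (v i : ℂ) * f i := fun f => by
    rw [Finset.sum_coe_sort J fun i => (v i : ℂ) * f i]
    refine Finset.sum_subset (Finset.subset_univ _) fun i _ hi => ?_
    have : v i = 0 := by simpa [J] using hi
    rw [this, Complex.ofReal_zero, zero_mul]
  have hnorm : ∑ i : J, ‖(v i : ℂ)‖ ^ 2 = ‖v‖ ^ 2 := by
    rw [EuclideanSpace.norm_sq_eq, Finset.sum_coe_sort J fun i => ‖(v i : ℂ)‖ ^ 2]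
    simp_rw [Complex.norm_real]
    refine Finset.sum_subset (Finset.subset_univ _) fun i _ hi => ?_
    have : v i = 0 := by simpa [J] using hi
    rw [this]; simp
  have hquad : (star (fun i : J => (v i : ℂ)) ⬝ᵥ A *ᵥ fun i => (v i : ℂ)) =
      ∑ i, (v i : ℂ) * ∑ j, (v j : ℂ) * specDensity P p T ℓ ν i j := by
    rw [← hsum]
    simp only [dotProduct, Matrix.mulVec, Pi.star_apply, Complex.star_def, Complex.conj_ofReal]
    refine Finset.sum_congr rfl fun i _ => ?_
    rw [← hsum]
    simp_rw [A, Matrix.submatrix_apply, mul_comm]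
  have hS : ((2 * Real.pi : ℝ) : ℂ) * ∑ i, (v i : ℂ) * ∑ j, (v j : ℂ) * specDensity P p T ℓ ν i j =
      ∑' n : ℤ, (lagCov P T ℓ v.ofLp n : ℂ) * (z : ℂ) ^ n := by
    have h2 : ∀ i j : Fin p, HasSum (fun n : ℤ => ((v i : ℂ) * v j) *
        ((coeffCov P T ℓ (n - (i : ℕ) + (j : ℕ)) : ℂ) * (z : ℂ) ^ n))
        (((2 * Real.pi : ℝ) : ℂ) * ((v i : ℂ) * ((v j : ℂ) * specDensity P p T ℓ ν i j))) := by
      intro i j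
      have h3 := (summable_mul_zpow_circle (summable_coeffCov_shift hγ i j) z).hasSum.mul_left
        ((v i : ℂ) * v j)
      have e : ((2 * Real.pi : ℝ) : ℂ) * ((v i : ℂ) * ((v j : ℂ) * specDensity P p T ℓ ν i j)) =
          (v i : ℂ) * v j * ∑' n : ℤ,
            (coeffCov P T ℓ (n - (i : ℕ) + (j : ℕ)) : ℂ) * (z : ℂ) ^ n := by
        rw [h.specDensity_apply, hz]
        have : (Real.pi : ℂ) ≠ 0 := by exact_mod_cast Real.pi_ne_zero
        push_cast
        field_simp
      rw [e]
      exact h3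
    have h4 := hasSum_sum (s := Finset.univ) fun (i : Fin p) _ =>
      hasSum_sum (s := Finset.univ) fun (j : Fin p) _ => h2 i j
    simp_rw [Finset.mul_sum]
    rw [← h4.tsum_eq]
    refine tsum_congr fun n => ?_
    rw [lagCov]
    push_cast
    simp_rw [Finset.sum_mul]
    refine Finset.sum_congr rfl fun i _ => Finset.sum_congr rfl fun j _ => ?_
    ring
  rw [← hS, Complex.re_ofReal_mul, ← hquad, mul_assoc (2 * Real.pi)]
  have := Real.pi_pos
  gcongr
  rw [hnorm] at h1
  refine h1.trans ?_
  gcongr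
  exact h.lambdaMax_le_stability ℓ hJ hJr hν

/-- For `p ≥ 1`, `2π ℳ` dominates the variance of one coefficient: apply the Toeplitz bound to a
single time and a basis vector. For `p = 0` the supremum is over an empty family and equals `0`. -/
theorem IsSPHAR.stability_nonneg (h : IsSPHAR P k CZ T Z) (ℓ : ℕ) {r : ℕ} (hr : 1 ≤ r) :
    0 ≤ stability P p T ℓ r := by
  rcases Nat.eq_zero_or_pos p with rfl | hp
  · have : IsEmpty {J : Finset (Fin 0) // J.Nonempty ∧ J.card ≤ r} :=
      ⟨fun ⟨J, ⟨i, _⟩, _⟩ => i.elim0⟩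
    rw [stability, Real.iSup_of_isEmpty]
  · let v : EuclideanSpace ℝ (Fin p) := EuclideanSpace.single ⟨0, hp⟩ 1
    have hv : IsSparse r v := isSparse_single hr _
    have h1 := sum_mul_mul_le_of_spectral_bound (ι := Fin 1) (t := fun _ => 0)
      (summable_lagCov (h.coefficient_autoregression ℓ).1 v.ofLp)
      (h.spectral_density_lagCov_le ℓ hv) (Function.injective_of_subsingleton _) fun _ => 1
    have h2 : lagCov P T ℓ v.ofLp 0 = ∫ ω, harmCoeff T ℓ 0 0 ω ^ 2 ∂P := by
      rw [lagCov_single]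
      have := h.integral_harmCoeff_mul_self (ℓ := ℓ) (m := 0) (by simp) 0 0
      rw [sub_self] at this
      simp_rw [sq, this]
    have h3 : 0 ≤ ∫ ω, harmCoeff T ℓ 0 0 ω ^ 2 ∂P := integral_nonneg fun _ => sq_nonneg _
    have h4 : ‖v‖ = 1 := by simp [v]
    simp [h2, h4] at h1
    have h5 := h3.trans h1
    have := Real.pi_pos
    exact nonneg_of_mul_nonneg_right h5 (by positivity)

end Stability

/-! ### Deviation bounds for the sample covariance and the empirical process. -/

section Deviation

variable {Ω : Type*} [MeasurableSpace Ω] {P : Measure Ω} {p : ℕ} {k : Fin p → ℝ → ℝ} {CZ : ℕ → ℝ}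
  {T Z : Sphere2 → ℤ → Ω → ℝ}

theorem card_obsIndex (ℓ N : ℕ) : (Fintype.card (ObsIndex ℓ N) : ℝ) = N * (2 * ℓ + 1) := by
  rw [Fintype.card_prod, Fintype.card_coe, Int.card_Icc, Fintype.card_fin]
  have : ((ℓ : ℤ) + 1 - -(ℓ : ℤ)).toNat = 2 * ℓ + 1 := by omega
  rw [this]
  push_cast
  ring

theorem nonempty_obsIndex (ℓ : ℕ) {N : ℕ} (hN : 1 ≤ N) : Nonempty (ObsIndex ℓ N) :=
  ⟨⟨⟨0, by simp⟩, ⟨0, hN⟩⟩⟩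

theorem natAbs_le_of_obsIndex {ℓ N : ℕ} (q : ObsIndex ℓ N) : (q.1 : ℤ).natAbs ≤ ℓ := by
  have := Finset.mem_Icc.1 q.1.2
  omega

theorem obsTime_injective (p N : ℕ) : Function.Injective (obsTime p N) := by
  intro i j hij
  simp only [obsTime] at hij
  exact Fin.ext (by omega)

theorem integral_sum_mul_sq {ι : Type*} [Fintype ι] {W : ι → Ω → ℝ} (hW : ∀ i, MemLp (W i) 2 P)
    (w : ι → ℝ) : ∫ ω, (∑ i, w i * W i ω) ^ 2 ∂P =
      ∑ i, ∑ j, w i * w j * ∫ ω, W i ω * W j ω ∂P := by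
  have hi : ∀ i j, Integrable (fun ω => w i * w j * (W i ω * W j ω)) P := fun i j =>
    ((hW i).integrable_mul (hW j)).const_mul _
  have e : ∀ ω, (∑ i, w i * W i ω) ^ 2 = ∑ i, ∑ j, w i * w j * (W i ω * W j ω) := fun ω => by
    rw [sq, Finset.sum_mul_sum]
    refine Finset.sum_congr rfl fun i _ => Finset.sum_congr rfl fun j _ => ?_
    ring
  simp_rw [e]
  rw [integral_finsetSum _ fun i _ => integrable_finsetSum _ fun j _ => hi i j]
  refine Finset.sum_congr rfl fun i _ => ?_
  rw [integral_finsetSum _ fun j _ => hi i j]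
  exact Finset.sum_congr rfl fun j _ => integral_const_mul _ _

theorem memLp_design [IsProbabilityMeasure P] (h : IsSPHAR P k CZ T Z) {ℓ N : ℕ}
    (q : ObsIndex ℓ N) (j : Fin p) : MemLp (fun ω => designMatrix p T ℓ N ω q j) 2 P :=
  h.memLp_harmCoeff ℓ q.1 _

theorem integral_design_mul [IsProbabilityMeasure P] (h : IsSPHAR P k CZ T Z) {ℓ N : ℕ}
    (q q' : ObsIndex ℓ N) (i j : Fin p) :
    ∫ ω, designMatrix p T ℓ N ω q i * designMatrix p T ℓ N ω q' j ∂P =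
      if q.1 = q'.1 then
        coeffCov P T ℓ (obsTime p N q.2 - obsTime p N q'.2 - (i : ℕ) + (j : ℕ)) else 0 := by
  have := h.integral_harmCoeff_mul ℓ q.1 q'.1 (obsTime p N q.2 - ((i : ℕ) + 1 : ℕ))
    (obsTime p N q'.2 - ((j : ℕ) + 1 : ℕ)) (natAbs_le_of_obsIndex q)
  simp only [designMatrix, Matrix.of_apply, laggedObs]
  rw [this]
  simp only [Subtype.coe_inj, coeffCov]
  congr 3
  push_cast
  ring

theorem integral_design_mulVec_mul [IsProbabilityMeasure P] (h : IsSPHAR P k CZ T Z) {ℓ N : ℕ}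
    (v : Fin p → ℝ) (q q' : ObsIndex ℓ N) :
    ∫ ω, (designMatrix p T ℓ N ω *ᵥ v) q * (designMatrix p T ℓ N ω *ᵥ v) q' ∂P =
      if q.1 = q'.1 then lagCov P T ℓ v (obsTime p N q.2 - obsTime p N q'.2) else 0 := by
  have hi : ∀ i j, Integrable (fun ω => v i * v j *
      (designMatrix p T ℓ N ω q i * designMatrix p T ℓ N ω q' j)) P := fun i j =>
    ((memLp_design h q i).integrable_mul (memLp_design h q' j)).const_mul _
  have e : ∀ ω, (designMatrix p T ℓ N ω *ᵥ v) q * (designMatrix p T ℓ N ω *ᵥ v) q' =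
      ∑ i, ∑ j, v i * v j * (designMatrix p T ℓ N ω q i * designMatrix p T ℓ N ω q' j) := by
    intro ω
    simp only [Matrix.mulVec, dotProduct, Finset.sum_mul_sum]
    refine Finset.sum_congr rfl fun i _ => Finset.sum_congr rfl fun j _ => ?_
    ring
  simp_rw [e]
  rw [integral_finsetSum _ fun i _ => integrable_finsetSum _ fun j _ => hi i j]
  simp_rw [lagCov]
  have h2 : ∀ i, ∫ ω, ∑ j, v i * v j * (designMatrix p T ℓ N ω q i * designMatrix p T ℓ N ω q' j) ∂P
      = ∑ j, v i * v j * ∫ ω, designMatrix p T ℓ N ω q i * designMatrix p T ℓ N ω q' j ∂P :=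
    fun i => by
      rw [integral_finsetSum _ fun j _ => hi i j]
      exact Finset.sum_congr rfl fun j _ => integral_const_mul _ _
  simp_rw [h2, integral_design_mul h]
  split_ifs
  · rfl
  · simp

theorem memLp_design_mulVec [IsProbabilityMeasure P] (h : IsSPHAR P k CZ T Z) {ℓ N : ℕ}
    (v : Fin p → ℝ) (q : ObsIndex ℓ N) :
    MemLp (fun ω => (designMatrix p T ℓ N ω *ᵥ v) q) 2 P := by
  simp only [Matrix.mulVec, dotProduct]
  exact memLp_finsetSum _ fun j _ => (memLp_design h q j).mul_const _

/-- Different `m` are uncorrelated, so the covariance of `X v` splits into Toeplitz blocks with the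
symbol of `lagCov`, each bounded by `K`. -/
theorem integral_design_mulVec_sum_sq_le [IsProbabilityMeasure P] (h : IsSPHAR P k CZ T Z)
    {ℓ N : ℕ} {v : Fin p → ℝ} {K : ℝ}
    (hK : ∀ z : Circle, (∑' n : ℤ, (lagCov P T ℓ v n : ℂ) * (z : ℂ) ^ n).re ≤ K)
    (w : ObsIndex ℓ N → ℝ) :
    ∫ ω, (∑ q, w q * (designMatrix p T ℓ N ω *ᵥ v) q) ^ 2 ∂P ≤ K * ∑ q, w q ^ 2 := by
  have hs := summable_lagCov (h.coefficient_autoregression ℓ).1 v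
  rw [integral_sum_mul_sq fun q => memLp_design_mulVec h v q]
  simp_rw [integral_design_mulVec_mul h, Fintype.sum_prod_type, mul_ite, mul_zero]
  have e : ∀ (m : Finset.Icc (-(ℓ : ℤ)) (ℓ : ℤ)) (i : Fin N),
      ∑ m', ∑ j, (if m = m' then w (m, i) * w (m', j) *
        lagCov P T ℓ v (obsTime p N i - obsTime p N j) else 0) =
      ∑ j, w (m, i) * w (m, j) * lagCov P T ℓ v (obsTime p N i - obsTime p N j) := fun m i => by
    rw [Finset.sum_eq_single m]
    · simp
    · intro m' _ hm'
      simp [hm'.symm]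
    · simp
  simp_rw [e, Finset.mul_sum]
  refine Finset.sum_le_sum fun m _ => ?_
  rw [← Finset.mul_sum]
  exact sum_mul_mul_le_of_spectral_bound hs hK (obsTime_injective p N) fun i => w (m, i)

theorem bilin_sampleCov {Ω : Type*} (v : EuclideanSpace ℝ (Fin p))
    (T : Sphere2 → ℤ → Ω → ℝ) (ℓ N : ℕ) (ω : Ω) :
    bilin v (sampleCov p T ℓ N ω) v =
      ((N : ℝ) * (2 * ℓ + 1))⁻¹ * ∑ q, (designMatrix p T ℓ N ω *ᵥ v.ofLp) q ^ 2 := by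
  rw [bilin, sampleCov, Matrix.smul_mulVec, dotProduct_smul, smul_eq_mul, ← Matrix.mulVec_mulVec,
    Matrix.dotProduct_mulVec, Matrix.vecMul_transpose]
  simp [dotProduct, sq]

theorem bilin_covMatrix [IsProbabilityMeasure P] (h : IsSPHAR P k CZ T Z)
    (v : EuclideanSpace ℝ (Fin p)) (ℓ : ℕ) :
    bilin v (covMatrix P p T ℓ) v = lagCov P T ℓ v.ofLp 0 := by
  simp only [bilin, covMatrix, lagCov, dotProduct, Matrix.mulVec, h.autocov_apply, Finset.mul_sum]
  refine Finset.sum_congr rfl fun i _ => Finset.sum_congr rfl fun j _ => ?_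
  ring

theorem bilin_sub (u v : EuclideanSpace ℝ (Fin p)) (A B : Matrix (Fin p) (Fin p) ℝ) :
    bilin u (A - B) v = bilin u A v - bilin u B v := by
  rw [bilin, Matrix.sub_mulVec, dotProduct_sub]; rfl

theorem hasGaussianLaw_of_isSPHAR [IsProbabilityMeasure P] (h : IsSPHAR P k CZ T Z) {κ : Type*}
    [Fintype κ] {W : κ → Ω → ℝ}
    (hW : ∀ i, MemGaussSpan P (fun (q : Sphere2 × ℤ) ω => T q.1 q.2 ω) (W i)) :
    HasGaussianLaw (fun ω i => W i ω) P ∧ ∀ i, ∫ ω, W i ω ∂P = 0 := by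
  have h0 : ∀ q : Sphere2 × ℤ, ∫ ω, T q.1 q.2 ω ∂P = 0 := fun q => h.centered q.1 q.2
  let X : Sphere2 × ℤ → Ω → ℝ := fun q ω => T q.1 q.2 ω
  exact ⟨hasGaussianLaw_of_memGaussSpan (X := X) h.gaussian h0 hW,
    fun i => MemGaussSpan.integral_eq_zero (X := X) h0 (hW i)⟩

theorem memGaussSpan_design_mulVec [IsProbabilityMeasure P] (h : IsSPHAR P k CZ T Z) {ℓ N : ℕ}
    (v : Fin p → ℝ) (q : ObsIndex ℓ N) :
    MemGaussSpan P (fun (q : Sphere2 × ℤ) ω => T q.1 q.2 ω)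
      (fun ω => (designMatrix p T ℓ N ω *ᵥ v) q) := by
  have hs := MemGaussSpan.sum (s := Finset.univ) fun (j : Fin p) _ =>
    (h.memGaussSpan_harmCoeff ℓ q.1 (obsTime p N q.2 - ((j : ℕ) + 1 : ℕ))).const_mul (v j)
  refine hs.congr (Eventually.of_forall fun ω => ?_)
  change ∑ j, designMatrix p T ℓ N ω q j * v j = _
  exact Finset.sum_congr rfl fun j _ => mul_comm _ (v j)

theorem measurable_design_mulVec [IsProbabilityMeasure P] (h : IsSPHAR P k CZ T Z) {ℓ N : ℕ}
    (v : Fin p → ℝ) (q : ObsIndex ℓ N) :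
    Measurable fun ω => (designMatrix p T ℓ N ω *ᵥ v) q := by
  simp only [Matrix.mulVec, dotProduct]
  exact Finset.measurable_fun_sum _ fun j _ => (h.measurable_harmCoeff ℓ q.1 _).mul_const _

/-- Deviation bound for the quadratic form of the sample covariance. -/
theorem measure_abs_bilin_gt_le [IsProbabilityMeasure P] (h : IsSPHAR P k CZ T Z) (ℓ : ℕ) {N : ℕ}
    (hN : 1 ≤ N) (v : EuclideanSpace ℝ (Fin p)) {K : ℝ} (hK0 : 0 ≤ K)
    (hK : ∀ z : Circle, (∑' n : ℤ, (lagCov P T ℓ v.ofLp n : ℂ) * (z : ℂ) ^ n).re ≤ K)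
    {η : ℝ} (hη : 0 ≤ η) :
    P.real {ω | |bilin v (sampleCov p T ℓ N ω - covMatrix P p T ℓ) v| > K * η} ≤
      2 * Real.exp (-(1 / 16) * (N * (2 * ℓ + 1)) * min (η ^ 2) η) := by
  have := nonempty_obsIndex ℓ hN
  have hg := hasGaussianLaw_of_isSPHAR h fun q : ObsIndex ℓ N =>
    memGaussSpan_design_mulVec h v.ofLp q
  have hn : (0 : ℝ) < N * (2 * ℓ + 1) := by
    have : (1 : ℝ) ≤ N := by exact_mod_cast hN
    positivity
  have key := measure_abs_sum_sq_sub_gt_le (fun q => measurable_design_mulVec h v.ofLp q) hg.1 hg.2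
    hK0 (integral_design_mulVec_sum_sq_le h hK) hη
  rw [card_obsIndex] at key
  refine le_of_eq_of_le ?_ key
  congr 1
  ext ω
  -- Every row has the same variance `v' Γ_ℓ v`, so centering the sum of squares centers `Γ̂` at
  -- `Γ_ℓ`. Columns have lags `1, …, p` while `stacked` starts at lag `0`; by stationarity only
  -- differences of lags matter.
  have e : ∑ q : ObsIndex ℓ N, ∫ ω, (designMatrix p T ℓ N ω *ᵥ v.ofLp) q ^ 2 ∂P =
      (N * (2 * ℓ + 1)) * lagCov P T ℓ v.ofLp 0 := by
    simp_rw [sq, integral_design_mulVec_mul h, if_true, sub_self]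
    rw [Finset.sum_const, nsmul_eq_mul, Finset.card_univ, card_obsIndex]
  rw [Set.mem_ofPred_eq, Set.mem_ofPred_eq, e, bilin_sub, bilin_sampleCov, bilin_covMatrix h]
  set S := ∑ q, (designMatrix p T ℓ N ω *ᵥ v.ofLp) q ^ 2
  set n : ℝ := N * (2 * ℓ + 1)
  have e2 : S - n * lagCov P T ℓ v.ofLp 0 = n * (n⁻¹ * S - lagCov P T ℓ v.ofLp 0) := by
    field_simp
  rw [e2, abs_mul, abs_of_pos hn, mul_assoc n K, gt_iff_lt, gt_iff_lt, mul_lt_mul_iff_right₀ hn]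

/-- The norm bound `b` is left free because polarization needs `u + v`, with `b = 2`. -/
theorem IsSPHAR.measure_abs_bilin_sparse_gt_le [IsProbabilityMeasure P] (h : IsSPHAR P k CZ T Z)
    (ℓ : ℕ) {N : ℕ} (hN : 1 ≤ N) {r : ℕ} (hr : 1 ≤ r) {v : EuclideanSpace ℝ (Fin p)}
    (hv : IsSparse r v) {b : ℝ} (hb : ‖v‖ ≤ b) {η : ℝ} (hη : 0 ≤ η) :
    P.real {ω | |bilin v (sampleCov p T ℓ N ω - covMatrix P p T ℓ) v| >
        2 * Real.pi * stability P p T ℓ r * b ^ 2 * η} ≤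
      2 * Real.exp (-(1 / 16) * (N * (2 * ℓ + 1)) * min (η ^ 2) η) := by
  have hs := h.stability_nonneg ℓ hr
  have hpi := Real.pi_pos
  refine measure_abs_bilin_gt_le h ℓ hN v (by positivity) (fun z => ?_) hη
  refine (h.spectral_density_lagCov_le ℓ hv z).trans ?_
  gcongr

theorem IsSparse.mono {r s : ℕ} (hrs : r ≤ s) {v : EuclideanSpace ℝ (Fin p)} (hv : IsSparse r v) :
    IsSparse s v := le_trans hv hrs

theorem IsSparse.add {r s : ℕ} {u v : EuclideanSpace ℝ (Fin p)} (hu : IsSparse r u)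
    (hv : IsSparse s v) : IsSparse (r + s) (u + v) := by
  refine le_trans (Set.ncard_le_ncard (t := {i | u i ≠ 0} ∪ {i | v i ≠ 0}) ?_ (Set.toFinite _))
    ((Set.ncard_union_le _ _).trans (add_le_add hu hv))
  intro i hi
  by_contra hc
  simp only [Set.mem_union, Set.mem_ofPred_eq, not_or, not_not] at hc
  simp [hc.1, hc.2] at hi

theorem bilin_polarization {A : Matrix (Fin p) (Fin p) ℝ} (hA : Aᵀ = A)
    (u v : EuclideanSpace ℝ (Fin p)) :
    2 * bilin u A v = bilin (u + v) A (u + v) - bilin u A u - bilin v A v := by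
  have : bilin v A u = bilin u A v := by
    rw [bilin, bilin, Matrix.dotProduct_mulVec, ← Matrix.mulVec_transpose, hA, dotProduct_comm]
  have e : bilin (u + v) A (u + v) = bilin u A u + bilin u A v + (bilin v A u + bilin v A v) := by
    simp only [bilin, WithLp.ofLp_add, Matrix.mulVec_add, add_dotProduct, dotProduct_add]
    ring
  rw [e, this]
  ring

theorem measureReal_le_add_three [IsProbabilityMeasure P] {S A B C : Set Ω} {a : ℝ}
    (hS : S ⊆ A ∪ B ∪ C) (hA : P.real A ≤ 2 * a) (hB : P.real B ≤ 2 * a) (hC : P.real C ≤ 2 * a) :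
    P.real S ≤ 6 * a := by
  have h1 := measureReal_mono hS (measure_ne_top P _)
  have h2 := measureReal_union_le (μ := P) (A ∪ B) C
  have h3 := measureReal_union_le (μ := P) A B
  linarith

theorem IsSPHAR.transpose_sampleCov_sub [IsProbabilityMeasure P] (h : IsSPHAR P k CZ T Z)
    (ℓ N : ℕ) (ω : Ω) : (sampleCov p T ℓ N ω - covMatrix P p T ℓ)ᵀ =
      sampleCov p T ℓ N ω - covMatrix P p T ℓ := by
  rw [Matrix.transpose_sub, sampleCov, Matrix.transpose_smul, Matrix.transpose_mul,
    Matrix.transpose_transpose]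
  congr 1
  ext i j
  rw [Matrix.transpose_apply, covMatrix, h.autocov_apply, h.autocov_apply, ← h.coeffCov_neg]
  congr 1
  ring

/-- Polarization with a union bound: outside three events `|2 u'Av| ≤ 2π ℳ (4 + 1 + 1) η`, which is
twice `6π ℳ η`. The vector `u + v` is only `2r`-sparse, hence `ℳ(f̃_ℓ, 2r)`. -/
theorem IsSPHAR.measure_abs_bilin_pair_gt_le [IsProbabilityMeasure P] (h : IsSPHAR P k CZ T Z)
    (ℓ : ℕ) {N : ℕ} (hN : 1 ≤ N) {r : ℕ} (hr : 1 ≤ r) {u v : EuclideanSpace ℝ (Fin p)}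
    (hu : IsSparse r u) (hv : IsSparse r v) (hu1 : ‖u‖ ≤ 1) (hv1 : ‖v‖ ≤ 1) {η : ℝ} (hη : 0 ≤ η) :
    P.real {ω | |bilin u (sampleCov p T ℓ N ω - covMatrix P p T ℓ) v| >
        6 * Real.pi * stability P p T ℓ (2 * r) * η} ≤
      6 * Real.exp (-(1 / 16) * (N * (2 * ℓ + 1)) * min (η ^ 2) η) := by
  have hr2 : 1 ≤ 2 * r := by omega
  have huv : IsSparse (2 * r) (u + v) := two_mul r ▸ hu.add hv
  have hb : ‖u + v‖ ≤ 2 := (norm_add_le u v).trans (by linarith)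
  refine measureReal_le_add_three ?_
    (h.measure_abs_bilin_sparse_gt_le ℓ hN hr2 huv hb hη)
    (h.measure_abs_bilin_sparse_gt_le ℓ hN hr2 (hu.mono (by omega)) hu1 hη)
    (h.measure_abs_bilin_sparse_gt_le ℓ hN hr2 (hv.mono (by omega)) hv1 hη)
  intro ω hω
  by_contra hc
  simp only [Set.mem_union, Set.mem_ofPred_eq, not_or, not_lt, gt_iff_lt] at hc hω
  have e := bilin_polarization (h.transpose_sampleCov_sub ℓ N ω) u v
  obtain ⟨⟨h1, h2⟩, h3⟩ := hc
  rw [abs_le] at h1 h2 h3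
  have h4 : |bilin u (sampleCov p T ℓ N ω - covMatrix P p T ℓ) v| ≤
      6 * Real.pi * stability P p T ℓ (2 * r) * η := by
    rw [abs_le]
    constructor <;> linarith
  linarith

theorem bilin_single (A : Matrix (Fin p) (Fin p) ℝ) (i j : Fin p) :
    bilin (EuclideanSpace.single i 1) A (EuclideanSpace.single j 1) = A i j := by
  simp [bilin]

/-- Deviation bound for the cross products of lagged observations and noise. -/
theorem IsSPHAR.measure_abs_empComponent_gt_le [IsProbabilityMeasure P] (h : IsSPHAR P k CZ T Z)
    (ℓ : ℕ) {N : ℕ} (hN : 1 ≤ N) {lag : ℕ} (h1 : 1 ≤ lag) (hp : lag ≤ p) {η : ℝ} (hη : 0 ≤ η) :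
    P.real {ω | |empComponent p T Z ℓ N lag ω| >
        2 * Real.pi * (CZ ℓ * (1 + (1 + muMax k ℓ) / muMin k ℓ)) * η} ≤
      6 * Real.exp (-(1 / 16) * (N * (2 * ℓ + 1)) * min (η ^ 2) η) := by
  have := nonempty_obsIndex ℓ hN
  have hn : (0 : ℝ) < N * (2 * ℓ + 1) := by
    have : (1 : ℝ) ≤ N := by exact_mod_cast hN
    positivity
  have hC := h.noise.power_pos ℓ
  have hμ := h.muMin_pos ℓ
  have hμ' := muMax_nonneg k ℓ
  let X : Sphere2 × ℤ → Ω → ℝ := fun q ω => T q.1 q.2 ω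
  let Y : ObsIndex ℓ N → Ω → ℝ := fun q ω => laggedObs p T ℓ N lag ω q
  let E : ObsIndex ℓ N → Ω → ℝ := fun q ω => noiseObs p Z ℓ N ω q
  have hYs : ∀ q, MemGaussSpan P X (Y q) := fun q => h.memGaussSpan_harmCoeff ℓ q.1 _
  -- By the autoregressive equation the noise coefficient is almost surely a finite combination of
  -- coefficients of `T`; this gives joint Gaussianity with `Y`.
  have hEs : ∀ q, MemGaussSpan P X (E q) := fun q => by
    have hs := (h.memGaussSpan_harmCoeff ℓ q.1 (obsTime p N q.2)).add
      ((MemGaussSpan.sum (s := Finset.univ) fun (j : Fin p) _ =>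
        (h.memGaussSpan_harmCoeff ℓ q.1 (obsTime p N q.2 - ((j : ℕ) + 1))).const_mul
          (kernelCoeff (k j) ℓ)).const_mul (-1))
    refine hs.congr ?_
    filter_upwards [h.harmCoeff_equation ℓ q.1 (obsTime p N q.2) (natAbs_le_of_obsIndex q)] with ω e
    simp only [E, noiseObs]
    rw [e]
    ring
  have hSs : ∀ q, MemGaussSpan P X fun ω => Y q ω + E q ω := fun q => (hYs q).add (hEs q)
  have hYm : ∀ q, Measurable (Y q) := fun q => h.measurable_harmCoeff ℓ q.1 _
  have hEm : ∀ q, Measurable (E q) := fun q => h.measurable_harmCoeff_noise ℓ q.1 _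
  have hYQ : ∀ w : ObsIndex ℓ N → ℝ, ∫ ω, (∑ q, w q * Y q ω) ^ 2 ∂P ≤
      CZ ℓ / muMin k ℓ * ∑ q, w q ^ 2 := fun w => by
    -- Column `j` of the design matrix has lag `j + 1`.
    let j : Fin p := ⟨lag - 1, by omega⟩
    have := integral_design_mulVec_sum_sq_le h (N := N)
      (v := (EuclideanSpace.single j (1 : ℝ)).ofLp) (K := CZ ℓ / muMin k ℓ)
      (fun z => by simp_rw [lagCov_single]; exact h.spectral_density_le ℓ z) w
    have e : ∀ ω q, (designMatrix p T ℓ N ω *ᵥ (EuclideanSpace.single j (1 : ℝ)).ofLp) q = Y q ω := by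
      intro ω q
      simp [designMatrix, Y, j, Nat.sub_add_cancel h1]
    simp_rw [e] at this
    exact this
  have hEE : ∀ q q', ∫ ω, E q ω * E q' ω ∂P = if q = q' then CZ ℓ else 0 := fun q q' => by
    simp only [E, noiseObs]
    rw [h.noise.integral_harmCoeff_mul ℓ q.1 q'.1 _ _ (natAbs_le_of_obsIndex q)]
    simp only [Subtype.coe_inj, (obsTime_injective p N).eq_iff, Prod.ext_iff]
  have hEQ : ∀ w : ObsIndex ℓ N → ℝ, ∫ ω, (∑ q, w q * E q ω) ^ 2 ∂P ≤
      CZ ℓ * ∑ q, w q ^ 2 := fun w => by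
    rw [integral_sum_mul_sq fun q => (hEs q).memLp]
    simp_rw [hEE, mul_ite, mul_zero, Finset.sum_ite_eq, Finset.mem_univ, if_true, Finset.mul_sum]
    exact (Finset.sum_congr rfl fun q _ => by ring).le
  have hSQ : ∀ w : ObsIndex ℓ N → ℝ, ∫ ω, (∑ q, w q * (Y q ω + E q ω)) ^ 2 ∂P ≤
      (2 * (CZ ℓ / muMin k ℓ + CZ ℓ)) * ∑ q, w q ^ 2 := fun w => by
    have i1 := (memLp_finsetSum Finset.univ fun q _ => (hYs q).memLp.const_mul (w q)).integrable_sq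
    have i2 := (memLp_finsetSum Finset.univ fun q _ => (hEs q).memLp.const_mul (w q)).integrable_sq
    calc ∫ ω, (∑ q, w q * (Y q ω + E q ω)) ^ 2 ∂P
        ≤ ∫ ω, (2 * (∑ q, w q * Y q ω) ^ 2 + 2 * (∑ q, w q * E q ω) ^ 2) ∂P := by
          refine integral_mono_of_nonneg (Eventually.of_forall fun ω => sq_nonneg _)
            ((i1.const_mul 2).add (i2.const_mul 2)) (Eventually.of_forall fun ω => ?_)
          simp only [mul_add, Finset.sum_add_distrib]
          nlinarith [sq_nonneg (∑ q, w q * Y q ω - ∑ q, w q * E q ω)]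
      _ = 2 * ∫ ω, (∑ q, w q * Y q ω) ^ 2 ∂P + 2 * ∫ ω, (∑ q, w q * E q ω) ^ 2 ∂P := by
          rw [integral_add (i1.const_mul 2) (i2.const_mul 2), integral_const_mul,
            integral_const_mul]
      _ ≤ _ := by linarith [hYQ w, hEQ w]
  have gY := hasGaussianLaw_of_isSPHAR h hYs
  have gE := hasGaussianLaw_of_isSPHAR h hEs
  have gS := hasGaussianLaw_of_isSPHAR h hSs
  have kY := measure_abs_sum_sq_sub_gt_le hYm gY.1 gY.2 (by positivity) hYQ hη
  have kE := measure_abs_sum_sq_sub_gt_le hEm gE.1 gE.2 hC.le hEQ hη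
  have kS := measure_abs_sum_sq_sub_gt_le (W := fun q ω => Y q ω + E q ω)
    (fun q => (hYm q).add (hEm q)) gS.1 gS.2 (by positivity) hSQ hη
  rw [card_obsIndex] at kY kE kS
  refine measureReal_le_add_three ?_ kS kY kE
  have hYE : ∀ q, ∫ ω, (Y q ω + E q ω) ^ 2 ∂P = ∫ ω, Y q ω ^ 2 ∂P + ∫ ω, E q ω ^ 2 ∂P := by
    intro q
    have i0 : Integrable (fun ω => Y q ω * E q ω) P := (hYs q).memLp.integrable_mul (hEs q).memLp
    have i1 := (hYs q).memLp.integrable_sq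
    have i2 := (hEs q).memLp.integrable_sq
    -- Causality enters here: since `lag ≥ 1`, `Y q` precedes the noise `E q`.
    have h0 : ∫ ω, Y q ω * E q ω ∂P = 0 := (h.coefficient_autoregression ℓ).2.1 q.1
      (natAbs_le_of_obsIndex q) _ _ (by simp; omega)
    have e : ∀ ω, (Y q ω + E q ω) ^ 2 = Y q ω ^ 2 + E q ω ^ 2 + 2 * (Y q ω * E q ω) := fun ω => by
      ring
    simp_rw [e]
    have i3 : Integrable (fun ω => Y q ω ^ 2 + E q ω ^ 2) P := i1.add i2
    rw [integral_add i3 (i0.const_mul 2), integral_add i1 i2, integral_const_mul, h0]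
    ring
  intro ω hω
  by_contra hc
  simp only [Set.mem_union, Set.mem_ofPred_eq, not_or, not_lt, gt_iff_lt] at hc hω
  obtain ⟨⟨b1, b2⟩, b3⟩ := hc
  have hsum : ∑ q, (Y q ω + E q ω) ^ 2 - ∑ q, ∫ ω, (Y q ω + E q ω) ^ 2 ∂P =
      (∑ q, Y q ω ^ 2 - ∑ q, ∫ ω, Y q ω ^ 2 ∂P) + (∑ q, E q ω ^ 2 - ∑ q, ∫ ω, E q ω ^ 2 ∂P) +
        2 * (laggedObs p T ℓ N lag ω ⬝ᵥ noiseObs p Z ℓ N ω) := by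
    have e : ∀ q, (Y q ω + E q ω) ^ 2 = Y q ω ^ 2 + E q ω ^ 2 + 2 * (Y q ω * E q ω) := fun q => by
      ring
    simp_rw [hYE, e, Finset.sum_add_distrib, ← Finset.mul_sum]
    simp only [dotProduct, Y, E]
    ring
  rw [hsum] at b1
  rw [empComponent, abs_div, abs_of_pos hn, lt_div_iff₀ hn] at hω
  set D := laggedObs p T ℓ N lag ω ⬝ᵥ noiseObs p Z ℓ N ω
  set n : ℝ := N * (2 * ℓ + 1)
  set κ := CZ ℓ / muMin k ℓ with hκ
  have hκ0 : 0 < κ := by positivity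
  -- The bounds `2(κ + C)`, `κ` and `C` for `Y + E`, `Y` and `E` add up to `3(κ + C)`, which
  -- controls `2D`.
  have hD : |D| ≤ n * (3 / 2 * (κ + CZ ℓ)) * η := by
    rw [abs_le] at b1 b2 b3 ⊢
    constructor <;> linarith
  -- The stated constant is generous: `3/2 < 2π`, and the `muMax` term is nonnegative.
  have hle : 3 / 2 * (κ + CZ ℓ) ≤ 2 * Real.pi * (CZ ℓ * (1 + (1 + muMax k ℓ) / muMin k ℓ)) := by
    have e : CZ ℓ * (1 + (1 + muMax k ℓ) / muMin k ℓ) = CZ ℓ + κ + κ * muMax k ℓ := by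
      rw [hκ]
      ring
    have h0 : 0 ≤ κ * muMax k ℓ := by positivity
    rw [e]
    nlinarith [Real.pi_gt_three]
  have := mul_le_mul_of_nonneg_left hle (mul_nonneg hn.le hη)
  linarith

end Deviation

end SphericalAR

end

/-! ### Assembly of the deviation bounds. -/

theorem mainTheorem5 :
    ∃ c : ℝ, 0 < c ∧
      ∀ (Ω : Type*) [MeasurableSpace Ω] (P : Measure Ω) [IsProbabilityMeasure P]
        (p : ℕ) (k : Fin p → ℝ → ℝ) (CZ : ℕ → ℝ) (T Z : SphericalAR.Sphere2 → ℤ → Ω → ℝ),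
        SphericalAR.IsSPHAR P k CZ T Z →
        ∀ (ℓ N : ℕ), 1 ≤ N → ∀ η : ℝ, 0 ≤ η →
          (∀ r : ℕ, 1 ≤ r → ∀ u v : EuclideanSpace ℝ (Fin p),
            SphericalAR.IsSparse r u → SphericalAR.IsSparse r v → ‖u‖ ≤ 1 → ‖v‖ ≤ 1 →
            P.real {ω | |SphericalAR.bilin v
                    (SphericalAR.sampleCov p T ℓ N ω - SphericalAR.covMatrix P p T ℓ) v|
                  > 2 * Real.pi * SphericalAR.stability P p T ℓ r * η}
                ≤ 2 * Real.exp (-c * (N * (2 * ℓ + 1)) * min (η ^ 2) η) ∧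
            P.real {ω | |SphericalAR.bilin u
                    (SphericalAR.sampleCov p T ℓ N ω - SphericalAR.covMatrix P p T ℓ) v|
                  > 6 * Real.pi * SphericalAR.stability P p T ℓ (2 * r) * η}
                ≤ 6 * Real.exp (-c * (N * (2 * ℓ + 1)) * min (η ^ 2) η)) ∧
          (∀ i j : Fin p,
            P.real {ω | |(SphericalAR.sampleCov p T ℓ N ω - SphericalAR.covMatrix P p T ℓ) i j|
                  > 6 * Real.pi * SphericalAR.stability P p T ℓ 2 * η}
                ≤ 6 * Real.exp (-c * (N * (2 * ℓ + 1)) * min (η ^ 2) η)) ∧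
          (∀ h : ℕ, 1 ≤ h → h ≤ p →
            P.real {ω | |SphericalAR.empComponent p T Z ℓ N h ω|
                  > 2 * Real.pi * (CZ ℓ *
                      (1 + (1 + SphericalAR.muMax k ℓ) / SphericalAR.muMin k ℓ)) * η}
                ≤ 6 * Real.exp (-c * (N * (2 * ℓ + 1)) * min (η ^ 2) η)) := by
  -- The constant of `measure_abs_sum_sq_sub_gt_le`, which polarization leaves unchanged.
  refine ⟨1 / 16, by norm_num, ?_⟩
  intro Ω _ P _ p k CZ T Z h ℓ N hN η hη
  refine ⟨fun r hr u v hu hv hu1 hv1 => ⟨?_, ?_⟩, fun i j => ?_, fun lag h1 hp => ?_⟩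
  · have := h.measure_abs_bilin_sparse_gt_le ℓ hN hr hv hv1 hη
    rwa [one_pow, mul_one] at this
  · exact h.measure_abs_bilin_pair_gt_le ℓ hN hr hu hv hu1 hv1 hη
  -- Basis vectors are `1`-sparse of norm one, so entries are the case `r = 1`.
  · have := h.measure_abs_bilin_pair_gt_le ℓ hN le_rfl (SphericalAR.isSparse_single le_rfl i)
      (SphericalAR.isSparse_single le_rfl j) (by simp) (by simp) hη
    simpa only [SphericalAR.bilin_single, mul_one] using this
  · exact h.measure_abs_empComponent_gt_le ℓ hN h1 hp hη
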